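/- Let $\Sigma$ be a compact Riemann surface with (possibly empty) boundary, or more generally a compact oriented smooth surface with boundary. A \emph{bundle pair} $(E,L)\to(\Sigma,\partial\Sigma)$ is a smooth symplectic vector bundle $(E,\omega)$ over $\Sigma$ together with a smooth Lagrangian subbundle $L$ of $E|_{\partial\Sigma}$. A \emph{compatible complex structure} is a smooth $J\in\Gamma(\mathrm{End}(E))$ with $J^2=-\mathrm{id}$ such that $\omega(J\cdot,J\cdot)=\omega$ and $g_J=\omega(\cdot,J\cdot)$ is positive definite; it makes $E$ a complex vector bundle with Hermitian metric $g_J+\sqrt{-1}\,\omega$. An \emph{orthogonal connection} for $(E,L,J)$ is a smooth connection $\nabla$ of the complex vector bundle $(E,J)$ whose restriction to $\partial\Sigma$ is unitary (compatible with $g_J+\sqrt{-1}\,\omega$) and $L$-orthogonal, that is, its parallel transport along $\partial\Sigma$ preserves $L$. The Chern--Weil Maslov index of $(E,L)$ computed with $J$ and such a connection $\nabla$ is $$\mu_{CW}(E,L;J,\nabla)=\frac{\sqrt{-1}}{\pi}\int_\Sigma \mathrm{tr}_{\mathbb C}(F_\nabla),$$ where $F_\nabla\in\Omega^2(\Sigma,\mathrm{End}(E))$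 is the curvature of $\nabla$ and the complex trace is taken with respect to $J$. \textbf{Corollary.} The Maslov index $\mu_{CW}(E,L)$ of a bundle pair $(E,L)$ does not depend on the compatible complex structure: if $J_0$ and $J_1$ are compatible complex structures on $E$, and $\nabla_0$ and $\nabla_1$ are orthogonal connections for $(E,L,J_0)$ and $(E,L,J_1)$ respectively, then $$\frac{\sqrt{-1}}{\pi}\int_\Sigma \mathrm{tr}_{\mathbb C}(F_{\nabla_0})=\frac{\sqrt{-1}}{\pi}\int_\Sigma \mathrm{tr}_{\mathbb C}(F_{\nabla_1}).$$ -/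

import Mathlib

open Bundle Set
open scoped Manifold ContDiff Topology

noncomputable section

namespace ChernWeilMaslov

/-! ### Oriented surfaces with boundary and integration of two-forms

A surface with boundary is a manifold `M` modelled on the half-plane
`EuclideanHalfSpace 2 = {x ∈ ℝ² | 0 ≤ x 0}`, with model with corners `𝓡∂ 2`. -/

section Surface

variable (M : Type*) [TopologicalSpace M] [ChartedSpace (EuclideanHalfSpace 2) M]

/-- The atlas of the surface `M` is oriented: every change of coordinates between two charts of the
atlas has positive Jacobian determinant. Such an atlas is an orientation of `M`. The charts of a
Riemann surface with boundary form such an atlas. -/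
def IsOriented : Prop :=
  ∀ e ∈ atlas (EuclideanHalfSpace 2) M, ∀ e' ∈ atlas (EuclideanHalfSpace 2) M,
    ∀ p ∈ e.source ∩ e'.source,
      0 < (fderivWithin ℝ (e'.extend (𝓡∂ 2) ∘ (e.extend (𝓡∂ 2)).symm) (range (𝓡∂ 2))
        (e.extend (𝓡∂ 2) p)).det

variable {M}

/-- The tangent space of the boundary at a boundary point `x`. Mathlib represents tangent vectors
at `x` by their coordinates in the preferred chart at `x`, in which the boundary is the line where
the coordinate of index `0` vanishes. -/
def boundaryTangentSpace (x : M) : Submodule ℝ (TangentSpace (𝓡∂ 2) x) :=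
  LinearMap.ker (EuclideanSpace.proj (0 : Fin 2) : EuclideanSpace ℝ (Fin 2) →L[ℝ] ℝ).toLinearMap

/-- The coordinate vector field `∂ᵢ` of the preferred chart at `p`, at the point with coordinates
`z` in this chart. -/
def coordinateVector (p : M) (z : EuclideanSpace ℝ (Fin 2)) (i : Fin 2) :
    TangentSpace (𝓡∂ 2) ((extChartAt (𝓡∂ 2) p).symm z) :=
  mfderivWithin 𝓘(ℝ, EuclideanSpace ℝ (Fin 2)) (𝓡∂ 2) (extChartAt (𝓡∂ 2) p).symm
    (range (𝓡∂ 2)) z (EuclideanSpace.single i (1 : ℝ) : EuclideanSpace ℝ (Fin 2))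

variable (M) in
/-- A smooth partition of unity subordinate to the domains of the preferred charts. -/
def chartPartition [IsManifold (𝓡∂ 2) ∞ M] [T2Space M] [CompactSpace M] :
    SmoothPartitionOfUnity M (𝓡∂ 2) M univ :=
  (SmoothPartitionOfUnity.exists_isSubordinate_chartAt_source (𝓡∂ 2) M).choose

/-- The integral of a complex-valued two-form `η` over a compact oriented surface, computed in the
charts with a partition of unity: the sum over `p` of the integrals of `ρ_p η(∂₀, ∂₁)` over the
coordinate domain of the chart at `p` (all but finitely many of them vanish). -/
def surfaceIntegral [IsManifold (𝓡∂ 2) ∞ M] [T2Space M] [CompactSpace M]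
    (η : ∀ x : M, TangentSpace (𝓡∂ 2) x → TangentSpace (𝓡∂ 2) x → ℂ) : ℂ :=
  ∑ᶠ p : M, ∫ z in (extChartAt (𝓡∂ 2) p).target,
    ((chartPartition M p ((extChartAt (𝓡∂ 2) p).symm z) : ℝ) : ℂ) *
      η ((extChartAt (𝓡∂ 2) p).symm z) (coordinateVector p z 0) (coordinateVector p z 1)

end Surface

/-! ### Trace of a complex-linear endomorphism -/

section Trace

/-- The complex trace of an endomorphism `A` of a real vector space with complex structure `J`, for
`A` commuting with `J` (see `complexTrace_eq_trace`). -/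
def complexTrace {V : Type*} [AddCommGroup V] [Module ℝ V] (J A : V →ₗ[ℝ] V) : ℂ :=
  ((LinearMap.trace ℝ V A : ℂ) - Complex.I * (LinearMap.trace ℝ V (J ∘ₗ A) : ℂ)) / 2

/-- When `J` is multiplication by the imaginary unit of a complex vector space, `complexTrace` is
the trace of complex-linear endomorphisms. -/
theorem complexTrace_eq_trace {V : Type*} [AddCommGroup V] [Module ℝ V] [Module ℂ V]
    [IsScalarTower ℝ ℂ V] [FiniteDimensional ℂ V] (J : V →ₗ[ℝ] V)
    (hJ : ∀ v, J v = Complex.I • v) (A : V →ₗ[ℂ] V) :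
    complexTrace J (A.restrictScalars ℝ) = LinearMap.trace ℂ V A := by
  have key : ∀ B : V →ₗ[ℂ] V, LinearMap.trace ℝ V (B.restrictScalars ℝ)
      = 2 * (LinearMap.trace ℂ V B).re := by
    intro B
    let b := Module.finBasis ℂ V
    rw [LinearMap.trace_eq_matrix_trace ℂ b B,
      LinearMap.trace_eq_matrix_trace ℝ (Complex.basisOneI.smulTower b)]
    simp only [Matrix.trace, Matrix.diag, LinearMap.toMatrix_apply, Fintype.sum_prod_type,
      Fin.sum_univ_two, Module.Basis.smulTower_repr, Module.Basis.smulTower_apply,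
      Complex.coe_basisOneI_repr, Complex.coe_basisOneI, LinearMap.coe_restrictScalars,
      map_smul, Finsupp.smul_apply, Complex.re_sum]
    simp
    ring
  have hJA : J ∘ₗ A.restrictScalars ℝ = (Complex.I • A).restrictScalars ℝ := by
    ext v
    simp [hJ]
  rw [complexTrace, hJA, key, key, map_smul]
  apply Complex.ext <;> simp

end Trace

/-! ### Bundle pairs -/

section BundlePair

variable {M : Type*} [TopologicalSpace M] [ChartedSpace (EuclideanHalfSpace 2) M]
  [IsManifold (𝓡∂ 2) ∞ M]
  (F : Type*) [NormedAddCommGroup F] [NormedSpace ℝ F]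
  (E : M → Type*) [TopologicalSpace (TotalSpace F E)] [∀ x, AddCommGroup (E x)]
  [∀ x, Module ℝ (E x)] [∀ x, TopologicalSpace (E x)] [∀ x, IsTopologicalAddGroup (E x)]
  [∀ x, ContinuousSMul ℝ (E x)] [FiberBundle F E] [VectorBundle ℝ F E]

/-- A smooth symplectic structure `ω` on the real vector bundle `E`. -/
structure SymplecticStructure where
  form : ∀ x, E x →L[ℝ] E x →L[ℝ] ℝ
  contMDiff_form : ContMDiff (𝓡∂ 2) ((𝓡∂ 2).prod 𝓘(ℝ, F →L[ℝ] F →L[ℝ] ℝ)) ∞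
    (fun x ↦ TotalSpace.mk' (F →L[ℝ] F →L[ℝ] ℝ) x (form x))
  self_eq_zero : ∀ x v, form x v v = 0
  nondegenerate : ∀ x v, (∀ w, form x v w = 0) → v = 0

variable {F E}

/-- A smooth Lagrangian subbundle `L` of `E` over the boundary: each fibre is equal to its own
symplectic orthogonal, and near each boundary point `L` has a smooth frame. -/
structure LagrangianSubbundle (Ω : SymplecticStructure F E) where
  fiber : ∀ x : (𝓡∂ 2).boundary M, Submodule ℝ (E x)
  lagrangian : ∀ x v, v ∈ fiber x ↔ ∀ w ∈ fiber x, Ω.form x v w = 0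
  exists_frame : ∀ x : (𝓡∂ 2).boundary M, ∃ U ∈ 𝓝 (x : M), ∃ (k : ℕ) (s : Fin k → ∀ y, E y),
    (∀ i, ContMDiffOn (𝓡∂ 2) ((𝓡∂ 2).prod 𝓘(ℝ, F)) ∞ (fun y ↦ TotalSpace.mk' F y (s i y)) U) ∧
    ∀ y : (𝓡∂ 2).boundary M, (y : M) ∈ U →
      LinearIndependent ℝ (fun i ↦ s i y) ∧ Submodule.span ℝ (range fun i ↦ s i y) = fiber y

/-- A smooth complex structure `J` on `E` compatible with `ω`: `ω(Jv, Jw) = ω(v, w)` and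
`ω(v, Jv) > 0` for `v ≠ 0`. -/
structure CompatibleComplexStructure (Ω : SymplecticStructure F E) where
  J : ∀ x, E x →L[ℝ] E x
  contMDiff_J : ContMDiff (𝓡∂ 2) ((𝓡∂ 2).prod 𝓘(ℝ, F →L[ℝ] F)) ∞
    (fun x ↦ TotalSpace.mk' (F →L[ℝ] F) x (J x))
  sq_eq_neg : ∀ x v, J x (J x v) = -v
  form_map : ∀ x v w, Ω.form x (J x v) (J x w) = Ω.form x v w
  form_pos : ∀ x v, v ≠ 0 → 0 < Ω.form x v (J x v)

/-- The Hermitian inner product `g + i ω`, where `g(v, w) = ω(v, Jw)`. -/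
def CompatibleComplexStructure.hermitian {Ω : SymplecticStructure F E}
    (𝒥 : CompatibleComplexStructure Ω) (x : M) (v w : E x) : ℂ :=
  (Ω.form x v (𝒥.J x w) : ℂ) + Complex.I * (Ω.form x v w : ℂ)

end BundlePair

/-! ### Connections and curvature -/

section Connection

variable {M : Type*} [TopologicalSpace M] [ChartedSpace (EuclideanHalfSpace 2) M]
  [IsManifold (𝓡∂ 2) ∞ M]
  {F : Type*} [NormedAddCommGroup F] [NormedSpace ℝ F]
  {E : M → Type*} [TopologicalSpace (TotalSpace F E)] [∀ x, AddCommGroup (E x)]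
  [∀ x, Module ℝ (E x)] [∀ x, TopologicalSpace (E x)] [∀ x, IsTopologicalAddGroup (E x)]
  [∀ x, ContinuousSMul ℝ (E x)] [FiberBundle F E] [VectorBundle ℝ F E]
  [ContMDiffVectorBundle ∞ F E (𝓡∂ 2)]

/-- `∇_X ∇_Y s - ∇_Y ∇_X s - ∇_[X,Y] s` at the point `x`. -/
def curvatureAux (D : CovariantDerivative (𝓡∂ 2) F E) (X Y : ∀ y : M, TangentSpace (𝓡∂ 2) y)
    (s : ∀ y, E y) (x : M) : E x :=
  D (fun y ↦ D s y (Y y)) x (X x) - D (fun y ↦ D s y (X y)) x (Y x)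
    - D s x (VectorField.mlieBracket (𝓡∂ 2) X Y x)

variable (F) in
/-- Extension of a vector of the fibre at `x` to a section that is constant in the preferred local
trivialization at `x`, and `0` outside the domain of this trivialization. -/
def localExtension {x : M} : E x →ₗ[ℝ] ∀ y, E y :=
  LinearMap.pi fun y ↦ ((trivializationAt F E x).symmL ℝ y).toLinearMap ∘ₗ
    ((trivializationAt F E x).continuousLinearMapAt ℝ x).toLinearMap

theorem contMDiffOn_localExtension {x : M} (e : E x) :
    ∃ U ∈ 𝓝 x, ContMDiffOn (𝓡∂ 2) ((𝓡∂ 2).prod 𝓘(ℝ, F)) ∞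
      (fun y ↦ TotalSpace.mk' F y (localExtension F e y)) U := by
  have hx := FiberBundle.mem_baseSet_trivializationAt F E x
  obtain ⟨U, hU, hs⟩ := FiberBundle.exists_contMDiffOn_extend (𝓡∂ 2) F e (k := ∞)
  refine ⟨U ∩ (trivializationAt F E x).baseSet,
    Filter.inter_mem hU ((trivializationAt F E x).open_baseSet.mem_nhds hx),
    (hs.mono inter_subset_left).congr fun y hy ↦ ?_⟩
  congr 1
  simp [localExtension, FiberBundle.extend, hx, hy.2]

/-- A smooth connection maps a section and a vector field that are smooth near a point to a section
that is differentiable there. -/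
theorem mdifferentiableAt_connection [T2Space M]
    (D : CovariantDerivative (𝓡∂ 2) F E)
    (hD : CovariantDerivative.ContMDiffCovariantDerivative D ∞) {x : M}
    {s : ∀ y, E y} {X : ∀ y : M, TangentSpace (𝓡∂ 2) y} {U : Set M} (hU : U ∈ 𝓝 x)
    (hs : ContMDiffOn (𝓡∂ 2) ((𝓡∂ 2).prod 𝓘(ℝ, F)) ∞ (fun y ↦ TotalSpace.mk' F y (s y)) U)
    (hX : MDifferentiableAt (𝓡∂ 2) ((𝓡∂ 2).prod 𝓘(ℝ, EuclideanSpace ℝ (Fin 2)))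
      (fun y ↦ TotalSpace.mk' (EuclideanSpace ℝ (Fin 2)) y (X y)) x) :
    MDifferentiableAt (𝓡∂ 2) ((𝓡∂ 2).prod 𝓘(ℝ, F))
      (fun y ↦ TotalSpace.mk' F y (D s y (X y))) x := by
  obtain ⟨f, hf⟩ := (SmoothBumpFunction.nhds_basis_tsupport (I := 𝓡∂ 2) x).mem_iff.1
    (interior_mem_nhds.2 hU)
  have h1 := ContMDiffOn.smul_section_of_tsupport (V := E) (F := F) (s := s)
    f.contMDiff.contMDiffOn isOpen_interior hf.2 (hs.mono interior_subset)
  have h2 := hD.contMDiff.contMDiff (σ := (f : M → ℝ) • s) (by simpa using h1.contMDiffOn)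
  have h3 := (h2.contMDiffAt (x := x) Filter.univ_mem).mdifferentiableAt (by simp)
  have h4 := MDifferentiableAt.clm_bundle_apply h3 hX
  refine h4.congr_of_eventuallyEq ?_
  have hev : ∀ᶠ y in 𝓝 x, ∀ᶠ z in 𝓝 y, f z = 1 := f.eventuallyEq_one.eventually_nhds
  filter_upwards [hev, eventually_mem_nhds_iff.2 hU] with y hy hyU
  have hsy := (hs.contMDiffAt hyU).mdifferentiableAt (by simp)
  have : D s y = D ((f : M → ℝ) • s) y := by
    refine D.isCovariantDerivativeOnUniv.congr_of_eventuallyEq hsy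
      (h1.contMDiffAt.mdifferentiableAt (by simp)) Filter.univ_mem ?_
    filter_upwards [hy] with z hz
    simp [hz]
  rw [this]

/-- The curvature `F(u, v)` of a smooth connection at the point `x`, as an endomorphism of the
fibre. It is computed with the extensions of `u`, `v` and of fibre vectors that are constant in the
preferred local trivialization at `x`. -/
def curvature [T2Space M] (D : CovariantDerivative (𝓡∂ 2) F E)
    (hD : CovariantDerivative.ContMDiffCovariantDerivative D ∞)
    (x : M) (u v : TangentSpace (𝓡∂ 2) x) : E x →ₗ[ℝ] E x where
  toFun e := curvatureAux D (FiberBundle.extend (EuclideanSpace ℝ (Fin 2)) u)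
    (FiberBundle.extend (EuclideanSpace ℝ (Fin 2)) v) (localExtension F e) x
  map_add' e e' := by
    obtain ⟨U, hU, hs⟩ := contMDiffOn_localExtension (F := F) e
    obtain ⟨U', hU', hs'⟩ := contMDiffOn_localExtension (F := F) e'
    have key : ∀ w : TangentSpace (𝓡∂ 2) x,
        D (fun y ↦ D (localExtension F (e + e')) y
            (FiberBundle.extend (EuclideanSpace ℝ (Fin 2)) w y)) x
          = D (fun y ↦ D (localExtension F e) y
              (FiberBundle.extend (EuclideanSpace ℝ (Fin 2)) w y)) x
            + D (fun y ↦ D (localExtension F e') y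
              (FiberBundle.extend (EuclideanSpace ℝ (Fin 2)) w y)) x := by
      intro w
      have hw := FiberBundle.mdifferentiableAt_extend (𝓡∂ 2) (EuclideanSpace ℝ (Fin 2)) w
      have d1 := mdifferentiableAt_connection D hD hU hs hw
      have d2 := mdifferentiableAt_connection D hD hU' hs' hw
      rw [← D.isCovariantDerivativeOnUniv.add d1 d2]
      have d3 := mdifferentiableAt_add_section d1 d2
      have hev : ∀ᶠ y in 𝓝 x, D (localExtension F (e + e')) y
            (FiberBundle.extend (EuclideanSpace ℝ (Fin 2)) w y)
          = D (localExtension F e) y (FiberBundle.extend (EuclideanSpace ℝ (Fin 2)) w y)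
            + D (localExtension F e') y
              (FiberBundle.extend (EuclideanSpace ℝ (Fin 2)) w y) := by
        filter_upwards [eventually_mem_nhds_iff.2 hU, eventually_mem_nhds_iff.2 hU'] with y hy hy'
        rw [map_add, D.isCovariantDerivativeOnUniv.add
          ((hs.contMDiffAt hy).mdifferentiableAt (by simp))
          ((hs'.contMDiffAt hy').mdifferentiableAt (by simp))]
        rfl
      refine D.isCovariantDerivativeOnUniv.congr_of_eventuallyEq ?_ d3 Filter.univ_mem hev
      exact d3.congr_of_eventuallyEq (hev.mono fun y hy ↦ congrArg (TotalSpace.mk' F y) hy)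
    have h0 := D.isCovariantDerivativeOnUniv.add
      ((hs.contMDiffAt hU).mdifferentiableAt (by simp))
      ((hs'.contMDiffAt hU').mdifferentiableAt (by simp))
    simp only [curvatureAux, key]
    rw [map_add, h0]
    simp only [add_apply]
    abel
  map_smul' c e := by
    obtain ⟨U, hU, hs⟩ := contMDiffOn_localExtension (F := F) e
    have key : ∀ w : TangentSpace (𝓡∂ 2) x,
        D (fun y ↦ D (localExtension F (c • e)) y
            (FiberBundle.extend (EuclideanSpace ℝ (Fin 2)) w y)) x
          = c • D (fun y ↦ D (localExtension F e) y
              (FiberBundle.extend (EuclideanSpace ℝ (Fin 2)) w y)) x := by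
      intro w
      have hw := FiberBundle.mdifferentiableAt_extend (𝓡∂ 2) (EuclideanSpace ℝ (Fin 2)) w
      have d1 := mdifferentiableAt_connection D hD hU hs hw
      rw [← D.isCovariantDerivativeOnUniv.smul_const c d1]
      have d3 := (mdifferentiableAt_const (c := c)).smul_section d1
      have hev : ∀ᶠ y in 𝓝 x, D (localExtension F (c • e)) y
            (FiberBundle.extend (EuclideanSpace ℝ (Fin 2)) w y)
          = c • D (localExtension F e) y
            (FiberBundle.extend (EuclideanSpace ℝ (Fin 2)) w y) := by
        filter_upwards [eventually_mem_nhds_iff.2 hU] with y hy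
        rw [map_smul, D.isCovariantDerivativeOnUniv.smul_const c
          ((hs.contMDiffAt hy).mdifferentiableAt (by simp))]
        rfl
      refine D.isCovariantDerivativeOnUniv.congr_of_eventuallyEq ?_ d3 Filter.univ_mem hev
      exact d3.congr_of_eventuallyEq (hev.mono fun y hy ↦ congrArg (TotalSpace.mk' F y) hy)
    have h0 := D.isCovariantDerivativeOnUniv.smul_const c
      ((hs.contMDiffAt hU).mdifferentiableAt (by simp))
    simp only [curvatureAux, key]
    rw [map_smul, h0]
    simp only [smul_apply, RingHom.id_apply, smul_sub]

variable {Ω : SymplecticStructure F E}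

/-- `∇` is a connection of the complex vector bundle `(E, J)`: `∇(Js) = J ∇s`. -/
def IsComplexLinear (𝒥 : CompatibleComplexStructure Ω) (D : CovariantDerivative (𝓡∂ 2) F E) :
    Prop :=
  ∀ (s : ∀ y, E y) (x : M),
    MDifferentiableAt (𝓡∂ 2) ((𝓡∂ 2).prod 𝓘(ℝ, F)) (fun y ↦ TotalSpace.mk' F y (s y)) x →
    ∀ v, D (fun y ↦ 𝒥.J y (s y)) x v = 𝒥.J x (D s x v)

/-- The restriction of `∇` to the boundary is unitary: in the directions tangent to the boundary,
`d h(s, t) = h(∇s, t) + h(s, ∇t)`, where `h` is the Hermitian inner product defined by `ω` and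
`J`. -/
def IsUnitaryAlongBoundary (𝒥 : CompatibleComplexStructure Ω)
    (D : CovariantDerivative (𝓡∂ 2) F E) : Prop :=
  ∀ x ∈ (𝓡∂ 2).boundary M, ∀ s t : ∀ y, E y,
    MDifferentiableAt (𝓡∂ 2) ((𝓡∂ 2).prod 𝓘(ℝ, F)) (fun y ↦ TotalSpace.mk' F y (s y)) x →
    MDifferentiableAt (𝓡∂ 2) ((𝓡∂ 2).prod 𝓘(ℝ, F)) (fun y ↦ TotalSpace.mk' F y (t y)) x →
    ∀ v ∈ boundaryTangentSpace x,
      mvfderiv (𝓡∂ 2) (fun y ↦ 𝒥.hermitian y (s y) (t y)) x v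
        = 𝒥.hermitian x (D s x v) (t x) + 𝒥.hermitian x (s x) (D t x v)

/-- Parallel transport of `∇` along the boundary preserves `L`: a section that is parallel along a
connected open piece `C` of the boundary and lies in `L` at one point of `C` lies in `L` at all
points of `C`. -/
def ParallelTransportPreserves (L : LagrangianSubbundle Ω) (D : CovariantDerivative (𝓡∂ 2) F E) :
    Prop :=
  ∀ U : Set M, IsOpen U → IsPreconnected (U ∩ (𝓡∂ 2).boundary M) → ∀ s : ∀ y, E y,
    (∀ x ∈ U ∩ (𝓡∂ 2).boundary M,
      MDifferentiableAt (𝓡∂ 2) ((𝓡∂ 2).prod 𝓘(ℝ, F)) (fun y ↦ TotalSpace.mk' F y (s y)) x ∧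
      ∀ v ∈ boundaryTangentSpace x, D s x v = 0) →
    ∀ x y : (𝓡∂ 2).boundary M, (x : M) ∈ U → (y : M) ∈ U → s x ∈ L.fiber x → s y ∈ L.fiber y

/-- A smooth connection of the complex vector bundle `(E, J)` which restricts on the boundary to an
`L`-orthogonal unitary connection. -/
structure OrthogonalConnection (L : LagrangianSubbundle Ω) (𝒥 : CompatibleComplexStructure Ω) where
  D : CovariantDerivative (𝓡∂ 2) F E
  smooth : CovariantDerivative.ContMDiffCovariantDerivative D ∞
  complexLinear : IsComplexLinear 𝒥 D
  unitary : IsUnitaryAlongBoundary 𝒥 D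
  orthogonal : ParallelTransportPreserves L D

/-- The Chern-Weil Maslov index `(i / π) ∫_M tr F` of a bundle pair, computed with the compatible
complex structure `J` and the connection `∇`. -/
def chernWeilMaslovIndex [T2Space M] [CompactSpace M] {L : LagrangianSubbundle Ω}
    {𝒥 : CompatibleComplexStructure Ω} (N : OrthogonalConnection L 𝒥) : ℂ :=
  Complex.I / Real.pi *
    surfaceIntegral fun x u v ↦ complexTrace (𝒥.J x : E x →ₗ[ℝ] E x) (curvature N.D N.smooth x u v)

end Connection

end ChernWeilMaslov

end

/-! Write `tr` for the real trace of real endomorphisms. The complex trace of the curvature is `(tr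
F - i tr (J F)) / 2`, and the two real traces are compared by two different arguments, both resting
on one transgression formula (`isExteriorDerivative_traceForm`). If an endomorphism field `K` is
parallel for two connections `D` and `D'`, then `tr (K F') - tr (K F) = d tr (K (D' - D))`. By
Stokes (`surfaceIntegral_eq_zero`) the integrals of the two traces agree as soon as the one-form `tr
(K (D' - D))` vanishes on vectors tangent to the boundary.

For `K = id` the two given connections are compared directly. The imaginary part of the Hermitian
metric is `ω` whatever `J` is, so both connections preserve `ω` along the boundary; their difference
there lies in the symplectic Lie algebra and has trace zero (`traceForm_id_eq_zero`).

For `K = J` both connections must be linear for the same complex structure. An automorphism `Φ` of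
the real bundle with `J' Φ = Φ J` and `Φ L = L` on the boundary turns `∇'` into the `J`-linear
connection `Φ⁻¹ ∇' Φ`, and `tr (J' F')` is unchanged by this conjugation. Along the boundary an
orthogonal connection maps sections of `L` to sections of `L` (`cov_mem_lagrangian`), and so does
the conjugated one. The difference `A` is therefore `J`-linear and preserves `L`; since `E = L ⊕ J
L`, the endomorphism `J A` exchanges the two summands and has trace zero (`traceForm_J_eq_zero`).
The conjugated connection need not be unitary, which is why the part `K = id` is treated without
`Φ`.

The existence of `Φ` (`exists_intertwiner`) is the remaining point. The map `1 - J' J` intertwines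
`J` and `J'` and is everywhere injective, but need not preserve `L`. Near the boundary it is
deformed into a map built from sections spanning `L`, which intertwines and preserves `L`.
`convexCombination_injective` shows that the segment between the two consists of injective maps at
boundary points, hence also near them, and a cutoff function glues. -/

open MeasureTheory

noncomputable section

set_option linter.unusedSectionVars false

namespace ChernWeilMaslov

local notation "ℝ²" => EuclideanSpace ℝ (Fin 2)

/-! ### Stokes' theorem on the half-plane -/

section HalfPlane

/-- The coordinate vector `∂ᵢ` of the plane. -/
abbrev stdVec (i : Fin 2) : ℝ² := EuclideanSpace.single i (1 : ℝ)

/-- The linear identification of `ℝ × ℝ` with the Euclidean plane. -/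
def planeEquiv : (ℝ × ℝ) ≃L[ℝ] ℝ² :=
  (ContinuousLinearEquiv.finTwoArrow ℝ ℝ).symm.trans (EuclideanSpace.equiv (Fin 2) ℝ).symm

@[simp] theorem planeEquiv_apply_zero (x : ℝ × ℝ) : planeEquiv x 0 = x.1 := by
  simp [planeEquiv]

@[simp] theorem planeEquiv_apply_one (x : ℝ × ℝ) : planeEquiv x 1 = x.2 := by
  simp [planeEquiv]

theorem planeEquiv_one_zero : planeEquiv (1, 0) = stdVec 0 := by
  ext i; fin_cases i <;> simp

theorem planeEquiv_zero_one : planeEquiv (0, 1) = stdVec 1 := by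
  ext i; fin_cases i <;> simp

theorem measurePreserving_planeEquiv : MeasurePreserving planeEquiv volume volume :=
  (EuclideanSpace.volume_preserving_symm_measurableEquiv_toLp (Fin 2)).symm.comp
    (volume_preserving_finTwoArrow ℝ).symm

theorem mem_range_halfPlane {z : ℝ²} : z ∈ range (𝓡∂ 2) ↔ 0 ≤ z 0 := by
  rw [range_modelWithCornersEuclideanHalfSpace]; rfl

theorem isClosed_range_halfPlane : IsClosed (range (𝓡∂ 2)) := (𝓡∂ 2).isClosed_range

theorem uniqueDiffOn_halfPlane : UniqueDiffOn ℝ (range (𝓡∂ 2)) := (𝓡∂ 2).uniqueDiffOn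

variable {V : Type*} [NormedAddCommGroup V] [NormedSpace ℝ V]

/-- Green's theorem for the one-form `g₀ dz₀ + g₁ dz₁`. The boundary line is tangent to `∂₁`, so
only `g₁` contributes there and `hb` constrains `g₁` alone. -/
theorem integral_halfPlane_of_compact_support [CompleteSpace V] {g₀ g₁ : ℝ² → V}
    (h₀ : ContDiffOn ℝ 1 g₀ (range (𝓡∂ 2))) (h₁ : ContDiffOn ℝ 1 g₁ (range (𝓡∂ 2)))
    {K : Set ℝ²} (hK : IsCompact K)
    (hK₀ : ∀ z ∈ range (𝓡∂ 2), z ∉ K → g₀ z = 0) (hK₁ : ∀ z ∈ range (𝓡∂ 2), z ∉ K → g₁ z = 0)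
    (hb : ∀ z : ℝ², z 0 = 0 → g₁ z = 0) :
    ∫ z in range (𝓡∂ 2), (fderivWithin ℝ g₁ (range (𝓡∂ 2)) z (stdVec 0)
      - fderivWithin ℝ g₀ (range (𝓡∂ 2)) z (stdVec 1)) = 0 := by
  -- The bound is strict, so that the sides of the box `[0, R] × [-R, R]` other than the one on the
  -- boundary line miss `K`.
  obtain ⟨R, hR0, hR⟩ : ∃ R : ℝ, 0 < R ∧ ∀ z ∈ K, ‖z‖ < R := by
    obtain ⟨R, hR⟩ := hK.isBounded.exists_norm_le
    exact ⟨max R 0 + 1, by positivity, fun z hz ↦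
      (hR z hz).trans_lt ((le_max_left R 0).trans_lt (lt_add_one _))⟩
  have hout : ∀ z : ℝ², R ≤ |z 0| ∨ R ≤ |z 1| → z ∉ K := by
    intro z hz hzK
    have := hR z hzK
    rcases hz with h | h
    · exact absurd ((h.trans (by simpa using PiLp.norm_apply_le z 0)).trans_lt this) (lt_irrefl _)
    · exact absurd ((h.trans (by simpa using PiLp.norm_apply_le z 1)).trans_lt this) (lt_irrefl _)
  set H := range (𝓡∂ 2) with hH
  have hfd : ∀ g : ℝ² → V, (∀ z ∈ H, z ∉ K → g z = 0) → ∀ z ∈ H, z ∉ K →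
      fderivWithin ℝ g H z = 0 := by
    intro g hg z hz hzK
    have : g =ᶠ[𝓝[H] z] fun _ ↦ 0 := by
      filter_upwards [self_mem_nhdsWithin, nhdsWithin_le_nhds (hK.isClosed.isOpen_compl.mem_nhds hzK)]
        with y hy hy' using hg y hy hy'
    rw [this.fderivWithin_eq (hg z hz hzK)]
    simp
  set B : Set (ℝ × ℝ) := Icc ((0 : ℝ), -R) (R, R) with hB
  have hBH : ∀ x ∈ B, planeEquiv x ∈ H := by
    intro x hx
    rw [hH, mem_range_halfPlane, planeEquiv_apply_zero]
    exact hx.1.1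
  have hmaps : MapsTo planeEquiv B H := hBH
  set F : ℝ² → V := fun z ↦ fderivWithin ℝ g₁ H z (stdVec 0) - fderivWithin ℝ g₀ H z (stdVec 1)
    with hF
  have hFc : ContinuousOn F H :=
    ((h₁.continuousOn_fderivWithin uniqueDiffOn_halfPlane le_rfl).clm_apply continuousOn_const).sub
    ((h₀.continuousOn_fderivWithin uniqueDiffOn_halfPlane le_rfl).clm_apply continuousOn_const)
  have e1 : ∫ z in H, F z = ∫ z in planeEquiv '' B, F z := by
    refine (setIntegral_eq_of_subset_of_forall_sdiff_eq_zero
      isClosed_range_halfPlane.measurableSet ?_ ?_)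
    · rintro _ ⟨x, hx, rfl⟩
      exact hBH x hx
    · rintro z ⟨hz, hzB⟩
      have : z ∉ K := by
        apply hout
        by_contra! hcon
        apply hzB
        have h0 : 0 ≤ z 0 := mem_range_halfPlane.1 hz
        refine ⟨(z 0, z 1), ⟨⟨h0, (abs_lt.1 hcon.2).1.le⟩, ⟨(abs_lt.1 hcon.1).2.le,
          (abs_lt.1 hcon.2).2.le⟩⟩, ?_⟩
        ext i; fin_cases i <;> simp
      simp [hF, hfd g₀ hK₀ z hz this, hfd g₁ hK₁ z hz this]
  have e2 : ∫ z in planeEquiv '' B, F z = ∫ x in B, F (planeEquiv x) :=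
    measurePreserving_planeEquiv.setIntegral_image_emb
      planeEquiv.toHomeomorph.measurableEmbedding F B
  rw [e1, e2]
  have hd : ∀ g : ℝ² → V, ContDiffOn ℝ 1 g H → ∀ x ∈ Ioo (0:ℝ) R ×ˢ Ioo (-R) R,
      HasFDerivAt (fun x ↦ g (planeEquiv x))
        ((fderivWithin ℝ g H (planeEquiv x)).comp (planeEquiv : (ℝ × ℝ) →L[ℝ] ℝ²)) x := by
    intro g hg x hx
    have hn : H ∈ 𝓝 (planeEquiv x) := by
      rw [hH, range_modelWithCornersEuclideanHalfSpace]
      have : {y : ℝ² | 0 < y 0} ∈ 𝓝 (planeEquiv x) :=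
        (isOpen_lt continuous_const (by fun_prop)).mem_nhds (by simpa using hx.1.1)
      filter_upwards [this] with y hy using le_of_lt hy
    have := ((hg.differentiableOn one_ne_zero) _ (mem_of_mem_nhds hn)).hasFDerivWithinAt.hasFDerivAt hn
    exact this.comp x planeEquiv.hasFDerivAt
  have hcont : ∀ g : ℝ² → V, ContDiffOn ℝ 1 g H →
      ContinuousOn (fun x ↦ g (planeEquiv x)) B := fun g hg ↦
    hg.continuousOn.comp planeEquiv.continuous.continuousOn hmaps
  -- The divergence theorem is applied to the field `(g₁, -g₀)`, whose divergence is the coefficient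
  -- of the exterior derivative.
  have key := integral_divergence_prod_Icc_of_hasFDerivAt_of_le
    (fun x ↦ g₁ (planeEquiv x)) (fun x ↦ - g₀ (planeEquiv x))
    (fun x ↦ (fderivWithin ℝ g₁ H (planeEquiv x)).comp (planeEquiv : (ℝ × ℝ) →L[ℝ] ℝ²))
    (fun x ↦ -(fderivWithin ℝ g₀ H (planeEquiv x)).comp (planeEquiv : (ℝ × ℝ) →L[ℝ] ℝ²))
    ((0 : ℝ), -R) (R, R) ⟨hR0.le, by simp; linarith⟩ (hcont g₁ h₁) (hcont g₀ h₀).neg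
    (hd g₁ h₁) (fun x hx ↦ (hd g₀ h₀ x hx).neg) ?_
  · simp only [neg_apply, ContinuousLinearMap.comp_apply, ContinuousLinearEquiv.coe_coe,
      planeEquiv_one_zero, planeEquiv_zero_one, ← sub_eq_add_neg] at key
    rw [key]
    have z1 : ∀ x ∈ uIcc (0:ℝ) R, g₀ (planeEquiv (x, R)) = 0 := fun x hx ↦ by
      rw [uIcc_of_le hR0.le] at hx
      refine hK₀ _ (hBH _ ⟨⟨hx.1, ?_⟩, ⟨hx.2, le_rfl⟩⟩) (hout _ (Or.inr ?_))
      · simp; linarith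
      · simp [le_abs_self]
    have z2 : ∀ x ∈ uIcc (0:ℝ) R, g₀ (planeEquiv (x, -R)) = 0 := fun x hx ↦ by
      rw [uIcc_of_le hR0.le] at hx
      refine hK₀ _ (hBH _ ⟨⟨hx.1, le_rfl⟩, ⟨hx.2, ?_⟩⟩) (hout _ (Or.inr ?_))
      · simp; linarith
      · simp [le_abs_self]
    have z3 : ∀ y ∈ uIcc (-R) R, g₁ (planeEquiv (R, y)) = 0 := fun y hy ↦ by
      rw [uIcc_of_le (by linarith)] at hy
      refine hK₁ _ (hBH _ ⟨⟨hR0.le, hy.1⟩, ⟨le_rfl, hy.2⟩⟩) (hout _ (Or.inl ?_))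
      simp [le_abs_self]
    -- The side on the boundary line is the only one treated by `hb`; the other three are outside
    -- `K`.
    have z4 : ∀ y ∈ uIcc (-R) R, g₁ (planeEquiv (0, y)) = 0 := fun y hy ↦ hb _ (by simp)
    have w1 : ∫ x in (0:ℝ)..R, -g₀ (planeEquiv (x, R)) = 0 := by
      rw [intervalIntegral.integral_congr (g := fun _ ↦ 0) fun x hx ↦ by simp [z1 x hx]]; simp
    have w2 : ∫ x in (0:ℝ)..R, -g₀ (planeEquiv (x, -R)) = 0 := by
      rw [intervalIntegral.integral_congr (g := fun _ ↦ 0) fun x hx ↦ by simp [z2 x hx]]; simp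
    have w3 : ∫ y in (-R)..R, g₁ (planeEquiv (R, y)) = 0 := by
      rw [intervalIntegral.integral_congr (g := fun _ ↦ 0) fun x hx ↦ by simp [z3 x hx]]; simp
    have w4 : ∫ y in (-R)..R, g₁ (planeEquiv (0, y)) = 0 := by
      rw [intervalIntegral.integral_congr (g := fun _ ↦ 0) fun x hx ↦ by simp [z4 x hx]]; simp
    rw [w1, w2, w3, w4]; simp
  · have : ContinuousOn (fun x ↦ F (planeEquiv x)) B :=
      hFc.comp planeEquiv.continuous.continuousOn hmaps
    refine (this.integrableOn_compact isCompact_Icc).congr_fun (fun x _ ↦ ?_) measurableSet_Icc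
    simp [hF, planeEquiv_one_zero, planeEquiv_zero_one, sub_eq_add_neg]

/-- A function supported in a compact subset of a relatively open set `T` of the half-plane extends
by zero to a function of the same regularity. -/
theorem contDiffOn_indicator_of_compact {T K : Set ℝ²} (hT : ∀ z ∈ T, T ∈ 𝓝[range (𝓡∂ 2)] z)
    (hK : IsCompact K) (hKT : K ⊆ T) {g : ℝ² → V} (hg : ContDiffOn ℝ 1 g T)
    (h0 : ∀ z ∈ T, z ∉ K → g z = 0) : ContDiffOn ℝ 1 (T.indicator g) (range (𝓡∂ 2)) := by
  intro z hz
  by_cases hzT : z ∈ T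
  · have h1 : ContDiffWithinAt ℝ 1 g (range (𝓡∂ 2)) z :=
      (hg z hzT).mono_of_mem_nhdsWithin (hT z hzT)
    refine h1.congr_of_eventuallyEq ?_ (by simp [hzT])
    filter_upwards [hT z hzT] with y hy
    simp [hy]
  -- `K` is closed, so away from `T` the extension vanishes on a whole neighbourhood, even at limit
  -- points of `T`.
  · have hzK : z ∉ K := fun h ↦ hzT (hKT h)
    refine (contDiffWithinAt_const (c := (0 : V))).congr_of_eventuallyEq ?_ (by simp [hzT])
    filter_upwards [nhdsWithin_le_nhds (hK.isClosed.isOpen_compl.mem_nhds hzK)] with y hy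
    by_cases hyT : y ∈ T
    · simp [hyT, h0 y hyT hy]
    · simp [hyT]

/-- The form needed for charts: the coefficients are controlled only on the relatively open
coordinate domain `T`, and extension by zero reduces to the whole half-plane. -/
theorem integral_halfPlane_of_compact [CompleteSpace V] {T K : Set ℝ²}
    (hTH : T ⊆ range (𝓡∂ 2)) (hTm : MeasurableSet T)
    (hT : ∀ z ∈ T, T ∈ 𝓝[range (𝓡∂ 2)] z)
    (hK : IsCompact K) (hKT : K ⊆ T) {g₀ g₁ : ℝ² → V}
    (h₀ : ContDiffOn ℝ 1 g₀ T) (h₁ : ContDiffOn ℝ 1 g₁ T)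
    (hK₀ : ∀ z ∈ T, z ∉ K → g₀ z = 0) (hK₁ : ∀ z ∈ T, z ∉ K → g₁ z = 0)
    (hb : ∀ z ∈ T, z 0 = 0 → g₁ z = 0) :
    ∫ z in T, (fderivWithin ℝ g₁ (range (𝓡∂ 2)) z (stdVec 0)
      - fderivWithin ℝ g₀ (range (𝓡∂ 2)) z (stdVec 1)) = 0 := by
  have hi : ∀ g : ℝ² → V, (∀ z ∈ T, z ∉ K → g z = 0) →
      ∀ z ∈ range (𝓡∂ 2), z ∉ K → T.indicator g z = 0 := by
    intro g hg z _ hzK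
    by_cases hzT : z ∈ T
    · simp [hzT, hg z hzT hzK]
    · simp [hzT]
  have := integral_halfPlane_of_compact_support
    (contDiffOn_indicator_of_compact hT hK hKT h₀ hK₀)
    (contDiffOn_indicator_of_compact hT hK hKT h₁ hK₁) hK (hi g₀ hK₀) (hi g₁ hK₁) (fun z hz ↦ by
      by_cases hzT : z ∈ T
      · simp [hzT, hb z hzT hz]
      · simp [hzT])
  rw [← this]
  symm
  have hfd : ∀ g : ℝ² → V, ∀ z ∈ T, fderivWithin ℝ (T.indicator g) (range (𝓡∂ 2)) z
      = fderivWithin ℝ g (range (𝓡∂ 2)) z := by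
    intro g z hz
    refine Filter.EventuallyEq.fderivWithin_eq ?_ (by simp [hz])
    filter_upwards [hT z hz] with y hy
    simp [hy]
  have hfd0 : ∀ g : ℝ² → V, (∀ z ∈ T, z ∉ K → g z = 0) → ∀ z ∉ T,
      fderivWithin ℝ (T.indicator g) (range (𝓡∂ 2)) z = 0 := by
    intro g hg z hz
    have hzK : z ∉ K := fun h ↦ hz (hKT h)
    have : T.indicator g =ᶠ[𝓝[range (𝓡∂ 2)] z] fun _ ↦ 0 := by
      filter_upwards [self_mem_nhdsWithin,
        nhdsWithin_le_nhds (hK.isClosed.isOpen_compl.mem_nhds hzK)] with y hy hy'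
      exact hi g hg y hy hy'
    rw [this.fderivWithin_eq (by simp [hz])]
    simp
  rw [setIntegral_eq_of_subset_of_forall_sdiff_eq_zero (s := T)
    isClosed_range_halfPlane.measurableSet hTH]
  · exact setIntegral_congr_fun hTm fun z hz ↦ by
      simp only [hfd _ z hz]
  · rintro z ⟨_, hzT⟩
    simp only [hfd0 g₀ hK₀ z hzT, hfd0 g₁ hK₁ z hzT, zero_apply, sub_zero]

end HalfPlane

/-! ### Coordinate vector fields and the boundary -/

section Coordinates

variable {M : Type*} [TopologicalSpace M] [ChartedSpace (EuclideanHalfSpace 2) M]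
  [IsManifold (𝓡∂ 2) ∞ M]

/-- The vector field with constant coordinates `w` in the preferred chart at `p`. -/
def coordField (p x : M) : ℝ² →L[ℝ] TangentSpace (𝓡∂ 2) x :=
  (trivializationAt ℝ² (TangentSpace (𝓡∂ 2)) p).symmL ℝ x

/-- The coordinates of tangent vectors at `x` in the preferred chart at `p`. -/
def chartCoords (p x : M) : TangentSpace (𝓡∂ 2) x →L[ℝ] ℝ² :=
  mvfderiv (𝓡∂ 2) (extChartAt (𝓡∂ 2) p) x

theorem isManifold_one : IsManifold (𝓡∂ 2) 1 M := .of_le (n := ∞) (by simp)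

theorem symm_mem_source {p : M} {z : ℝ²} (hz : z ∈ (extChartAt (𝓡∂ 2) p).target) :
    (extChartAt (𝓡∂ 2) p).symm z ∈ (chartAt (EuclideanHalfSpace 2) p).source := by
  have := (extChartAt (𝓡∂ 2) p).map_target hz
  rwa [extChartAt_source] at this

theorem coordField_eq {p x : M} (hx : x ∈ (chartAt (EuclideanHalfSpace 2) p).source) :
    coordField p x = mfderivWithin 𝓘(ℝ, ℝ²) (𝓡∂ 2) (extChartAt (𝓡∂ 2) p).symm (range (𝓡∂ 2))
      (extChartAt (𝓡∂ 2) p x) :=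
  have : IsManifold (𝓡∂ 2) 1 M := isManifold_one
  TangentBundle.symmL_trivializationAt hx

/-- Relates the derivative of the inverse chart to the trivialization of the tangent bundle, which
is the form convenient for smoothness. -/
theorem mfderivWithin_symm_eq {p : M} {z : ℝ²} (hz : z ∈ (extChartAt (𝓡∂ 2) p).target) (w : ℝ²) :
    mfderivWithin 𝓘(ℝ, ℝ²) (𝓡∂ 2) (extChartAt (𝓡∂ 2) p).symm (range (𝓡∂ 2)) z w
      = coordField p ((extChartAt (𝓡∂ 2) p).symm z) w := by
  rw [coordField_eq (symm_mem_source hz)]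
  -- The point `φ (φ⁻¹ z)` equals `z` only propositionally, and the type of the derivative depends
  -- on it. Viewing all tangent spaces as the plane makes the substitution possible.
  have : ∀ z' : ℝ², z' = z →
      ((mfderivWithin 𝓘(ℝ, ℝ²) (𝓡∂ 2) (extChartAt (𝓡∂ 2) p).symm (range (𝓡∂ 2)) z :) : ℝ² →L[ℝ] ℝ²)
      = mfderivWithin 𝓘(ℝ, ℝ²) (𝓡∂ 2) (extChartAt (𝓡∂ 2) p).symm (range (𝓡∂ 2)) z' := by
    rintro _ rfl; rfl
  exact DFunLike.congr_fun (this (extChartAt (𝓡∂ 2) p ((extChartAt (𝓡∂ 2) p).symm z))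
    ((extChartAt (𝓡∂ 2) p).right_inv hz)) w

theorem coordinateVector_eq {p : M} {z : ℝ²} (hz : z ∈ (extChartAt (𝓡∂ 2) p).target) (i : Fin 2) :
    coordinateVector p z i = coordField p ((extChartAt (𝓡∂ 2) p).symm z) (stdVec i) :=
  mfderivWithin_symm_eq hz _

theorem chartCoords_eq {p x : M} (hx : x ∈ (chartAt (EuclideanHalfSpace 2) p).source) :
    chartCoords p x = (trivializationAt ℝ² (TangentSpace (𝓡∂ 2)) p).continuousLinearMapAt ℝ x := by
  have : IsManifold (𝓡∂ 2) 1 M := isManifold_one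
  rw [TangentBundle.continuousLinearMapAt_trivializationAt hx]
  rfl

theorem chartCoords_coordField {p x : M} (hx : x ∈ (chartAt (EuclideanHalfSpace 2) p).source)
    (w : ℝ²) : chartCoords p x (coordField p x w) = w := by
  rw [chartCoords_eq hx]
  exact Trivialization.continuousLinearMapAt_symmL _ (by simpa using hx) w

theorem coordField_chartCoords {p x : M} (hx : x ∈ (chartAt (EuclideanHalfSpace 2) p).source)
    (v : TangentSpace (𝓡∂ 2) x) : coordField p x (chartCoords p x v) = v := by
  rw [chartCoords_eq hx]
  exact Trivialization.symmL_continuousLinearMapAt _ (by simpa using hx) v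

theorem coordField_self (x : M) (w : ℝ²) : coordField x x w = w := by
  have : IsManifold (𝓡∂ 2) 1 M := isManifold_one
  rw [coordField_eq (mem_chart_source _ x), mfderivWithin_range_extChartAt_symm]
  rfl

theorem target_mem_nhdsWithin {p : M} {z : ℝ²} (hz : z ∈ (extChartAt (𝓡∂ 2) p).target) :
    (extChartAt (𝓡∂ 2) p).target ∈ 𝓝[range (𝓡∂ 2)] z :=
  extChartAt_target_mem_nhdsWithin_of_mem hz

theorem contMDiffOn_symm (p : M) :
    ContMDiffOn 𝓘(ℝ, ℝ²) (𝓡∂ 2) ∞ (extChartAt (𝓡∂ 2) p).symm (extChartAt (𝓡∂ 2) p).target :=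
  contMDiffOn_extChartAt_symm p

variable {W : Type*} [NormedAddCommGroup W] [NormedSpace ℝ W]

/-- The chain rule for the coordinate expression of a function on the surface. -/
theorem hasFDerivWithinAt_comp_symm {f : M → W} {p : M} {z : ℝ²}
    (hz : z ∈ (extChartAt (𝓡∂ 2) p).target)
    (hf : MDifferentiableAt (𝓡∂ 2) 𝓘(ℝ, W) f ((extChartAt (𝓡∂ 2) p).symm z)) :
    HasFDerivWithinAt (fun z ↦ f ((extChartAt (𝓡∂ 2) p).symm z))
      ((mvfderiv (𝓡∂ 2) f ((extChartAt (𝓡∂ 2) p).symm z)).comp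
        (coordField p ((extChartAt (𝓡∂ 2) p).symm z))) (range (𝓡∂ 2)) z := by
  have : IsManifold (𝓡∂ 2) 1 M := isManifold_one
  have h1 := (mdifferentiableWithinAt_extChartAt_symm (I := 𝓡∂ 2) hz).hasMFDerivWithinAt
  have h2 := (hf.hasMFDerivAt.comp_hasMFDerivWithinAt z h1).hasFDerivWithinAt
  refine h2.congr_fderiv ?_
  ext w
  exact congrArg (mvfderiv (𝓡∂ 2) f ((extChartAt (𝓡∂ 2) p).symm z)) (mfderivWithin_symm_eq hz w)

theorem fderivWithin_comp_symm {f : M → W} {p : M} {z : ℝ²}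
    (hz : z ∈ (extChartAt (𝓡∂ 2) p).target)
    (hf : MDifferentiableAt (𝓡∂ 2) 𝓘(ℝ, W) f ((extChartAt (𝓡∂ 2) p).symm z)) (w : ℝ²) :
    fderivWithin ℝ (fun z ↦ f ((extChartAt (𝓡∂ 2) p).symm z)) (range (𝓡∂ 2)) z w
      = mvfderiv (𝓡∂ 2) f ((extChartAt (𝓡∂ 2) p).symm z)
        (coordField p ((extChartAt (𝓡∂ 2) p).symm z) w) := by
  rw [(hasFDerivWithinAt_comp_symm hz hf).fderivWithin
    (uniqueDiffOn_halfPlane z (extChartAt_target_subset_range p hz))]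
  rfl

/-! #### The boundary -/

/-- Being an interior point may be tested in any chart of the atlas, hence in the one at `p`. The
target is relatively open in the half-plane, so a point of it is interior in the plane exactly when
its coordinate `z 0` is positive. -/
theorem mem_boundary_iff {p : M} {z : ℝ²} (hz : z ∈ (extChartAt (𝓡∂ 2) p).target) :
    (extChartAt (𝓡∂ 2) p).symm z ∈ (𝓡∂ 2).boundary M ↔ z 0 = 0 := by
  have hr := mem_range_halfPlane.1 (extChartAt_target_subset_range p hz)
  change (𝓡∂ 2).IsBoundaryPoint _ ↔ _
  rw [← not_iff_not, ← (𝓡∂ 2).isInteriorPoint_iff_not_isBoundaryPoint,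
    (𝓡∂ 2).isInteriorPoint_iff_of_mem_atlas (n := ∞) (by simp)
      (chart_mem_atlas (EuclideanHalfSpace 2) p) (symm_mem_source hz)]
  change extChartAt (𝓡∂ 2) p ((extChartAt (𝓡∂ 2) p).symm z) ∈ interior (extChartAt (𝓡∂ 2) p).target ↔ _
  rw [(extChartAt (𝓡∂ 2) p).right_inv hz]
  constructor
  · intro h h0
    have := interior_mono (extChartAt_target_subset_range p) h
    rw [interior_range_modelWithCornersEuclideanHalfSpace] at this
    exact this.ne' h0
  · intro h
    rw [mem_interior_iff_mem_nhds]
    have h1 : z ∈ interior (range (𝓡∂ 2)) := by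
      rw [interior_range_modelWithCornersEuclideanHalfSpace]
      exact lt_of_le_of_ne hr (Ne.symm h)
    have := target_mem_nhdsWithin hz
    rwa [nhdsWithin_eq_nhds.2 (mem_interior_iff_mem_nhds.1 h1)] at this

/-- A function on the half-plane vanishing on the boundary line has vanishing tangential
derivative. -/
theorem fderivWithin_boundary_eq_zero {g : ℝ² → W} {z w : ℝ²} (hz : z 0 = 0) (hw : w 0 = 0)
    (hg : DifferentiableWithinAt ℝ g (range (𝓡∂ 2)) z)
    (h0 : ∀ᶠ y in 𝓝[range (𝓡∂ 2)] z, y 0 = 0 → g y = 0) :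
    fderivWithin ℝ g (range (𝓡∂ 2)) z w = 0 := by
  -- The line through `z` in direction `w` stays in the boundary of the half-plane, so the
  -- derivative in direction `w` is an ordinary two-sided derivative along it, of a function that is
  -- locally zero.
  have hl : HasDerivAt (fun t : ℝ ↦ z + t • w) w 0 := by
    simpa using ((hasDerivAt_id (0 : ℝ)).smul_const w).const_add z
  have hmem : ∀ t : ℝ, z + t • w ∈ range (𝓡∂ 2) := fun t ↦ by
    rw [mem_range_halfPlane]; simp [hz, hw]
  have hz' : z + (0 : ℝ) • w = z := by simp
  have h1 : HasDerivWithinAt (g ∘ fun t : ℝ ↦ z + t • w) (fderivWithin ℝ g (range (𝓡∂ 2)) z w)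
      univ 0 := by
    refine HasFDerivWithinAt.comp_hasDerivWithinAt (t := range (𝓡∂ 2)) 0 ?_ hl.hasDerivWithinAt
      (fun t _ ↦ hmem t)
    rw [hz']
    exact hg.hasFDerivWithinAt
  have h2 : (g ∘ fun t : ℝ ↦ z + t • w) =ᶠ[𝓝 0] fun _ ↦ (0 : W) := by
    have ht : Filter.Tendsto (fun t : ℝ ↦ z + t • w) (𝓝 0) (𝓝[range (𝓡∂ 2)] z) := by
      refine tendsto_nhdsWithin_iff.2 ⟨?_, Filter.Eventually.of_forall hmem⟩
      simpa [hz'] using hl.continuousAt.tendsto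
    filter_upwards [ht.eventually h0] with t ht
    exact ht (by simp [hz, hw])
  rw [hasDerivWithinAt_univ] at h1
  exact (h1.congr_of_eventuallyEq h2.symm).unique (hasDerivAt_const 0 0)

theorem mvfderiv_coordField_eq_zero {f : M → W} {p x : M}
    (hp : x ∈ (chartAt (EuclideanHalfSpace 2) p).source)
    (hx : x ∈ (𝓡∂ 2).boundary M) (hf : MDifferentiableAt (𝓡∂ 2) 𝓘(ℝ, W) f x)
    (h0 : ∀ᶠ y in 𝓝 x, y ∈ (𝓡∂ 2).boundary M → f y = 0) {w : ℝ²} (hw : w 0 = 0) :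
    mvfderiv (𝓡∂ 2) f x (coordField p x w) = 0 := by
  obtain ⟨z, hz, rfl⟩ : ∃ z ∈ (extChartAt (𝓡∂ 2) p).target, (extChartAt (𝓡∂ 2) p).symm z = x :=
    ⟨extChartAt (𝓡∂ 2) p x, (extChartAt (𝓡∂ 2) p).map_source (by rwa [extChartAt_source]),
      (extChartAt (𝓡∂ 2) p).left_inv (by rwa [extChartAt_source])⟩
  rw [← fderivWithin_comp_symm hz hf]
  refine fderivWithin_boundary_eq_zero ((mem_boundary_iff hz).1 hx) hw
    (hasFDerivWithinAt_comp_symm hz hf).differentiableWithinAt ?_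
  have hc : Filter.Tendsto (extChartAt (𝓡∂ 2) p).symm (𝓝[range (𝓡∂ 2)] z)
      (𝓝 ((extChartAt (𝓡∂ 2) p).symm z)) := by
    have := ((contMDiffOn_symm p).continuousOn z hz).tendsto
    exact this.mono_left (nhdsWithin_le_of_mem (target_mem_nhdsWithin hz))
  filter_upwards [hc.eventually h0, target_mem_nhdsWithin hz] with y hy hyt hy0
  exact hy ((mem_boundary_iff hyt).2 hy0)

theorem mem_boundaryTangentSpace_iff {x : M} {v : TangentSpace (𝓡∂ 2) x} :
    v ∈ boundaryTangentSpace x ↔ chartCoords x x v 0 = 0 := by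
  have h := coordField_chartCoords (mem_chart_source (EuclideanHalfSpace 2) x) v
  rw [coordField_self] at h
  rw [h]
  rfl

/-- A function vanishing on the boundary has vanishing derivative in the directions tangent to the
boundary. -/
theorem mvfderiv_eq_zero_of_boundary {f : M → W} {x : M}
    (hx : x ∈ (𝓡∂ 2).boundary M) (hf : MDifferentiableAt (𝓡∂ 2) 𝓘(ℝ, W) f x)
    (h0 : ∀ᶠ y in 𝓝 x, y ∈ (𝓡∂ 2).boundary M → f y = 0) {v : TangentSpace (𝓡∂ 2) x}
    (hv : v ∈ boundaryTangentSpace x) : mvfderiv (𝓡∂ 2) f x v = 0 := by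
  have := mvfderiv_coordField_eq_zero (mem_chart_source _ x) hx hf h0
    (mem_boundaryTangentSpace_iff.1 hv)
  rwa [coordField_chartCoords (mem_chart_source (EuclideanHalfSpace 2) x)] at this

theorem mdifferentiableAt_coord {p x : M} (hp : x ∈ (chartAt (EuclideanHalfSpace 2) p).source) :
    MDifferentiableAt (𝓡∂ 2) 𝓘(ℝ, ℝ²) (extChartAt (𝓡∂ 2) p) x :=
  have : IsManifold (𝓡∂ 2) 1 M := isManifold_one
  mdifferentiableAt_extChartAt hp

theorem coord_zero_of_boundary {p y : M} (hp : y ∈ (chartAt (EuclideanHalfSpace 2) p).source)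
    (hy : y ∈ (𝓡∂ 2).boundary M) : extChartAt (𝓡∂ 2) p y 0 = 0 := by
  have hs : y ∈ (extChartAt (𝓡∂ 2) p).source := by rwa [extChartAt_source]
  rw [← mem_boundary_iff ((extChartAt (𝓡∂ 2) p).map_source hs), (extChartAt (𝓡∂ 2) p).left_inv hs]
  exact hy

theorem mvfderiv_coord_zero {p x : M} (hp : x ∈ (chartAt (EuclideanHalfSpace 2) p).source)
    (v : TangentSpace (𝓡∂ 2) x) :
    MDifferentiableAt (𝓡∂ 2) 𝓘(ℝ, ℝ) (fun y ↦ extChartAt (𝓡∂ 2) p y 0) x ∧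
    mvfderiv (𝓡∂ 2) (fun y ↦ extChartAt (𝓡∂ 2) p y 0) x v
      = chartCoords p x v 0 := by
  have h := (EuclideanSpace.proj (𝕜 := ℝ) (0 : Fin 2) : ℝ² →L[ℝ] ℝ).hasMFDerivAt
    (x := extChartAt (𝓡∂ 2) p x)
  have h2 := h.comp x (mdifferentiableAt_coord hp).hasMFDerivAt
  refine ⟨h2.mdifferentiableAt, ?_⟩
  have := h2.mfderiv
  exact DFunLike.congr_fun this v

/-- In every chart, tangent vectors of the boundary are those with vanishing coordinate of
index `0`. -/
theorem coordField_mem_boundaryTangentSpace {p x : M}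
    (hp : x ∈ (chartAt (EuclideanHalfSpace 2) p).source) (hx : x ∈ (𝓡∂ 2).boundary M) {w : ℝ²}
    (hw : w 0 = 0) : coordField p x w ∈ boundaryTangentSpace x := by
  -- `boundaryTangentSpace` is defined by the preferred chart at `x`. The coordinate of index `0` of
  -- that chart vanishes on the boundary, so it is annihilated by the boundary direction `w` of the
  -- chart at `p`.
  have h := mvfderiv_coord_zero (mem_chart_source (EuclideanHalfSpace 2) x) (coordField p x w)
  have := mvfderiv_coordField_eq_zero hp hx h.1 ?_ hw
  · rw [h.2] at this
    rw [mem_boundaryTangentSpace_iff]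
    exact this
  · filter_upwards [(chartAt (EuclideanHalfSpace 2) x).open_source.mem_nhds (mem_chart_source _ x)]
      with y hy hyb
    exact coord_zero_of_boundary hy hyb

theorem mfderiv_mem_of_boundaryTangentSpace {p x : M}
    (hp : x ∈ (chartAt (EuclideanHalfSpace 2) p).source) (hx : x ∈ (𝓡∂ 2).boundary M)
    {v : TangentSpace (𝓡∂ 2) x} (hv : v ∈ boundaryTangentSpace x) :
    chartCoords p x v 0 = 0 := by
  have h := mvfderiv_coord_zero hp v
  rw [← h.2]
  refine mvfderiv_eq_zero_of_boundary hx h.1 ?_ hv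
  filter_upwards [(chartAt (EuclideanHalfSpace 2) p).open_source.mem_nhds hp] with y hy hyb
  exact coord_zero_of_boundary hy hyb

end Coordinates

/-! ### Stokes' theorem on a compact oriented surface -/

section Stokes

theorem det_plane (D : ℝ² →L[ℝ] ℝ²) :
    D.det = D (stdVec 0) 0 * D (stdVec 1) 1 - D (stdVec 0) 1 * D (stdVec 1) 0 := by
  have : D.det = LinearMap.det (D : ℝ² →ₗ[ℝ] ℝ²) := rfl
  rw [this, ← LinearMap.det_toMatrix (EuclideanSpace.basisFun (Fin 2) ℝ).toBasis,
    Matrix.det_fin_two]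
  simp [LinearMap.toMatrix_apply]
  ring

theorem eq_sum_stdVec (w : ℝ²) : w = w 0 • stdVec 0 + w 1 • stdVec 1 := by
  ext i; fin_cases i <;> simp

variable {M : Type*} [TopologicalSpace M] [ChartedSpace (EuclideanHalfSpace 2) M]
  [IsManifold (𝓡∂ 2) ∞ M]

/-- The coefficient of a two-form in the preferred chart at `p`. -/
def density (η : ∀ x : M, TangentSpace (𝓡∂ 2) x → TangentSpace (𝓡∂ 2) x → ℂ) (p x : M) : ℂ :=
  η x (coordField p x (stdVec 0)) (coordField p x (stdVec 1))

/-- The one-form `β` is continuously differentiable and `η` is its exterior derivative. -/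
structure IsExteriorDerivative (β : ∀ x : M, TangentSpace (𝓡∂ 2) x →L[ℝ] ℂ)
    (η : ∀ x : M, TangentSpace (𝓡∂ 2) x → TangentSpace (𝓡∂ 2) x → ℂ) : Prop where
  contDiffOn : ∀ (p : M) (w : ℝ²), ContDiffOn ℝ 1
    (fun z ↦ β ((extChartAt (𝓡∂ 2) p).symm z) (coordField p ((extChartAt (𝓡∂ 2) p).symm z) w))
    (extChartAt (𝓡∂ 2) p).target
  eq : ∀ (p : M), ∀ z ∈ (extChartAt (𝓡∂ 2) p).target, ∀ u v : ℝ²,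
    η ((extChartAt (𝓡∂ 2) p).symm z) (coordField p ((extChartAt (𝓡∂ 2) p).symm z) u)
      (coordField p ((extChartAt (𝓡∂ 2) p).symm z) v)
    = fderivWithin ℝ (fun z ↦ β ((extChartAt (𝓡∂ 2) p).symm z)
        (coordField p ((extChartAt (𝓡∂ 2) p).symm z) v)) (range (𝓡∂ 2)) z u
      - fderivWithin ℝ (fun z ↦ β ((extChartAt (𝓡∂ 2) p).symm z)
        (coordField p ((extChartAt (𝓡∂ 2) p).symm z) u)) (range (𝓡∂ 2)) z v

/-- Two-forms, as functions of two tangent vectors. -/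
def IsTwoForm (η : ∀ x : M, TangentSpace (𝓡∂ 2) x → TangentSpace (𝓡∂ 2) x → ℂ) : Prop :=
  ∀ (x : M) (u v : TangentSpace (𝓡∂ 2) x) (a b c d : ℝ),
    η x (a • u + b • v) (c • u + d • v) = ((a * d - b * c : ℝ) : ℂ) * η x u v

theorem exists_coord {p x : M} (hx : x ∈ (chartAt (EuclideanHalfSpace 2) p).source) :
    ∃ z ∈ (extChartAt (𝓡∂ 2) p).target, (extChartAt (𝓡∂ 2) p).symm z = x :=
  ⟨extChartAt (𝓡∂ 2) p x, (extChartAt (𝓡∂ 2) p).map_source (by rwa [extChartAt_source]),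
    (extChartAt (𝓡∂ 2) p).left_inv (by rwa [extChartAt_source])⟩

theorem contDiffWithinAt_halfPlane {W : Type*} [NormedAddCommGroup W] [NormedSpace ℝ W]
    {p : M} {g : ℝ² → W} {n : ℕ∞ω} (hg : ContDiffOn ℝ n g (extChartAt (𝓡∂ 2) p).target) {z : ℝ²}
    (hz : z ∈ (extChartAt (𝓡∂ 2) p).target) : ContDiffWithinAt ℝ n g (range (𝓡∂ 2)) z :=
  (hg z hz).mono_of_mem_nhdsWithin (target_mem_nhdsWithin hz)

theorem continuousOn_fderivWithin_halfPlane {W : Type*} [NormedAddCommGroup W] [NormedSpace ℝ W]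
    {p : M} {g : ℝ² → W} (hg : ContDiffOn ℝ 1 g (extChartAt (𝓡∂ 2) p).target) (w : ℝ²) :
    ContinuousOn (fun z ↦ fderivWithin ℝ g (range (𝓡∂ 2)) z w) (extChartAt (𝓡∂ 2) p).target := by
  intro z hz
  have := (contDiffWithinAt_halfPlane hg hz).fderivWithin_right (m := 0) uniqueDiffOn_halfPlane
    (by simp) (extChartAt_target_subset_range p hz)
  exact (this.continuousWithinAt.clm_apply continuousWithinAt_const).mono
    (extChartAt_target_subset_range p)

namespace IsExteriorDerivative

variable {β : ∀ x : M, TangentSpace (𝓡∂ 2) x →L[ℝ] ℂ}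
  {η : ∀ x : M, TangentSpace (𝓡∂ 2) x → TangentSpace (𝓡∂ 2) x → ℂ}

theorem differentiableWithinAt (h : IsExteriorDerivative β η) {p : M} {z : ℝ²}
    (hz : z ∈ (extChartAt (𝓡∂ 2) p).target) (w : ℝ²) : DifferentiableWithinAt ℝ
    (fun z ↦ β ((extChartAt (𝓡∂ 2) p).symm z) (coordField p ((extChartAt (𝓡∂ 2) p).symm z) w))
    (range (𝓡∂ 2)) z :=
  (contDiffWithinAt_halfPlane (h.contDiffOn p w) hz).differentiableWithinAt one_ne_zero

/-- `η` is only a function of two vectors; alternating bilinearity is inherited from the coordinate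
formula for the exterior derivative. -/
theorem isTwoForm (h : IsExteriorDerivative β η) : IsTwoForm η := by
  intro x u v a b c d
  obtain ⟨p, hp⟩ : ∃ p, x ∈ (chartAt (EuclideanHalfSpace 2) p).source := ⟨x, mem_chart_source _ x⟩
  obtain ⟨z, hz, rfl⟩ := exists_coord hp
  have hzx := symm_mem_source hz
  rw [← coordField_chartCoords hzx u, ← coordField_chartCoords hzx v]
  generalize chartCoords p _ u = u'
  generalize chartCoords p _ v = v'
  rw [← map_smul, ← map_smul, ← map_smul, ← map_smul, ← map_add, ← map_add, h.eq p z hz,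
    h.eq p z hz]
  have hu := uniqueDiffOn_halfPlane z (extChartAt_target_subset_range p hz)
  have key : ∀ s t : ℝ, fderivWithin ℝ (fun z ↦ β ((extChartAt (𝓡∂ 2) p).symm z)
      (coordField p ((extChartAt (𝓡∂ 2) p).symm z) (s • u' + t • v'))) (range (𝓡∂ 2)) z
      = s • fderivWithin ℝ (fun z ↦ β ((extChartAt (𝓡∂ 2) p).symm z)
          (coordField p ((extChartAt (𝓡∂ 2) p).symm z) u')) (range (𝓡∂ 2)) z
        + t • fderivWithin ℝ (fun z ↦ β ((extChartAt (𝓡∂ 2) p).symm z)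
          (coordField p ((extChartAt (𝓡∂ 2) p).symm z) v')) (range (𝓡∂ 2)) z := by
    intro s t
    rw [← fderivWithin_const_smul hu (h.differentiableWithinAt hz u'),
      ← fderivWithin_const_smul hu (h.differentiableWithinAt hz v'),
      ← fderivWithin_add hu ((h.differentiableWithinAt hz u').const_smul s)
        ((h.differentiableWithinAt hz v').const_smul t)]
    congr 1
    funext y
    simp only [map_add, map_smul, Pi.add_apply, Pi.smul_apply]
  rw [key, key]
  simp only [map_add, map_smul, add_apply, smul_apply, Complex.real_smul]
  push_cast
  ring

theorem smul (h : IsExteriorDerivative β η) {f : M → ℝ}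
    (hf : ContMDiff (𝓡∂ 2) 𝓘(ℝ, ℝ) ∞ f) :
    IsExteriorDerivative (fun x ↦ f x • β x)
      (fun x u v ↦ (mvfderiv (𝓡∂ 2) f x u : ℂ) * β x v - (mvfderiv (𝓡∂ 2) f x v : ℂ) * β x u
        + (f x : ℂ) * η x u v) := by
  have hfd : ∀ p : M, ContDiffOn ℝ 1 (fun z ↦ f ((extChartAt (𝓡∂ 2) p).symm z))
      (extChartAt (𝓡∂ 2) p).target := fun p ↦
    ((hf.comp_contMDiffOn (contMDiffOn_symm p)).contDiffOn).of_le (by simp)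
  refine ⟨fun p w ↦ ?_, fun p z hz u v ↦ ?_⟩
  · exact (hfd p).smul (h.contDiffOn p w)
  · have hfz := (hf.contMDiffAt (x := (extChartAt (𝓡∂ 2) p).symm z)).mdifferentiableAt (by simp)
    have hu := uniqueDiffOn_halfPlane z (extChartAt_target_subset_range p hz)
    have hfd' := (hasFDerivWithinAt_comp_symm hz hfz).differentiableWithinAt
    simp only [smul_apply]
    rw [fderivWithin_fun_smul hu hfd' (h.differentiableWithinAt hz v),
      fderivWithin_fun_smul hu hfd' (h.differentiableWithinAt hz u)]
    simp only [add_apply, smul_apply, ContinuousLinearMap.smulRight_apply, Complex.real_smul]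
    rw [fderivWithin_comp_symm hz hfz, fderivWithin_comp_symm hz hfz, h.eq p z hz]
    ring

theorem continuousOn_density (h : IsExteriorDerivative β η) (p : M) :
    ContinuousOn (fun z ↦ density η p ((extChartAt (𝓡∂ 2) p).symm z))
      (extChartAt (𝓡∂ 2) p).target := by
  refine ((continuousOn_fderivWithin_halfPlane (h.contDiffOn p (stdVec 1)) (stdVec 0)).sub
    (continuousOn_fderivWithin_halfPlane (h.contDiffOn p (stdVec 0)) (stdVec 1))).congr ?_
  intro z hz
  exact h.eq p z hz _ _

end IsExteriorDerivative

theorem measurableSet_target (p : M) : MeasurableSet (extChartAt (𝓡∂ 2) p).target := by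
  rw [extChartAt_target]
  exact ((chartAt (EuclideanHalfSpace 2) p).open_target.preimage
    (𝓡∂ 2).continuous_symm).measurableSet.inter isClosed_range_halfPlane.measurableSet

theorem measurableSet_target_inter (p : M) {s : Set M} (hs : IsOpen s) :
    MeasurableSet ((extChartAt (𝓡∂ 2) p).target ∩ (extChartAt (𝓡∂ 2) p).symm ⁻¹' s) := by
  obtain ⟨u, hu, hu'⟩ := continuousOn_iff'.1 (contMDiffOn_symm p).continuousOn s hs
  rw [inter_comm, hu']
  exact hu.measurableSet.inter (measurableSet_target p)

theorem coordField_eq_transition {p q x : M}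
    (hq : x ∈ (chartAt (EuclideanHalfSpace 2) q).source) (w : ℝ²) :
    coordField p x w = coordField q x (chartCoords q x (coordField p x w)) :=
  (coordField_chartCoords hq _).symm

/-- The coefficient of a two-form is multiplied by the Jacobian determinant of the change of
coordinates. -/
theorem IsTwoForm.density_eq {η : ∀ x : M, TangentSpace (𝓡∂ 2) x → TangentSpace (𝓡∂ 2) x → ℂ}
    (h : IsTwoForm η) {p q x : M} (hq : x ∈ (chartAt (EuclideanHalfSpace 2) q).source) :
    density η p x = (((chartCoords q x).comp (coordField p x)).det : ℂ) * density η q x := by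
  rw [density, density, coordField_eq_transition hq (stdVec 0),
    coordField_eq_transition hq (stdVec 1), det_plane]
  set a := chartCoords q x (coordField p x (stdVec 0)) with ha
  set b := chartCoords q x (coordField p x (stdVec 1)) with hb
  rw [eq_sum_stdVec a, eq_sum_stdVec b]
  simp only [map_add, map_smul]
  rw [h]
  simp only [ContinuousLinearMap.comp_apply, ← ha, ← hb]

/-- Change of variables along the transition map. The form vanishes off the overlap of the two chart
domains, so both integrals reduce to the overlap. -/
theorem integral_density_eq (hM : IsOriented M)
    {η : ∀ x : M, TangentSpace (𝓡∂ 2) x → TangentSpace (𝓡∂ 2) x → ℂ} (h : IsTwoForm η) {p q : M}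
    (h0 : ∀ x, x ∉ (chartAt (EuclideanHalfSpace 2) p).source ∩
      (chartAt (EuclideanHalfSpace 2) q).source → ∀ u v, η x u v = 0) :
    ∫ z in (extChartAt (𝓡∂ 2) p).target, density η p ((extChartAt (𝓡∂ 2) p).symm z)
      = ∫ z in (extChartAt (𝓡∂ 2) q).target, density η q ((extChartAt (𝓡∂ 2) q).symm z) := by
  set A := (extChartAt (𝓡∂ 2) p).target ∩ (extChartAt (𝓡∂ 2) p).symm ⁻¹'
    (chartAt (EuclideanHalfSpace 2) q).source with hA
  set B := (extChartAt (𝓡∂ 2) q).target ∩ (extChartAt (𝓡∂ 2) q).symm ⁻¹'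
    (chartAt (EuclideanHalfSpace 2) p).source with hB
  set τ : ℝ² → ℝ² := fun z ↦ extChartAt (𝓡∂ 2) q ((extChartAt (𝓡∂ 2) p).symm z) with hτ
  have hqs : ∀ x, x ∈ (chartAt (EuclideanHalfSpace 2) q).source → x ∈ (extChartAt (𝓡∂ 2) q).source :=
    fun x hx ↦ by rwa [extChartAt_source]
  have hps : ∀ x, x ∈ (chartAt (EuclideanHalfSpace 2) p).source → x ∈ (extChartAt (𝓡∂ 2) p).source :=
    fun x hx ↦ by rwa [extChartAt_source]
  have hτψ : ∀ z ∈ A, (extChartAt (𝓡∂ 2) q).symm (τ z) = (extChartAt (𝓡∂ 2) p).symm z :=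
    fun z hz ↦ (extChartAt (𝓡∂ 2) q).left_inv (hqs _ hz.2)
  have himg : τ '' A = B := by
    ext y
    constructor
    · rintro ⟨z, hz, rfl⟩
      refine ⟨(extChartAt (𝓡∂ 2) q).map_source (hqs _ hz.2), ?_⟩
      rw [mem_preimage, hτψ z hz]
      exact symm_mem_source hz.1
    · rintro ⟨hy, hyp⟩
      refine ⟨extChartAt (𝓡∂ 2) p ((extChartAt (𝓡∂ 2) q).symm y), ⟨(extChartAt (𝓡∂ 2) p).map_source
        (hps _ hyp), ?_⟩, ?_⟩
      · rw [mem_preimage, (extChartAt (𝓡∂ 2) p).left_inv (hps _ hyp)]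
        exact symm_mem_source hy
      · simp only [hτ]
        rw [(extChartAt (𝓡∂ 2) p).left_inv (hps _ hyp), (extChartAt (𝓡∂ 2) q).right_inv hy]
  have hinj : InjOn τ A := by
    intro z hz z' hz' hzz
    have : (extChartAt (𝓡∂ 2) p).symm z = (extChartAt (𝓡∂ 2) p).symm z' := by
      rw [← hτψ z hz, ← hτψ z' hz', hzz]
    rw [← (extChartAt (𝓡∂ 2) p).right_inv hz.1, ← (extChartAt (𝓡∂ 2) p).right_inv hz'.1, this]
  have hder : ∀ z ∈ A, HasFDerivWithinAt τ ((chartCoords q ((extChartAt (𝓡∂ 2) p).symm z)).comp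
      (coordField p ((extChartAt (𝓡∂ 2) p).symm z))) A z := fun z hz ↦
    (hasFDerivWithinAt_comp_symm hz.1 (mdifferentiableAt_coord hz.2)).mono
      (inter_subset_left.trans (extChartAt_target_subset_range p))
  -- The orientation enters here: it removes the absolute value from the Jacobian in the change of
  -- variables.
  have hpos : ∀ z ∈ A, 0 < ((chartCoords q ((extChartAt (𝓡∂ 2) p).symm z)).comp
      (coordField p ((extChartAt (𝓡∂ 2) p).symm z))).det := by
    intro z hz
    have h1 := hM _ (chart_mem_atlas _ p) _ (chart_mem_atlas _ q) ((extChartAt (𝓡∂ 2) p).symm z)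
      ⟨symm_mem_source hz.1, hz.2⟩
    have h2 := (hasFDerivWithinAt_comp_symm hz.1 (mdifferentiableAt_coord hz.2)).fderivWithin
      (uniqueDiffOn_halfPlane z (extChartAt_target_subset_range p hz.1))
    have h3 : (chartAt (EuclideanHalfSpace 2) p).extend (𝓡∂ 2) ((extChartAt (𝓡∂ 2) p).symm z) = z :=
      (extChartAt (𝓡∂ 2) p).right_inv hz.1
    rw [h3] at h1
    change 0 < ContinuousLinearMap.det (fderivWithin ℝ (fun z ↦ extChartAt (𝓡∂ 2) q
      ((extChartAt (𝓡∂ 2) p).symm z)) (range (𝓡∂ 2)) z) at h1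
    rw [h2] at h1
    exact h1
  have hAm : MeasurableSet A :=
    measurableSet_target_inter p (chartAt (EuclideanHalfSpace 2) q).open_source
  calc _ = ∫ z in A, density η p ((extChartAt (𝓡∂ 2) p).symm z) := by
        refine setIntegral_eq_of_subset_of_forall_sdiff_eq_zero (measurableSet_target p)
          inter_subset_left ?_
        rintro z ⟨hz, hzA⟩
        exact h0 _ (fun hc ↦ hzA ⟨hz, hc.2⟩) _ _
    _ = ∫ z in A, |((chartCoords q ((extChartAt (𝓡∂ 2) p).symm z)).comp
          (coordField p ((extChartAt (𝓡∂ 2) p).symm z))).det| •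
            density η q ((extChartAt (𝓡∂ 2) q).symm (τ z)) := by
        refine setIntegral_congr_fun hAm fun z hz ↦ ?_
        simp only
        rw [abs_of_pos (hpos z hz), hτψ z hz, h.density_eq hz.2, Complex.real_smul]
    _ = ∫ z in τ '' A, density η q ((extChartAt (𝓡∂ 2) q).symm z) :=
        (integral_image_eq_integral_abs_det_fderiv_smul volume hAm hder hinj
          fun z ↦ density η q ((extChartAt (𝓡∂ 2) q).symm z)).symm
    _ = _ := by
        rw [himg]
        refine (setIntegral_eq_of_subset_of_forall_sdiff_eq_zero (measurableSet_target q)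
          inter_subset_left ?_).symm
        rintro z ⟨hz, hzB⟩
        exact h0 _ (fun hc ↦ hzB ⟨hz, hc.1⟩) _ _

variable [T2Space M] [CompactSpace M]

theorem isSubordinate_chartPartition :
    (chartPartition M).IsSubordinate fun p ↦ (chartAt (EuclideanHalfSpace 2) p).source :=
  (SmoothPartitionOfUnity.exists_isSubordinate_chartAt_source (𝓡∂ 2) M).choose_spec

/-- The support of the member of the partition of unity at `p`, in coordinates. -/
def coordSupport (p : M) : Set ℝ² := extChartAt (𝓡∂ 2) p '' tsupport (chartPartition M p)

theorem tsupport_subset_source (p : M) :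
    tsupport (chartPartition M p) ⊆ (extChartAt (𝓡∂ 2) p).source := by
  rw [extChartAt_source]
  exact isSubordinate_chartPartition p

theorem isCompact_coordSupport (p : M) : IsCompact (coordSupport p) :=
  (isClosed_tsupport _).isCompact.image_of_continuousOn
    ((continuousOn_extChartAt p).mono (tsupport_subset_source p))

theorem coordSupport_subset_target (p : M) : coordSupport p ⊆ (extChartAt (𝓡∂ 2) p).target := by
  rintro _ ⟨x, hx, rfl⟩
  exact (extChartAt (𝓡∂ 2) p).map_source (tsupport_subset_source p hx)

theorem symm_notMem_tsupport {p : M} {z : ℝ²} (hz : z ∈ (extChartAt (𝓡∂ 2) p).target)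
    (hz' : z ∉ coordSupport p) :
    (extChartAt (𝓡∂ 2) p).symm z ∉ tsupport (chartPartition M p) := fun h ↦
  hz' ⟨_, h, (extChartAt (𝓡∂ 2) p).right_inv hz⟩

theorem integrableOn_of_tsupport {p : M} {g : M → ℂ}
    (hg : ContinuousOn (fun z ↦ g ((extChartAt (𝓡∂ 2) p).symm z)) (extChartAt (𝓡∂ 2) p).target)
    (h0 : ∀ x ∉ tsupport (chartPartition M p), g x = 0) :
    IntegrableOn (fun z ↦ g ((extChartAt (𝓡∂ 2) p).symm z)) (extChartAt (𝓡∂ 2) p).target := by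
  refine IntegrableOn.of_forall_sdiff_eq_zero
    ((hg.mono (coordSupport_subset_target p)).integrableOn_compact (isCompact_coordSupport p))
    (measurableSet_target p) ?_
  rintro z ⟨hz, hz'⟩
  exact h0 _ (symm_notMem_tsupport hz hz')

theorem finite_support_chartPartition :
    {p : M | ∃ x, chartPartition M p x ≠ 0}.Finite :=
  ((chartPartition M).locallyFinite.finite_nonempty_of_compact).subset fun _ ⟨x, hx⟩ ↦ ⟨x, hx⟩

theorem continuousOn_chartPartition (p q : M) :
    ContinuousOn (fun z ↦ ((chartPartition M q ((extChartAt (𝓡∂ 2) p).symm z) : ℝ) : ℂ))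
      (extChartAt (𝓡∂ 2) p).target :=
  Complex.continuous_ofReal.comp_continuousOn
    ((chartPartition M q).contMDiff.continuous.comp_continuousOn (contMDiffOn_symm p).continuousOn)

theorem surfaceIntegral_eq (η : ∀ x : M, TangentSpace (𝓡∂ 2) x → TangentSpace (𝓡∂ 2) x → ℂ) :
    surfaceIntegral η = ∑ p ∈ (finite_support_chartPartition (M := M)).toFinset,
      ∫ z in (extChartAt (𝓡∂ 2) p).target,
        ((chartPartition M p ((extChartAt (𝓡∂ 2) p).symm z) : ℝ) : ℂ) *
          density η p ((extChartAt (𝓡∂ 2) p).symm z) := by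
  rw [surfaceIntegral, finsum_eq_sum_of_support_subset]
  · refine Finset.sum_congr rfl fun p _ ↦ setIntegral_congr_fun (measurableSet_target p) ?_
    intro z hz
    simp only [coordinateVector_eq hz, density]
  · intro p hp
    simp only [Finite.coe_toFinset, mem_ofPred_eq]
    by_contra! hc
    apply hp
    simp [hc]

/-- Continuity provides integrability: after multiplication by the partition function the integrand
has compact support in the coordinate domain. -/
theorem surfaceIntegral_sub {η η' : ∀ x : M, TangentSpace (𝓡∂ 2) x → TangentSpace (𝓡∂ 2) x → ℂ}
    (h : ∀ p, ContinuousOn (fun z ↦ density η p ((extChartAt (𝓡∂ 2) p).symm z))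
      (extChartAt (𝓡∂ 2) p).target)
    (h' : ∀ p, ContinuousOn (fun z ↦ density η' p ((extChartAt (𝓡∂ 2) p).symm z))
      (extChartAt (𝓡∂ 2) p).target) :
    surfaceIntegral (fun x u v ↦ η x u v - η' x u v) = surfaceIntegral η - surfaceIntegral η' := by
  rw [surfaceIntegral_eq, surfaceIntegral_eq, surfaceIntegral_eq, ← Finset.sum_sub_distrib]
  refine Finset.sum_congr rfl fun p _ ↦ ?_
  have hi : ∀ η : ∀ x : M, TangentSpace (𝓡∂ 2) x → TangentSpace (𝓡∂ 2) x → ℂ,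
      ContinuousOn (fun z ↦ density η p ((extChartAt (𝓡∂ 2) p).symm z))
        (extChartAt (𝓡∂ 2) p).target →
      IntegrableOn (fun z ↦ ((chartPartition M p ((extChartAt (𝓡∂ 2) p).symm z) : ℝ) : ℂ) *
          density η p ((extChartAt (𝓡∂ 2) p).symm z)) (extChartAt (𝓡∂ 2) p).target := fun η h ↦
    integrableOn_of_tsupport (g := fun x ↦ ((chartPartition M p x : ℝ) : ℂ) * density η p x)
      ((continuousOn_chartPartition p p).mul h) fun x hx ↦ by simp [image_eq_zero_of_notMem_tsupport hx]
  rw [← integral_sub (hi η (h p)) (hi η' (h' p))]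
  simp only [density, mul_sub]

theorem mvfderiv_sum {ι : Type*} {x : M} (S : Finset ι) (f : ι → M → ℝ)
    (hf : ∀ i ∈ S, MDifferentiableAt (𝓡∂ 2) 𝓘(ℝ, ℝ) (f i) x) :
    MDifferentiableAt (𝓡∂ 2) 𝓘(ℝ, ℝ) (∑ i ∈ S, f i) x ∧
    mvfderiv (𝓡∂ 2) (∑ i ∈ S, f i) x = ∑ i ∈ S, mvfderiv (𝓡∂ 2) (f i) x := by
  classical
  induction S using Finset.induction with
  | empty =>
    refine ⟨mdifferentiableAt_const (c := (0 : ℝ)), ?_⟩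
    rw [Finset.sum_empty, Finset.sum_empty, mvfderiv_zero]
  | insert i S hi IH =>
    obtain ⟨h1, h2⟩ := IH fun j hj ↦ hf j (Finset.mem_insert_of_mem hj)
    have h3 := hf i (Finset.mem_insert_self i S)
    rw [Finset.sum_insert hi, Finset.sum_insert hi]
    exact ⟨h3.add h1, by rw [mvfderiv_add h3 h1, h2]⟩

/-- **Stokes' theorem** for one-forms vanishing on the tangent vectors of the boundary. -/
theorem surfaceIntegral_eq_zero (hM : IsOriented M)
    {β : ∀ x : M, TangentSpace (𝓡∂ 2) x →L[ℝ] ℂ}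
    {η : ∀ x : M, TangentSpace (𝓡∂ 2) x → TangentSpace (𝓡∂ 2) x → ℂ}
    (h : IsExteriorDerivative β η)
    (hb : ∀ x ∈ (𝓡∂ 2).boundary M, ∀ v ∈ boundaryTangentSpace x, β x v = 0) :
    surfaceIntegral η = 0 := by
  classical
  set S := (finite_support_chartPartition (M := M)).toFinset with hS
  set ρ := chartPartition M with hρ
  have hρS : ∀ p ∉ S, ∀ x, ρ p x = 0 := by
    intro p hp x
    by_contra hc
    exact hp ((finite_support_chartPartition (M := M)).mem_toFinset.2 ⟨x, hc⟩)
  have hsum : ∀ x, ∑ p ∈ S, ρ p x = 1 := by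
    intro x
    rw [← ρ.sum_eq_one (mem_univ x), finsum_eq_sum_of_support_subset]
    intro p hp
    by_contra hc
    exact hp (hρS p hc x)
  -- `ζ q` is the exterior derivative of `ρ_q β`, a one-form supported in a single chart domain.
  set ζ : M → ∀ x : M, TangentSpace (𝓡∂ 2) x → TangentSpace (𝓡∂ 2) x → ℂ := fun q x u v ↦
    (mvfderiv (𝓡∂ 2) (ρ q) x u : ℂ) * β x v - (mvfderiv (𝓡∂ 2) (ρ q) x v : ℂ) * β x u
        + (ρ q x : ℂ) * η x u v with hζ
  have hζd : ∀ q, IsExteriorDerivative (fun x ↦ ρ q x • β x) (ζ q) := fun q ↦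
    h.smul (ρ q).contMDiff
  have hdρ : ∀ q, ∀ x ∉ tsupport (ρ q), mvfderiv (𝓡∂ 2) (ρ q) x = 0 := by
    intro q x hx
    have : (ρ q : M → ℝ) =ᶠ[𝓝 x] fun _ ↦ 0 := by
      filter_upwards [(isClosed_tsupport _).isOpen_compl.mem_nhds hx] with y hy
      exact image_eq_zero_of_notMem_tsupport hy
    have h1 : HasMFDerivAt (𝓡∂ 2) 𝓘(ℝ, ℝ) (ρ q) x 0 :=
      (hasMFDerivAt_const (0 : ℝ) x).congr_of_eventuallyEq this
    ext v
    exact DFunLike.congr_fun h1.mfderiv v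
  have hζ0 : ∀ q, ∀ x ∉ tsupport (ρ q), ∀ u v, ζ q x u v = 0 := by
    intro q x hx u v
    simp [hζ, hdρ q x hx, image_eq_zero_of_notMem_tsupport hx]
  -- The differentials of the partition functions add up to the differential of the constant `1`;
  -- hence the `ζ q` add up to `η`.
  have hdsum : ∀ x (u : TangentSpace (𝓡∂ 2) x), ∑ q ∈ S, mvfderiv (𝓡∂ 2) (ρ q) x u = 0 := by
    intro x u
    have h1 := (mvfderiv_sum (x := x) S (fun q ↦ (ρ q : M → ℝ))
      fun q _ ↦ (ρ q).contMDiff.contMDiffAt.mdifferentiableAt (by simp)).2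
    have h2 : (∑ q ∈ S, (ρ q : M → ℝ)) = fun _ ↦ 1 := by
      funext y
      rw [Finset.sum_apply, hsum]
    rw [h2, mvfderiv_const] at h1
    have h4 := DFunLike.congr_fun h1 u
    rw [sum_apply] at h4
    exact h4.symm
  have hηsum : ∀ x u v, η x u v = ∑ q ∈ S, ζ q x u v := by
    intro x u v
    simp only [hζ, Finset.sum_add_distrib, Finset.sum_sub_distrib, ← Finset.sum_mul]
    rw [← Complex.ofReal_sum, ← Complex.ofReal_sum, ← Complex.ofReal_sum, hdsum, hdsum, hsum]
    simp
  have hint : ∀ p q, IntegrableOn (fun z ↦ (ρ p ((extChartAt (𝓡∂ 2) p).symm z) : ℂ) *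
      density (ζ q) p ((extChartAt (𝓡∂ 2) p).symm z)) (extChartAt (𝓡∂ 2) p).target := fun p q ↦
    integrableOn_of_tsupport (g := fun x ↦ (ρ p x : ℂ) * density (ζ q) p x)
      ((continuousOn_chartPartition p p).mul ((hζd q).continuousOn_density p))
      fun x hx ↦ by simp [hρ, image_eq_zero_of_notMem_tsupport hx]
  have hint' : ∀ p q, IntegrableOn (fun z ↦ (ρ p ((extChartAt (𝓡∂ 2) q).symm z) : ℂ) *
      density (ζ q) q ((extChartAt (𝓡∂ 2) q).symm z)) (extChartAt (𝓡∂ 2) q).target := fun p q ↦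
    integrableOn_of_tsupport (g := fun x ↦ (ρ p x : ℂ) * density (ζ q) q x)
      ((continuousOn_chartPartition q p).mul ((hζd q).continuousOn_density q))
      fun x hx ↦ by simp [density, hζ0 q x hx]
  rw [surfaceIntegral_eq]
  calc _ = ∑ p ∈ S, ∑ q ∈ S, ∫ z in (extChartAt (𝓡∂ 2) p).target,
          (ρ p ((extChartAt (𝓡∂ 2) p).symm z) : ℂ) *
            density (ζ q) p ((extChartAt (𝓡∂ 2) p).symm z) := by
        refine Finset.sum_congr rfl fun p _ ↦ ?_
        rw [← integral_finsetSum _ fun q _ ↦ hint p q]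
        refine setIntegral_congr_fun (measurableSet_target p) fun z _ ↦ ?_
        simp only [← Finset.mul_sum]
        congr 1
        exact hηsum _ _ _
    -- `ρ_p ζ_q` is supported in the intersection of both chart domains, so its integral may be
    -- moved from the chart at `p` to the chart at `q`. The sum over `p` then removes `ρ_p`.
    _ = ∑ p ∈ S, ∑ q ∈ S, ∫ z in (extChartAt (𝓡∂ 2) q).target,
          (ρ p ((extChartAt (𝓡∂ 2) q).symm z) : ℂ) *
            density (ζ q) q ((extChartAt (𝓡∂ 2) q).symm z) := by
        refine Finset.sum_congr rfl fun p _ ↦ Finset.sum_congr rfl fun q _ ↦ ?_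
        refine integral_density_eq hM (η := fun x u v ↦ (ρ p x : ℂ) * ζ q x u v) ?_ ?_
        · intro x u v a b c d
          simp only [(hζd q).isTwoForm x u v a b c d]
          ring
        · intro x hx u v
          by_cases hxp : x ∈ tsupport (ρ p)
          · have : x ∉ tsupport (ρ q) := fun hxq ↦ hx
              ⟨isSubordinate_chartPartition p hxp, isSubordinate_chartPartition q hxq⟩
            simp [hζ0 q x this]
          · simp [image_eq_zero_of_notMem_tsupport hxp]
    _ = ∑ q ∈ S, ∫ z in (extChartAt (𝓡∂ 2) q).target,
          density (ζ q) q ((extChartAt (𝓡∂ 2) q).symm z) := by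
        rw [Finset.sum_comm]
        refine Finset.sum_congr rfl fun q _ ↦ ?_
        rw [← integral_finsetSum _ fun p _ ↦ hint' p q]
        refine setIntegral_congr_fun (measurableSet_target q) fun z _ ↦ ?_
        simp only [← Finset.sum_mul]
        rw [← Complex.ofReal_sum, hsum]
        simp
    _ = 0 := by
        refine Finset.sum_eq_zero fun q _ ↦ ?_
        -- Each remaining integral lives in one chart, where `∂₁` is tangent to the boundary and so
        -- is annihilated by `β` there.
        have key := integral_halfPlane_of_compact (extChartAt_target_subset_range q)
          (measurableSet_target q) (fun z hz ↦ target_mem_nhdsWithin hz)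
          (isCompact_coordSupport q) (coordSupport_subset_target q)
          ((hζd q).contDiffOn q (stdVec 0)) ((hζd q).contDiffOn q (stdVec 1))
          (fun z hz hz' ↦ by
            rw [smul_apply, image_eq_zero_of_notMem_tsupport (symm_notMem_tsupport hz hz'), zero_smul])
          (fun z hz hz' ↦ by
            rw [smul_apply, image_eq_zero_of_notMem_tsupport (symm_notMem_tsupport hz hz'), zero_smul])
          (fun z hz hz0 ↦ by
            have hzb := (mem_boundary_iff hz).2 hz0
            rw [smul_apply, hb _ hzb _ (coordField_mem_boundaryTangentSpace (symm_mem_source hz) hzb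
              (by simp)), smul_zero])
        rw [← key]
        exact setIntegral_congr_fun (measurableSet_target q) fun z hz ↦ (hζd q).eq q z hz _ _

end Stokes

/-! ### Symplectic linear algebra -/

section LinearAlgebra

variable {V : Type*} [AddCommGroup V] [Module ℝ V]

/-- An endomorphism in the symplectic Lie algebra of a nondegenerate form has trace zero. -/
theorem trace_eq_zero_of_skew [FiniteDimensional ℝ V] (Θ : V →ₗ[ℝ] V →ₗ[ℝ] ℝ)
    (hΘ : ∀ v, (∀ w, Θ v w = 0) → v = 0) (B : V →ₗ[ℝ] V)
    (hB : ∀ v w, Θ (B v) w + Θ v (B w) = 0) : LinearMap.trace ℝ V B = 0 := by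
  have hinj : Function.Injective Θ := by
    rw [injective_iff_map_eq_zero]
    intro v hv
    exact hΘ v fun w ↦ by simp [hv]
  let T : V ≃ₗ[ℝ] Module.Dual ℝ V :=
    LinearEquiv.ofInjectiveOfFinrankEq Θ hinj Subspace.dual_finrank_eq.symm
  -- Under the isomorphism with the dual given by `Θ`, skewness says that the transpose of `B` is
  -- conjugate to `-B`; thus `tr B = -tr B`.
  have h1 : Module.Dual.transpose (R := ℝ) B = T.conj (-B) := by
    ext f w
    obtain ⟨v, rfl⟩ := T.surjective f
    have := hB v w
    have h2 : ∀ v w, T v w = Θ v w := fun _ _ ↦ rfl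
    simp only [Module.Dual.transpose_apply, LinearMap.comp_apply, LinearMap.neg_apply,
      LinearEquiv.conj_apply_apply, LinearEquiv.symm_apply_apply, h2, map_neg]
    linarith
  have h2 := LinearMap.trace_transpose' (R := ℝ) (M := V) B
  rw [h1, LinearMap.trace_conj', map_neg] at h2
  linarith

/-- A complex structure `J` on a vector space with a bilinear form `Θ`, compatible with `Θ`. -/
structure IsCompatible (Θ : V →ₗ[ℝ] V →ₗ[ℝ] ℝ) (J : V →ₗ[ℝ] V) : Prop where
  self_eq_zero : ∀ v, Θ v v = 0
  sq_eq_neg : ∀ v, J (J v) = -v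
  form_map : ∀ v w, Θ (J v) (J w) = Θ v w
  form_pos : ∀ v, v ≠ 0 → 0 < Θ v (J v)

namespace IsCompatible

variable {Θ : V →ₗ[ℝ] V →ₗ[ℝ] ℝ} {J J' : V →ₗ[ℝ] V} {L : Submodule ℝ V}

theorem swap (h : IsCompatible Θ J) (v w : V) : Θ v w = -Θ w v := by
  have := h.self_eq_zero (v + w)
  simp only [map_add, LinearMap.add_apply, h.self_eq_zero] at this
  linarith

theorem symm (h : IsCompatible Θ J) (v w : V) : Θ v (J w) = Θ w (J v) := by
  rw [← h.form_map v, h.sq_eq_neg, map_neg, h.swap w]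

theorem nonneg (h : IsCompatible Θ J) (v : V) : 0 ≤ Θ v (J v) := by
  rcases eq_or_ne v 0 with rfl | hv
  · simp
  · exact (h.form_pos v hv).le

theorem eq_zero (h : IsCompatible Θ J) {v : V} (hv : Θ v (J v) = 0) : v = 0 := by
  by_contra h0
  exact (h.form_pos v h0).ne' hv

/-- With respect to the inner product `Θ (·, J ·)`, the subspace `J L` is the orthogonal complement
of `L`: this rewrites the condition that `L` equals its own symplectic orthogonal. -/
theorem isCompl [FiniteDimensional ℝ V] (h : IsCompatible Θ J)
    (hL : ∀ v, v ∈ L ↔ ∀ w ∈ L, Θ v w = 0) : IsCompl L (L.map J) := by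
  let g : LinearMap.BilinForm ℝ V := Θ.compl₂ J
  have hg : ∀ v w, g v w = Θ v (J w) := fun _ _ ↦ rfl
  have hrefl : g.IsRefl := fun v w hvw ↦ by
    rw [hg] at hvw ⊢
    rw [h.symm, hvw]
  have horth : g.orthogonal L = L.map J := by
    ext v
    rw [LinearMap.BilinForm.mem_orthogonal_iff]
    constructor
    · intro hv
      refine ⟨-J v, ?_, by rw [map_neg, h.sq_eq_neg, neg_neg]⟩
      rw [SetLike.mem_coe, hL]
      intro w hw
      have h1 : Θ w (J v) = 0 := hv w hw
      rw [map_neg, LinearMap.neg_apply, h.swap, h1, neg_zero, neg_zero]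
    · rintro ⟨m, hm, rfl⟩ w hw
      change Θ w (J (J m)) = 0
      rw [h.sq_eq_neg, map_neg, (hL w).1 hw m hm, neg_zero]
  rw [← horth]
  rw [LinearMap.BilinForm.isCompl_orthogonal_iff_disjoint hrefl, horth, Submodule.disjoint_def]
  rintro v hv ⟨m, hm, rfl⟩
  have : Θ m (J m) = 0 := by rw [h.swap, (hL _).1 hv m hm, neg_zero]
  rw [h.eq_zero this, map_zero]

theorem exists_decomposition [FiniteDimensional ℝ V] (h : IsCompatible Θ J)
    (hL : ∀ v, v ∈ L ↔ ∀ w ∈ L, Θ v w = 0) (v : V) : ∃ l ∈ L, ∃ m ∈ L, v = l + J m := by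
  have hv : v ∈ L ⊔ L.map J := by rw [(h.isCompl hL).sup_eq_top]; trivial
  obtain ⟨l, hl, _, ⟨m, hm, rfl⟩, rfl⟩ := Submodule.mem_sup.1 hv
  exact ⟨l, hl, m, hm, rfl⟩

/-- If `A` is complex linear and preserves a Lagrangian subspace, then its complex trace is real. -/
theorem trace_comp_eq_zero [FiniteDimensional ℝ V] (h : IsCompatible Θ J)
    (hL : ∀ v, v ∈ L ↔ ∀ w ∈ L, Θ v w = 0) (A : V →ₗ[ℝ] V) (hAJ : ∀ v, A (J v) = J (A v))
    (hA : ∀ v ∈ L, A v ∈ L) : LinearMap.trace ℝ V (J ∘ₗ A) = 0 := by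
  -- The projection onto `L` along `J L`. Since `A` preserves both summands, `J A` exchanges them;
  -- `hid` separates its two off-diagonal blocks, and `h2` and `h3` show that both have trace zero.
  let P : V →ₗ[ℝ] V := L.subtype ∘ₗ L.projectionOnto (L.map J) (h.isCompl hL)
  have hPl : ∀ l ∈ L, P l = l := fun l hl ↦ by
    simp [P, Submodule.projectionOnto_apply_left (h.isCompl hL) ⟨l, hl⟩]
  have hPJ : ∀ l ∈ L, P (J l) = 0 := fun l hl ↦ by
    simp only [P, LinearMap.comp_apply]
    rw [Submodule.projectionOnto_apply_of_mem_right (h.isCompl hL) ⟨l, hl, rfl⟩]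
    simp
  have hid : J ∘ₗ A = (J ∘ₗ A) ∘ₗ P - ((J ∘ₗ A) ∘ₗ J ∘ₗ P) ∘ₗ J := by
    ext v
    obtain ⟨l, hl, m, hm, rfl⟩ := h.exists_decomposition hL v
    simp only [LinearMap.sub_apply, LinearMap.comp_apply, map_add, hPl l hl, hPJ m hm,
      h.sq_eq_neg, map_neg, hPl m hm, hPJ l hl, map_zero]
    abel
  have h1 : ((J ∘ₗ A) ∘ₗ P) = ((J ∘ₗ A) ∘ₗ P) ∘ₗ P := by
    ext v
    obtain ⟨l, hl, m, hm, rfl⟩ := h.exists_decomposition hL v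
    simp [hPl l hl, hPJ m hm]
  have h2 : LinearMap.trace ℝ V ((J ∘ₗ A) ∘ₗ P) = 0 := by
    rw [h1, LinearMap.trace_comp_comm']
    have : P ∘ₗ (J ∘ₗ A) ∘ₗ P = 0 := by
      ext v
      obtain ⟨l, hl, m, hm, rfl⟩ := h.exists_decomposition hL v
      simp [hPl l hl, hPJ m hm, hPJ _ (hA l hl)]
    rw [this, map_zero]
  have h3 : LinearMap.trace ℝ V (((J ∘ₗ A) ∘ₗ J ∘ₗ P) ∘ₗ J)
      = - LinearMap.trace ℝ V ((J ∘ₗ A) ∘ₗ P) := by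
    rw [LinearMap.trace_comp_comm', ← map_neg]
    congr 1
    ext v
    simp [hAJ, h.sq_eq_neg]
  rw [hid, map_sub, h3, h2]
  simp

/-- If `v = J' J v`, then `J' v = -J v`, so the nonnegative numbers `Θ v (J v)` and `Θ v (J' v)` are
opposite and both vanish. -/
theorem map_sub_comp_injective (h : IsCompatible Θ J) (h' : IsCompatible Θ J') {v : V}
    (hv : v - J' (J v) = 0) : v = 0 := by
  apply h.eq_zero
  have h1 : J' v = - J v := by
    rw [sub_eq_zero.1 hv, h'.sq_eq_neg, ← sub_eq_zero.1 hv]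
  have h2 := h.nonneg v
  have h3 := h'.nonneg v
  rw [h1, map_neg] at h3
  linarith

/-- Invertibility of the convex combinations of two intertwining operators from `(V, J)` to
`(V, J')`, one of which maps `L` to itself. -/
theorem convexCombination_injective [FiniteDimensional ℝ V] (h : IsCompatible Θ J)
    (h' : IsCompatible Θ J') (hL : ∀ v, v ∈ L ↔ ∀ w ∈ L, Θ v w = 0) {ι : Type*} [Fintype ι]
    (σ : ι → V) (hσ : Submodule.span ℝ (range σ) = L) {t : ℝ} (ht0 : 0 ≤ t) (ht1 : t ≤ 1) {v : V}
    (hv : (1 - t) • (v - J' (J v)) + t • ∑ i, (Θ (σ i) (J v) • σ i + Θ (σ i) v • J' (σ i)) = 0) :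
    v = 0 := by
  have hσL : ∀ i, σ i ∈ L := fun i ↦ hσ ▸ Submodule.subset_span (mem_range_self i)
  have hLL : ∀ v ∈ L, ∀ w ∈ L, Θ v w = 0 := fun v hv ↦ (hL v).1 hv
  obtain ⟨l, hl, m, hm, rfl⟩ := h.exists_decomposition hL v
  -- Everything is expressed in the decomposition `L ⊕ J' L` of the target. The operator then maps
  -- `l + J m` to `u + J' n` with `u` and `n` in `L`.
  obtain ⟨x, hx, y, hy, hxy⟩ := h'.exists_decomposition hL (J l)
  obtain ⟨x', hx', y', hy', hxy'⟩ := h'.exists_decomposition hL (J m)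
  set u := (1 - t) • (l + x' + y) + t • ∑ i, Θ (σ i) (J l) • σ i with hu
  set n := (1 - t) • (m + y' - x) + t • ∑ i, Θ (σ i) (J m) • σ i with hn
  have huL : u ∈ L := L.add_mem (L.smul_mem _ (L.add_mem (L.add_mem hl hx') hy))
    (L.smul_mem _ (L.sum_mem fun i _ ↦ L.smul_mem _ (hσL i)))
  have hnL : n ∈ L := L.add_mem (L.smul_mem _ (L.sub_mem (L.add_mem hm hy') hx))
    (L.smul_mem _ (L.sum_mem fun i _ ↦ L.smul_mem _ (hσL i)))
  have hun : u + J' n = 0 := by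
    rw [← hv, hu, hn]
    simp only [map_add, map_smul, map_sub, map_sum, h.sq_eq_neg, map_neg, hxy, h'.sq_eq_neg]
    have e1 : ∀ i, Θ (σ i) (x + J' y) = Θ (σ i) (J l) := fun i ↦ by rw [hxy]
    have e2 : J' (J m) = J' x' - y' := by rw [hxy', map_add, h'.sq_eq_neg]; abel
    have e4 : ∀ i, (Θ (σ i) x + Θ (σ i) (J' y) + -Θ (σ i) m) • σ i
        + (Θ (σ i) l + Θ (σ i) (J m)) • J' (σ i)
        = Θ (σ i) (J l) • σ i + Θ (σ i) (J m) • J' (σ i) := fun i ↦ by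
      rw [hLL _ (hσL i) _ hm, hLL _ (hσL i) _ hl, ← e1 i, map_add]
      simp
    have e5 : ∀ i, (Θ (σ i) x + Θ (σ i) (J' y)) • σ i = Θ (σ i) (J l) • σ i := fun i ↦ by
      rw [← e1 i, map_add]
    simp only [e4, e5, Finset.sum_add_distrib, smul_add]
    rw [hxy']
    simp only [smul_add, smul_sub, smul_neg]
    abel
  -- Both components vanish because the sum is direct. Pairing `u` with `l` and `n` with `m` in the
  -- inner product of `J` gives a scalar identity that will be a sum of nonnegative terms.
  have hu0 : Θ l (J u) + Θ m (J n) = 0 := by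
    have hu1 : u = 0 := by
      have : u ∈ L ⊓ L.map J' := ⟨huL, -n, L.neg_mem hnL, by
        rw [map_neg]; exact (eq_neg_of_add_eq_zero_left hun).symm⟩
      rwa [(h'.isCompl hL).inf_eq_bot, Submodule.mem_bot] at this
    have hn1 : n = 0 := by
      rw [hu1, zero_add] at hun
      rw [← neg_neg n, ← h'.sq_eq_neg n, hun, map_zero, neg_zero]
    simp [hu1, hn1]
  have hsq : ∀ a, Θ a (J (∑ i, Θ (σ i) (J a) • σ i)) = ∑ i, Θ (σ i) (J a) ^ 2 := fun a ↦ by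
    simp only [map_sum, map_smul, smul_eq_mul]
    refine Finset.sum_congr rfl fun i _ ↦ ?_
    rw [h.symm a, sq]
  have k1 : Θ l (J x') = Θ x' (J' y) := by
    rw [h.symm, hxy, map_add, hLL _ hx' _ hx, zero_add]
  have k2 : Θ m (J x) = Θ x (J' y') := by
    rw [h.symm, hxy', map_add, hLL _ hx _ hx', zero_add]
  have k3 : Θ l (J y) = Θ y (J' y) := by
    rw [h.symm, hxy, map_add, hLL _ hy _ hx, zero_add]
  have k4 : Θ m (J y') = Θ y' (J' y') := by
    rw [h.symm, hxy', map_add, hLL _ hy' _ hx', zero_add]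
  -- The only terms without a sign, coming from `k1` and `k2`, cancel. This is the relation `Θ (J m)
  -- (J l) = Θ m l = 0` written in the second decomposition.
  have k5 : Θ x' (J' y) = Θ x (J' y') := by
    have := h.form_map m l
    rw [hLL _ hm _ hl, hxy, hxy'] at this
    simp only [map_add, LinearMap.add_apply, h'.form_map, hLL _ hx' _ hx, hLL _ hy' _ hy,
      h'.swap (J' y') x] at this
    linarith
  rw [hu, hn] at hu0
  simp only [map_add, map_smul, map_sub, hsq, smul_eq_mul] at hu0
  rw [k1, k2, k3, k4, k5] at hu0
  have p1 := h.nonneg l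
  have p2 := h.nonneg m
  have p3 := h'.nonneg y
  have p4 := h'.nonneg y'
  have p5 : 0 ≤ ∑ i, Θ (σ i) (J l) ^ 2 := Finset.sum_nonneg fun i _ ↦ sq_nonneg _
  have p6 : 0 ≤ ∑ i, Θ (σ i) (J m) ^ 2 := Finset.sum_nonneg fun i _ ↦ sq_nonneg _
  have hspan : ∀ a ∈ L, ∑ i, Θ (σ i) (J a) ^ 2 = 0 → a = 0 := by
    intro a ha h0
    rw [Finset.sum_eq_zero_iff_of_nonneg fun i _ ↦ sq_nonneg _] at h0
    apply h.eq_zero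
    rw [← hσ] at ha
    have : ∀ b ∈ Submodule.span ℝ (range σ), Θ b (J a) = 0 := by
      intro b hb
      induction hb using Submodule.span_induction with
      | mem b hb =>
        obtain ⟨i, rfl⟩ := hb
        exact pow_eq_zero_iff two_ne_zero |>.1 (h0 i (Finset.mem_univ _))
      | zero => simp
      | add b c _ _ hb hc => simp [hb, hc]
      | smul r b _ hb => simp [hb]
    exact this a ha
  have key : (1 - t) * (Θ l (J l) + Θ y (J' y) + Θ m (J m) + Θ y' (J' y'))
      + t * (∑ i, Θ (σ i) (J l) ^ 2 + ∑ i, Θ (σ i) (J m) ^ 2) = 0 := by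
    linarith
  have q1 : 0 ≤ (1 - t) * (Θ l (J l) + Θ y (J' y) + Θ m (J m) + Θ y' (J' y')) :=
    mul_nonneg (by linarith) (by linarith)
  have q2 : 0 ≤ t * (∑ i, Θ (σ i) (J l) ^ 2 + ∑ i, Θ (σ i) (J m) ^ 2) :=
    mul_nonneg ht0 (by linarith)
  -- At `t = 0` definiteness of `Θ (·, J ·)` suffices. For `t > 0` the sum of squares vanishes, so
  -- `l` and `m` are orthogonal to the spanning family `σ`, hence to themselves.
  have hlm : l = 0 ∧ m = 0 := by
    rcases ht0.eq_or_lt with rfl | hpos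
    · exact ⟨h.eq_zero (by linarith), h.eq_zero (by linarith)⟩
    · have : ∑ i, Θ (σ i) (J l) ^ 2 + ∑ i, Θ (σ i) (J m) ^ 2 = 0 := by
        have h0 : t * (∑ i, Θ (σ i) (J l) ^ 2 + ∑ i, Θ (σ i) (J m) ^ 2) = 0 := by linarith
        exact (mul_eq_zero.1 h0).resolve_left hpos.ne'
      exact ⟨hspan l hl (by linarith), hspan m hm (by linarith)⟩
  simp [hlm.1, hlm.2]

end IsCompatible

end LinearAlgebra

/-! ### Smooth sections in coordinates -/

section Sections

variable {M : Type*} [TopologicalSpace M] [ChartedSpace (EuclideanHalfSpace 2) M]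
  [IsManifold (𝓡∂ 2) ∞ M]
  {F : Type*} [NormedAddCommGroup F] [NormedSpace ℝ F]
  {E : M → Type*} [TopologicalSpace (TotalSpace F E)] [∀ x, AddCommGroup (E x)]
  [∀ x, Module ℝ (E x)] [∀ x, TopologicalSpace (E x)] [∀ x, IsTopologicalAddGroup (E x)]
  [∀ x, ContinuousSMul ℝ (E x)] [FiberBundle F E] [VectorBundle ℝ F E]
  [ContMDiffVectorBundle ∞ F E (𝓡∂ 2)]
  {F' : Type*} [NormedAddCommGroup F'] [NormedSpace ℝ F']
  {E' : M → Type*} [TopologicalSpace (TotalSpace F' E')] [∀ x, AddCommGroup (E' x)]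
  [∀ x, Module ℝ (E' x)] [∀ x, TopologicalSpace (E' x)] [∀ x, IsTopologicalAddGroup (E' x)]
  [∀ x, ContinuousSMul ℝ (E' x)] [FiberBundle F' E'] [VectorBundle ℝ F' E']
  [ContMDiffVectorBundle ∞ F' E' (𝓡∂ 2)]

variable (F) in
/-- The section `s` is smooth near `x`. -/
abbrev SmoothAt (s : ∀ y, E y) (x : M) : Prop :=
  ContMDiffAt (𝓡∂ 2) ((𝓡∂ 2).prod 𝓘(ℝ, F)) ∞ (fun y ↦ TotalSpace.mk' F y (s y)) x

variable (F) in
/-- The section `s` is differentiable at `x`. -/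
abbrev DiffAt (s : ∀ y, E y) (x : M) : Prop :=
  MDifferentiableAt (𝓡∂ 2) ((𝓡∂ 2).prod 𝓘(ℝ, F)) (fun y ↦ TotalSpace.mk' F y (s y)) x

theorem SmoothAt.diffAt {s : ∀ y, E y} {x : M} (h : SmoothAt F s x) : DiffAt F s x :=
  h.mdifferentiableAt (by simp)

variable (F) in
/-- The section `s` is smooth at all points of a neighbourhood of `x`. -/
def SmoothNear (s : ∀ y, E y) (x : M) : Prop := ∀ᶠ y in 𝓝 x, SmoothAt F s y

theorem SmoothNear.smoothAt {s : ∀ y, E y} {x : M} (h : SmoothNear F s x) : SmoothAt F s x :=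
  h.self_of_nhds

theorem SmoothNear.diffAt {s : ∀ y, E y} {x : M} (h : SmoothNear F s x) : DiffAt F s x :=
  h.smoothAt.diffAt

theorem SmoothNear.of_contMDiffOn {s : ∀ y, E y} {x : M} {U : Set M} (hU : U ∈ 𝓝 x)
    (hs : ContMDiffOn (𝓡∂ 2) ((𝓡∂ 2).prod 𝓘(ℝ, F)) ∞ (fun y ↦ TotalSpace.mk' F y (s y)) U) :
    SmoothNear F s x := by
  filter_upwards [eventually_mem_nhds_iff.2 hU] with y hy using hs.contMDiffAt hy

theorem SmoothNear.exists_contMDiffOn {s : ∀ y, E y} {x : M} (h : SmoothNear F s x) :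
    ∃ U ∈ 𝓝 x,
      ContMDiffOn (𝓡∂ 2) ((𝓡∂ 2).prod 𝓘(ℝ, F)) ∞ (fun y ↦ TotalSpace.mk' F y (s y)) U :=
  ⟨{y | SmoothAt F s y}, h, fun _ hy ↦ ContMDiffAt.contMDiffWithinAt hy⟩

theorem DiffAt.congr {s t : ∀ y, E y} {x : M} (h : DiffAt F s x) (hst : ∀ᶠ y in 𝓝 x, t y = s y) :
    DiffAt F t x :=
  h.congr_of_eventuallyEq (hst.mono fun y hy ↦ congrArg (TotalSpace.mk' F y) hy)

theorem SmoothAt.congr {s t : ∀ y, E y} {x : M} (h : SmoothAt F s x)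
    (hst : ∀ᶠ y in 𝓝 x, t y = s y) : SmoothAt F t x :=
  h.congr_of_eventuallyEq (hst.mono fun y hy ↦ congrArg (TotalSpace.mk' F y) hy)

variable (e : Trivialization F (π F E)) [MemTrivializationAtlas e]

/-- The section with constant value `f` in the trivialization `e`. -/
def constSection (f : F) (y : M) : E y := e.symmL ℝ y f

/-- The expression of the section `s` in the trivialization `e`. -/
def triv (s : ∀ y, E y) (y : M) : F := e.continuousLinearMapAt ℝ y (s y)

variable {e}

theorem triv_constSection {x : M} (hx : x ∈ e.baseSet) (f : F) : triv e (constSection e f) x = f :=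
  e.continuousLinearMapAt_symmL hx f

theorem constSection_triv {x : M} (hx : x ∈ e.baseSet) (s : ∀ y, E y) :
    constSection e (triv e s x) x = s x :=
  e.symmL_continuousLinearMapAt hx (s x)

theorem triv_eq {x : M} (hx : x ∈ e.baseSet) (s : ∀ y, E y) : (e ⟨x, s x⟩).2 = triv e s x := by
  rw [triv, Trivialization.continuousLinearMapAt_apply, e.coe_linearMapAt_of_mem hx]

theorem smoothAt_iff {x : M} (hx : x ∈ e.baseSet) {s : ∀ y, E y} :
    SmoothAt F s x ↔ ContMDiffAt (𝓡∂ 2) 𝓘(ℝ, F) ∞ (triv e s) x := by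
  rw [SmoothAt, e.contMDiffAt_section_iff hx]
  have : (fun y ↦ (e ⟨y, s y⟩).2) =ᶠ[𝓝 x] triv e s := by
    filter_upwards [e.open_baseSet.mem_nhds hx] with y hy using triv_eq hy s
  exact this.contMDiffAt_iff

theorem diffAt_iff {x : M} (hx : x ∈ e.baseSet) {s : ∀ y, E y} :
    DiffAt F s x ↔ MDifferentiableAt (𝓡∂ 2) 𝓘(ℝ, F) (triv e s) x := by
  have : ContMDiffVectorBundle 1 F E (𝓡∂ 2) := .of_le (n := ∞) (by simp)
  rw [DiffAt, e.mdifferentiableAt_section_iff _ _ hx]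
  have : (fun y ↦ (e ⟨y, s y⟩).2) =ᶠ[𝓝 x] triv e s := by
    filter_upwards [e.open_baseSet.mem_nhds hx] with y hy using triv_eq hy s
  exact this.mdifferentiableAt_iff

theorem smoothAt_constSection {x : M} (hx : x ∈ e.baseSet) (f : F) :
    SmoothAt F (constSection e f) x := by
  rw [smoothAt_iff hx]
  refine (contMDiffAt_const (c := f)).congr_of_eventuallyEq ?_
  filter_upwards [e.open_baseSet.mem_nhds hx] with y hy using triv_constSection hy f

theorem contDiffWithinAt_sum_smulRight {ι V W : Type*} [Fintype ι]
    [NormedAddCommGroup W] [NormedSpace ℝ W] [NormedAddCommGroup V] [NormedSpace ℝ V]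
    (l : ι → F →L[ℝ] ℝ) {g : ι → V → W} {S : Set V} {x : V}
    (h : ∀ j, ContDiffWithinAt ℝ ∞ (g j) S x) :
    ContDiffWithinAt ℝ ∞ (fun y ↦ ∑ j, (l j).smulRight (g j y)) S x :=
  ContDiffWithinAt.sum fun j _ ↦ (ContinuousLinearMap.contDiff
    (ContinuousLinearMap.smulRightL ℝ F W (l j))).contDiffAt.comp_contDiffWithinAt x (h j)

theorem contMDiffAt_sum_smulRight {ι W : Type*} [Fintype ι]
    [NormedAddCommGroup W] [NormedSpace ℝ W]
    (l : ι → F →L[ℝ] ℝ) {g : ι → M → W} {x : M}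
    (h : ∀ j, ContMDiffAt (𝓡∂ 2) 𝓘(ℝ, W) ∞ (g j) x) :
    ContMDiffAt (𝓡∂ 2) 𝓘(ℝ, F →L[ℝ] W) ∞ (fun y ↦ ∑ j, (l j).smulRight (g j y)) x :=
  ContMDiffAt.sum fun j _ ↦ (ContinuousLinearMap.contMDiff
    (ContinuousLinearMap.smulRightL ℝ F W (l j))).contMDiffAt.comp x (h j)

theorem eq_sum_smulRight [FiniteDimensional ℝ F] {W : Type*} [NormedAddCommGroup W]
    [NormedSpace ℝ W] (g : F →L[ℝ] W) :
    g = ∑ j, (LinearMap.toContinuousLinearMap ((Module.finBasis ℝ F).coord j)).smulRight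
      (g (Module.finBasis ℝ F j)) := by
  ext f
  conv_lhs => rw [← (Module.finBasis ℝ F).sum_repr f]
  simp only [map_sum, map_smul]
  simp

/-- A family of operators from a finite-dimensional space is smooth if its values at fixed vectors
are. -/
theorem contMDiffAt_clm_of_apply [FiniteDimensional ℝ F] {W : Type*} [NormedAddCommGroup W]
    [NormedSpace ℝ W] {g : M → F →L[ℝ] W} {x : M}
    (h : ∀ f, ContMDiffAt (𝓡∂ 2) 𝓘(ℝ, W) ∞ (fun y ↦ g y f) x) :
    ContMDiffAt (𝓡∂ 2) 𝓘(ℝ, F →L[ℝ] W) ∞ g x := by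
  rw [funext fun y ↦ eq_sum_smulRight (g y)]
  exact contMDiffAt_sum_smulRight _ fun j ↦ h _

theorem contDiffWithinAt_clm_of_apply [FiniteDimensional ℝ F] {W V : Type*}
    [NormedAddCommGroup W] [NormedSpace ℝ W] [NormedAddCommGroup V] [NormedSpace ℝ V]
    {g : V → F →L[ℝ] W} {S : Set V} {x : V}
    (h : ∀ f, ContDiffWithinAt ℝ ∞ (fun y ↦ g y f) S x) : ContDiffWithinAt ℝ ∞ g S x := by
  rw [funext fun y ↦ eq_sum_smulRight (g y)]
  exact contDiffWithinAt_sum_smulRight _ fun j ↦ h _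

/-- A bundle map is smooth if it maps local sections which are constant in a trivialization to
smooth sections. -/
theorem smoothAt_hom_of_apply [FiniteDimensional ℝ F] {Φ : ∀ y, E y →L[ℝ] E' y} {x : M}
    (h : ∀ f : F, SmoothAt F' (fun y ↦ Φ y (constSection (trivializationAt F E x) f y)) x) :
    SmoothAt (F →L[ℝ] F') Φ x := by
  refine (contMDiffAt_hom_bundle _).2 ⟨contMDiffAt_id, ?_⟩
  refine contMDiffAt_clm_of_apply fun f ↦ ?_
  exact (smoothAt_iff (FiberBundle.mem_baseSet_trivializationAt F' E' x)).1 (h f)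

theorem SmoothAt.apply {Φ : ∀ y, E y →L[ℝ] E' y} {x : M} (h : SmoothAt (F →L[ℝ] F') Φ x)
    {s : ∀ y, E y} (hs : SmoothAt F s x) : SmoothAt F' (fun y ↦ Φ y (s y)) x :=
  ContMDiffAt.clm_bundle_apply h hs

theorem DiffAt.apply {Φ : ∀ y, E y →L[ℝ] E' y} {x : M} (h : SmoothAt (F →L[ℝ] F') Φ x)
    {s : ∀ y, E y} (hs : DiffAt F s x) : DiffAt F' (fun y ↦ Φ y (s y)) x :=
  have : ContMDiffVectorBundle 1 F E (𝓡∂ 2) := .of_le (n := ∞) (by simp)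
  have : ContMDiffVectorBundle 1 F' E' (𝓡∂ 2) := .of_le (n := ∞) (by simp)
  MDifferentiableAt.clm_bundle_apply h.diffAt hs

theorem SmoothNear.apply {Φ : ∀ y, E y →L[ℝ] E' y} {x : M} (h : SmoothNear (F →L[ℝ] F') Φ x)
    {s : ∀ y, E y} (hs : SmoothNear F s x) : SmoothNear F' (fun y ↦ Φ y (s y)) x := by
  filter_upwards [h, hs] with y hy hsy using hy.apply hsy

theorem smoothNear_constSection {x : M} (hx : x ∈ e.baseSet) (f : F) :
    SmoothNear F (constSection e f) x := by
  filter_upwards [e.open_baseSet.mem_nhds hx] with y hy using smoothAt_constSection hy f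

end Sections

/-! ### Connections in coordinates -/

section ConnectionForm

variable {M : Type*} [TopologicalSpace M] [ChartedSpace (EuclideanHalfSpace 2) M]
  [IsManifold (𝓡∂ 2) ∞ M]
  {F : Type*} [NormedAddCommGroup F] [NormedSpace ℝ F]
  {E : M → Type*} [TopologicalSpace (TotalSpace F E)] [∀ x, AddCommGroup (E x)]
  [∀ x, Module ℝ (E x)] [∀ x, TopologicalSpace (E x)] [∀ x, IsTopologicalAddGroup (E x)]
  [∀ x, ContinuousSMul ℝ (E x)] [FiberBundle F E] [VectorBundle ℝ F E]
  [ContMDiffVectorBundle ∞ F E (𝓡∂ 2)]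

theorem cov_sum (D : CovariantDerivative (𝓡∂ 2) F E) {ι : Type*} {x : M} (S : Finset ι)
    (σ : ι → ∀ y, E y) (hσ : ∀ i ∈ S, DiffAt F (σ i) x) :
    DiffAt F (∑ i ∈ S, σ i) x ∧ D (∑ i ∈ S, σ i) x = ∑ i ∈ S, D (σ i) x := by
  classical
  induction S using Finset.induction with
  | empty =>
    refine ⟨mdifferentiableAt_zeroSection .., ?_⟩
    rw [Finset.sum_empty, Finset.sum_empty, D.isCovariantDerivativeOnUniv.zero]
  | insert i S hi IH =>
    obtain ⟨h1, h2⟩ := IH fun j hj ↦ hσ j (Finset.mem_insert_of_mem hj)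
    have h3 := hσ i (Finset.mem_insert_self i S)
    rw [Finset.sum_insert hi, Finset.sum_insert hi]
    exact ⟨mdifferentiableAt_add_section h3 h1,
      by rw [D.isCovariantDerivativeOnUniv.add h3 h1, h2]⟩

theorem cov_congr (D : CovariantDerivative (𝓡∂ 2) F E) {s t : ∀ y, E y} {x : M}
    (hs : DiffAt F s x) (hst : ∀ᶠ y in 𝓝 x, t y = s y) : D t x = D s x :=
  D.isCovariantDerivativeOnUniv.congr_of_eventuallyEq (hs.congr hst) hs Filter.univ_mem hst

/-- The smoothness of a connection is used on globally smooth sections. A bump function equal to `1`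
near `x` makes the section global, and locality of `D` removes it again. -/
theorem smoothAt_cov [T2Space M] {D : CovariantDerivative (𝓡∂ 2) F E}
    (hD : CovariantDerivative.ContMDiffCovariantDerivative D ∞) {s : ∀ y, E y} {x : M}
    (hs : SmoothNear F s x) :
    SmoothAt (E := fun y ↦ TangentSpace (𝓡∂ 2) y →L[ℝ] E y) (ℝ² →L[ℝ] F) (D s) x := by
  obtain ⟨U, hU, hsU⟩ := hs.exists_contMDiffOn
  obtain ⟨f, hf⟩ := (SmoothBumpFunction.nhds_basis_tsupport (I := 𝓡∂ 2) x).mem_iff.1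
    (interior_mem_nhds.2 hU)
  have h1 := ContMDiffOn.smul_section_of_tsupport (V := E) (F := F) (s := s)
    f.contMDiff.contMDiffOn isOpen_interior hf.2 (hsU.mono interior_subset)
  have h2 := hD.contMDiff.contMDiff (σ := (f : M → ℝ) • s) (by simpa using h1.contMDiffOn)
  refine SmoothAt.congr (h2.contMDiffAt (x := x) Filter.univ_mem) ?_
  have hev : ∀ᶠ y in 𝓝 x, ∀ᶠ z in 𝓝 y, f z = 1 := f.eventuallyEq_one.eventually_nhds
  filter_upwards [hev, hs] with y hy hyU
  refine (cov_congr D hyU.diffAt ?_).symm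
  filter_upwards [hy] with z hz
  simp [hz]

variable [FiniteDimensional ℝ F]
variable (e : Trivialization F (π F E)) [MemTrivializationAtlas e]

/-- The connection form of `D` in the trivialization `e` and in the chart at `p`. -/
def connectionForm (D : CovariantDerivative (𝓡∂ 2) F E) (p : M) (z : ℝ²) :
    F →L[ℝ] ℝ² →L[ℝ] F :=
  ∑ j, (LinearMap.toContinuousLinearMap ((Module.finBasis ℝ F).coord j)).smulRight
    (e.continuousLinearMapAt ℝ ((extChartAt (𝓡∂ 2) p).symm z) ∘L
      D (constSection e (Module.finBasis ℝ F j)) ((extChartAt (𝓡∂ 2) p).symm z) ∘L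
      coordField p ((extChartAt (𝓡∂ 2) p).symm z))

variable {e}

/-- `D = d + Γ` in a trivialization: expand `s` in the frame of constant sections, and apply the
Leibniz rule to each term. -/
theorem triv_cov {D : CovariantDerivative (𝓡∂ 2) F E} {p : M} {z : ℝ²}
    (hz : z ∈ (extChartAt (𝓡∂ 2) p).target) (hb : (extChartAt (𝓡∂ 2) p).symm z ∈ e.baseSet)
    {s : ∀ y, E y} (hs : DiffAt F s ((extChartAt (𝓡∂ 2) p).symm z)) (w : ℝ²) :
    e.continuousLinearMapAt ℝ ((extChartAt (𝓡∂ 2) p).symm z)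
        (D s ((extChartAt (𝓡∂ 2) p).symm z) (coordField p ((extChartAt (𝓡∂ 2) p).symm z) w))
      = fderivWithin ℝ (fun z ↦ triv e s ((extChartAt (𝓡∂ 2) p).symm z)) (range (𝓡∂ 2)) z w
        + connectionForm e D p z (triv e s ((extChartAt (𝓡∂ 2) p).symm z)) w := by
  have hs' := (diffAt_iff hb).1 hs
  rw [fderivWithin_comp_symm hz hs', connectionForm]
  set x := (extChartAt (𝓡∂ 2) p).symm z
  set b := Module.finBasis ℝ F
  set v := coordField p x w
  let l : Fin (Module.finrank ℝ F) → F →L[ℝ] ℝ := fun j ↦ LinearMap.toContinuousLinearMap (b.coord j)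
  have hl : ∀ j, MDifferentiableAt (𝓡∂ 2) 𝓘(ℝ, ℝ) (fun y ↦ l j (triv e s y)) x ∧
      mvfderiv (𝓡∂ 2) (fun y ↦ l j (triv e s y)) x v = l j (mvfderiv (𝓡∂ 2) (triv e s) x v) := by
    intro j
    have h := (l j).hasMFDerivAt.comp x hs'.hasMFDerivAt
    exact ⟨h.mdifferentiableAt, DFunLike.congr_fun h.mfderiv v⟩
  have hc : ∀ j, DiffAt F (constSection e (b j)) x := fun j ↦ (smoothAt_constSection hb _).diffAt
  have h1 := cov_sum D Finset.univ (fun j ↦ (fun y ↦ l j (triv e s y)) • constSection e (b j))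
    fun j _ ↦ (hl j).1.smul_section (hc j)
  have hsum : ∀ y ∈ e.baseSet,
      s y = (∑ j, (fun y ↦ l j (triv e s y)) • constSection e (b j)) y := by
    intro y hy
    rw [Finset.sum_apply]
    conv_lhs => rw [← constSection_triv hy s, ← b.sum_repr (triv e s y), constSection, map_sum]
    refine Finset.sum_congr rfl fun j _ ↦ ?_
    rw [map_smul]
    rfl
  have h2 : D s x = _ := (cov_congr D h1.1
    (Filter.eventually_of_mem (e.open_baseSet.mem_nhds hb) hsum)).trans h1.2
  rw [h2, sum_apply, map_sum, sum_apply, sum_apply]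
  have h3 : mvfderiv (𝓡∂ 2) (triv e s) x v
      = ∑ j, l j (mvfderiv (𝓡∂ 2) (triv e s) x v) • b j := (b.sum_repr _).symm
  rw [h3, ← Finset.sum_add_distrib]
  refine Finset.sum_congr rfl fun j _ ↦ ?_
  rw [D.isCovariantDerivativeOnUniv.leibniz (hc j) (hl j).1]
  simp only [add_apply, smul_apply, ContinuousLinearMap.smulRight_apply, map_add, map_smul,
    ContinuousLinearMap.comp_apply]
  rw [(hl j).2, add_comm]
  congr 2
  exact triv_constSection hb (b j)

theorem triv_smooth {p : M} {z : ℝ²} (hz : z ∈ (extChartAt (𝓡∂ 2) p).target)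
    (hb : (extChartAt (𝓡∂ 2) p).symm z ∈ e.baseSet) {s : ∀ y, E y}
    (hs : SmoothAt F s ((extChartAt (𝓡∂ 2) p).symm z)) :
    ContDiffWithinAt ℝ ∞ (fun z ↦ triv e s ((extChartAt (𝓡∂ 2) p).symm z)) (range (𝓡∂ 2)) z := by
  have h := ((smoothAt_iff hb).1 hs).comp_contMDiffWithinAt z (contMDiffOn_symm p z hz)
  exact h.contDiffWithinAt.mono_of_mem_nhdsWithin (target_mem_nhdsWithin hz)

theorem smoothAt_coordField {p x : M} (hx : x ∈ (chartAt (EuclideanHalfSpace 2) p).source) (w : ℝ²) :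
    SmoothAt (E := fun y : M ↦ TangentSpace (𝓡∂ 2) y) ℝ² (fun y ↦ coordField p y w) x :=
  smoothAt_constSection (e := trivializationAt ℝ² (TangentSpace (𝓡∂ 2)) p) (by simpa using hx) w

/-- The form is a finite sum over a basis of covariant derivatives of constant sections, each of
them smooth. -/
theorem contDiffWithinAt_connectionForm [T2Space M] {D : CovariantDerivative (𝓡∂ 2) F E}
    (hD : CovariantDerivative.ContMDiffCovariantDerivative D ∞) {p : M} {z : ℝ²}
    (hz : z ∈ (extChartAt (𝓡∂ 2) p).target) (hb : (extChartAt (𝓡∂ 2) p).symm z ∈ e.baseSet) :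
    ContDiffWithinAt ℝ ∞ (connectionForm e D p) (range (𝓡∂ 2)) z := by
  refine contDiffWithinAt_sum_smulRight _ fun j ↦ ?_
  exact contDiffWithinAt_clm_of_apply fun w ↦ triv_smooth hz hb
    (SmoothAt.apply (smoothAt_cov hD (smoothNear_constSection hb _))
      (smoothAt_coordField (symm_mem_source hz) w))

end ConnectionForm

/-! ### The curvature in coordinates -/

section Curvature

variable {F : Type*} [NormedAddCommGroup F] [NormedSpace ℝ F]

/-- The curvature `∂_u Γ_v - ∂_v Γ_u + [Γ_u, Γ_v]` of a connection form `Γ` on the half-plane. -/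
def curvatureForm (Γ : ℝ² → F →L[ℝ] ℝ² →L[ℝ] F) (z u v : ℝ²) : F →L[ℝ] F :=
  (fderivWithin ℝ Γ (range (𝓡∂ 2)) z u).flip v - (fderivWithin ℝ Γ (range (𝓡∂ 2)) z v).flip u
    + ((Γ z).flip u ∘L (Γ z).flip v - (Γ z).flip v ∘L (Γ z).flip u)

/-- The covariant derivative of `g` along the vector field `Y`. -/
def covariantForm (Γ : ℝ² → F →L[ℝ] ℝ² →L[ℝ] F) (g : ℝ² → F) (Y : ℝ² → ℝ²) (z : ℝ²) : F :=
  fderivWithin ℝ g (range (𝓡∂ 2)) z (Y z) + Γ z (g z) (Y z)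

theorem closure_interior_halfPlane {z : ℝ²} (hz : z ∈ range (𝓡∂ 2)) :
    z ∈ closure (interior (range (𝓡∂ 2))) :=
  (𝓡∂ 2).range_subset_closure_interior hz

theorem hasFDerivWithinAt_covariantForm {Γ : ℝ² → F →L[ℝ] ℝ² →L[ℝ] F} {g : ℝ² → F} {Y : ℝ² → ℝ²}
    {z : ℝ²} (hz : z ∈ range (𝓡∂ 2)) (hΓ : DifferentiableWithinAt ℝ Γ (range (𝓡∂ 2)) z)
    (hg : ContDiffWithinAt ℝ 2 g (range (𝓡∂ 2)) z)
    (hY : DifferentiableWithinAt ℝ Y (range (𝓡∂ 2)) z) :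
    DifferentiableWithinAt ℝ (covariantForm Γ g Y) (range (𝓡∂ 2)) z ∧ ∀ w : ℝ²,
    fderivWithin ℝ (covariantForm Γ g Y) (range (𝓡∂ 2)) z w
      = fderivWithin ℝ (fderivWithin ℝ g (range (𝓡∂ 2))) (range (𝓡∂ 2)) z w (Y z)
        + fderivWithin ℝ g (range (𝓡∂ 2)) z (fderivWithin ℝ Y (range (𝓡∂ 2)) z w)
        + (fderivWithin ℝ Γ (range (𝓡∂ 2)) z w (g z) (Y z)
          + Γ z (fderivWithin ℝ g (range (𝓡∂ 2)) z w) (Y z)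
          + Γ z (g z) (fderivWithin ℝ Y (range (𝓡∂ 2)) z w)) := by
  have h1 : DifferentiableWithinAt ℝ (fderivWithin ℝ g (range (𝓡∂ 2))) (range (𝓡∂ 2)) z :=
    (hg.fderivWithin_right (m := 1) uniqueDiffOn_halfPlane (by norm_num) hz).differentiableWithinAt
      one_ne_zero
  have h2 := hg.differentiableWithinAt two_ne_zero
  have h3 := (h1.hasFDerivWithinAt.clm_apply hY.hasFDerivWithinAt).add
    ((hΓ.hasFDerivWithinAt.clm_apply h2.hasFDerivWithinAt).clm_apply hY.hasFDerivWithinAt)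
  refine ⟨h3.differentiableWithinAt, fun w ↦ ?_⟩
  have h4 : HasFDerivWithinAt (covariantForm Γ g Y) _ (range (𝓡∂ 2)) z := h3
  rw [h4.fderivWithin (uniqueDiffOn_halfPlane z hz)]
  simp
  abel

/-- The second derivatives of `g` cancel by symmetry, and the derivatives of the vector fields are
absorbed by the bracket. What remains is of order zero in `g`, `X` and `Y`, which is the source of
tensoriality. -/
theorem curvatureForm_apply {Γ : ℝ² → F →L[ℝ] ℝ² →L[ℝ] F} {g : ℝ² → F} {X Y : ℝ² → ℝ²}
    {z : ℝ²} (hz : z ∈ range (𝓡∂ 2)) (hΓ : DifferentiableWithinAt ℝ Γ (range (𝓡∂ 2)) z)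
    (hg : ContDiffWithinAt ℝ 2 g (range (𝓡∂ 2)) z)
    (hX : DifferentiableWithinAt ℝ X (range (𝓡∂ 2)) z)
    (hY : DifferentiableWithinAt ℝ Y (range (𝓡∂ 2)) z) :
    covariantForm Γ (covariantForm Γ g Y) X z - covariantForm Γ (covariantForm Γ g X) Y z
      - covariantForm Γ g (VectorField.lieBracketWithin ℝ X Y (range (𝓡∂ 2))) z
      = curvatureForm Γ z (X z) (Y z) (g z) := by
  have hsymm : IsSymmSndFDerivWithinAt ℝ g (range (𝓡∂ 2)) z :=
    hg.isSymmSndFDerivWithinAt (by simp) uniqueDiffOn_halfPlane (closure_interior_halfPlane hz) hz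
  have e1 := (hasFDerivWithinAt_covariantForm hz hΓ hg hY).2 (X z)
  have e2 := (hasFDerivWithinAt_covariantForm hz hΓ hg hX).2 (Y z)
  have e3 := hsymm.eq (X z) (Y z)
  have c : ∀ g' Y', covariantForm Γ g' Y' z
      = fderivWithin ℝ g' (range (𝓡∂ 2)) z (Y' z) + Γ z (g' z) (Y' z) := fun _ _ ↦ rfl
  rw [c _ X, c (covariantForm Γ g X) Y, c _ (VectorField.lieBracketWithin ℝ X Y (range (𝓡∂ 2))), e1, e2, e3]
  simp only [curvatureForm, VectorField.lieBracketWithin, c, map_sub, map_add, add_apply,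
    sub_apply, ContinuousLinearMap.flip_apply, ContinuousLinearMap.comp_apply]
  abel

variable {M : Type*} [TopologicalSpace M] [ChartedSpace (EuclideanHalfSpace 2) M]
  [IsManifold (𝓡∂ 2) ∞ M]

/-- Naturality of the Lie bracket under pullback by the inverse chart. -/
theorem chartCoords_mlieBracket {X Y : ∀ y : M, TangentSpace (𝓡∂ 2) y} {p : M} {z : ℝ²}
    (hz : z ∈ (extChartAt (𝓡∂ 2) p).target)
    (hX : DiffAt ℝ² X ((extChartAt (𝓡∂ 2) p).symm z))
    (hY : DiffAt ℝ² Y ((extChartAt (𝓡∂ 2) p).symm z)) :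
    chartCoords p ((extChartAt (𝓡∂ 2) p).symm z)
        (VectorField.mlieBracket (𝓡∂ 2) X Y ((extChartAt (𝓡∂ 2) p).symm z))
      = VectorField.lieBracketWithin ℝ
        (fun z ↦ chartCoords p ((extChartAt (𝓡∂ 2) p).symm z) (X ((extChartAt (𝓡∂ 2) p).symm z)))
        (fun z ↦ chartCoords p ((extChartAt (𝓡∂ 2) p).symm z) (Y ((extChartAt (𝓡∂ 2) p).symm z)))
        (range (𝓡∂ 2)) z := by
  have : IsManifold (𝓡∂ 2) (minSmoothness ℝ 3) M :=
    .of_le (n := ∞) (by rw [minSmoothness_of_isRCLikeNormedField]; exact ENat.LEInfty.out)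
  have hzr := extChartAt_target_subset_range p hz
  have hpb : ∀ (V : ∀ y : M, TangentSpace (𝓡∂ 2) y), ∀ z' ∈ (extChartAt (𝓡∂ 2) p).target,
      VectorField.mpullbackWithin 𝓘(ℝ, ℝ²) (𝓡∂ 2) (extChartAt (𝓡∂ 2) p).symm V (range (𝓡∂ 2)) z'
        = chartCoords p ((extChartAt (𝓡∂ 2) p).symm z') (V ((extChartAt (𝓡∂ 2) p).symm z')) := by
    intro V z' hz'
    have hx := symm_mem_source hz'
    refine DFunLike.congr_fun (ContinuousLinearMap.inverse_eq (f := mfderivWithin 𝓘(ℝ, ℝ²) (𝓡∂ 2)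
      (extChartAt (𝓡∂ 2) p).symm (range (𝓡∂ 2)) z') ?_ ?_) _
    · ext1 v
      exact (mfderivWithin_symm_eq hz' _).trans (coordField_chartCoords hx v)
    · ext1 w
      exact (congrArg (chartCoords p _) (mfderivWithin_symm_eq hz' w)).trans
        (chartCoords_coordField hx w)
  have h := VectorField.mpullbackWithin_mlieBracketWithin (I := 𝓘(ℝ, ℝ²)) (I' := 𝓡∂ 2)
    (f := (extChartAt (𝓡∂ 2) p).symm) (V := X) (W := Y) (s := range (𝓡∂ 2)) (t := univ) (n := ∞)
    (x₀ := z) hX.mdifferentiableWithinAt hY.mdifferentiableWithinAt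
    uniqueDiffOn_halfPlane.uniqueMDiffOn
    ((contMDiffOn_symm p z hz).mono_of_mem_nhdsWithin (target_mem_nhdsWithin hz)) hzr
    (by rw [minSmoothness_of_isRCLikeNormedField]; exact ENat.LEInfty.out)
    (by simp) (closure_interior_halfPlane hzr)
  rw [hpb _ z hz, VectorField.mlieBracketWithin_univ,
    VectorField.mlieBracketWithin_eq_lieBracketWithin] at h
  rw [h]
  refine Filter.EventuallyEq.lieBracketWithin_vectorField_eq ?_ (hpb X z hz) ?_ (hpb Y z hz)
  · filter_upwards [target_mem_nhdsWithin hz] with z' hz' using hpb X z' hz'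
  · filter_upwards [target_mem_nhdsWithin hz] with z' hz' using hpb Y z' hz'

end Curvature

/-! ### Traces of curvature forms -/

section TraceForm

variable {F : Type*} [NormedAddCommGroup F] [NormedSpace ℝ F] [FiniteDimensional ℝ F]

variable (F) in
/-- The trace as a continuous functional. -/
def traceCLM : (F →L[ℝ] F) →L[ℝ] ℝ :=
  LinearMap.toContinuousLinearMap (LinearMap.trace ℝ F ∘ₗ ContinuousLinearMap.coeLM ℝ)

theorem traceCLM_apply (A : F →L[ℝ] F) : traceCLM F A = LinearMap.trace ℝ F A := rfl

theorem traceCLM_mul_comm (A B : F →L[ℝ] F) : traceCLM F (A * B) = traceCLM F (B * A) :=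
  LinearMap.trace_mul_comm ℝ (A : F →ₗ[ℝ] F) B

/-- The pointwise algebra of the transgression. With `α = a' - a` and `β = b' - b`, cyclicity of the
trace turns `tr (k [a, β])` into `tr ([k, a] β)`, and likewise for `[α, b]`. The quadratic term `tr
(k [α, β])` vanishes because `k` commutes with `β`. -/
theorem trace_curvature_identity {k a b a' b' p q p' q' : F →L[ℝ] F}
    (ha : k * (a' - a) = (a' - a) * k) (hb : k * (b' - b) = (b' - b) * k) :
    traceCLM F (k * (p' - q' + (a' * b' - b' * a'))) - traceCLM F (k * (p - q + (a * b - b * a)))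
      = traceCLM F ((k * a - a * k) * (b' - b) + k * (p' - p))
        - traceCLM F ((k * b - b * k) * (a' - a) + k * (q' - q)) := by
  obtain ⟨α, rfl⟩ : ∃ α, a' = a + α := ⟨a' - a, by abel⟩
  obtain ⟨β, rfl⟩ : ∃ β, b' = b + β := ⟨b' - b, by abel⟩
  rw [add_sub_cancel_left] at ha hb ⊢
  rw [add_sub_cancel_left]
  have c1 : traceCLM F (k * (β * a)) = traceCLM F (a * (k * β)) := by
    rw [← mul_assoc, traceCLM_mul_comm]
  have c2 : traceCLM F (k * (α * b)) = traceCLM F (b * (k * α)) := by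
    rw [← mul_assoc, traceCLM_mul_comm]
  have c3 : traceCLM F (k * (β * α)) = traceCLM F (k * (α * β)) := by
    rw [← mul_assoc, hb, mul_assoc, traceCLM_mul_comm, mul_assoc]
  simp only [mul_add, add_mul, mul_sub, sub_mul, map_add, map_sub, mul_assoc, c1, c2, c3]
  ring

theorem sub_mul_comm_of_eq {R : Type*} [Ring R] {k a a' : R} (h : k * a - a * k = k * a' - a' * k) :
    k * (a' - a) = (a' - a) * k := by
  rw [mul_sub, sub_mul, sub_eq_sub_iff_sub_eq_sub, h]

theorem hasFDerivWithinAt_postcomp {V X W Y : Type*} [NormedAddCommGroup V] [NormedSpace ℝ V]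
    [NormedAddCommGroup X] [NormedSpace ℝ X] [NormedAddCommGroup W] [NormedSpace ℝ W]
    [NormedAddCommGroup Y] [NormedSpace ℝ Y] (P : X →L[ℝ] Y) {Γ : V → W →L[ℝ] X}
    {Γ' : V →L[ℝ] W →L[ℝ] X} {S : Set V} {z : V} (h : HasFDerivWithinAt Γ Γ' S z) :
    HasFDerivWithinAt (fun z ↦ P ∘L Γ z) (ContinuousLinearMap.compL ℝ W X Y P ∘L Γ') S z :=
  (ContinuousLinearMap.compL ℝ W X Y P).hasFDerivAt.comp_hasFDerivWithinAt z h

theorem hasFDerivWithinAt_flip {V G W X : Type*} [NormedAddCommGroup V] [NormedSpace ℝ V]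
    [NormedAddCommGroup G] [NormedSpace ℝ G] [NormedAddCommGroup W] [NormedSpace ℝ W]
    [NormedAddCommGroup X] [NormedSpace ℝ X] {Γ : V → W →L[ℝ] G →L[ℝ] X}
    {Γ' : V →L[ℝ] W →L[ℝ] G →L[ℝ] X} {S : Set V} {z : V} (h : HasFDerivWithinAt Γ Γ' S z) (v : G) :
    HasFDerivWithinAt (fun z ↦ (Γ z).flip v)
      (ContinuousLinearMap.compL ℝ W (G →L[ℝ] X) X (ContinuousLinearMap.apply ℝ X v) ∘L Γ') S z :=
  hasFDerivWithinAt_postcomp (ContinuousLinearMap.apply ℝ X v) h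

/-- The hypotheses `h` and `h'` say that `K` is parallel for both connections: `dK = [K, Γ]`. They
give the derivative of `K` in the product rule, and together they show that `K` commutes with `Γ' -
Γ`. -/
theorem trace_curvatureForm_sub {Γ Γ' : ℝ² → F →L[ℝ] ℝ² →L[ℝ] F} {K : ℝ² → F →L[ℝ] F} {z : ℝ²}
    (hz : z ∈ range (𝓡∂ 2)) (hΓ : DifferentiableWithinAt ℝ Γ (range (𝓡∂ 2)) z)
    (hΓ' : DifferentiableWithinAt ℝ Γ' (range (𝓡∂ 2)) z)
    (hK : DifferentiableWithinAt ℝ K (range (𝓡∂ 2)) z)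
    (h : ∀ w, fderivWithin ℝ K (range (𝓡∂ 2)) z w = K z * (Γ z).flip w - (Γ z).flip w * K z)
    (h' : ∀ w, fderivWithin ℝ K (range (𝓡∂ 2)) z w = K z * (Γ' z).flip w - (Γ' z).flip w * K z)
    (u v : ℝ²) :
    traceCLM F (K z * curvatureForm Γ' z u v) - traceCLM F (K z * curvatureForm Γ z u v)
      = fderivWithin ℝ (fun z ↦ traceCLM F (K z * (Γ' z - Γ z).flip v)) (range (𝓡∂ 2)) z u
        - fderivWithin ℝ (fun z ↦ traceCLM F (K z * (Γ' z - Γ z).flip u)) (range (𝓡∂ 2)) z v := by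
  have hd : ∀ v w, fderivWithin ℝ (fun z ↦ traceCLM F (K z * (Γ' z - Γ z).flip v))
      (range (𝓡∂ 2)) z w = traceCLM F ((K z * (Γ z).flip w - (Γ z).flip w * K z)
        * ((Γ' z).flip v - (Γ z).flip v)
        + K z * ((fderivWithin ℝ Γ' (range (𝓡∂ 2)) z w).flip v
          - (fderivWithin ℝ Γ (range (𝓡∂ 2)) z w).flip v)) := by
    intro v w
    have h1 := (hasFDerivWithinAt_flip hΓ'.hasFDerivWithinAt v).sub
      (hasFDerivWithinAt_flip hΓ.hasFDerivWithinAt v)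
    have h2 := (traceCLM F).hasFDerivAt.comp_hasFDerivWithinAt z (hK.hasFDerivWithinAt.mul' h1)
    have h3 : HasFDerivWithinAt (fun z ↦ traceCLM F (K z * (Γ' z - Γ z).flip v)) _
      (range (𝓡∂ 2)) z := h2
    rw [h3.fderivWithin (uniqueDiffOn_halfPlane z hz), ← h w]
    exact congrArg (traceCLM F) (add_comm _ _)
  rw [hd, hd, curvatureForm, curvatureForm]
  refine trace_curvature_identity ?_ ?_
  · exact sub_mul_comm_of_eq ((h u).symm.trans (h' u))
  · exact sub_mul_comm_of_eq ((h v).symm.trans (h' v))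

end TraceForm

/-! ### The curvature of a connection -/

section ConnectionCurvature

variable {M : Type*} [TopologicalSpace M] [T2Space M] [ChartedSpace (EuclideanHalfSpace 2) M]
  [IsManifold (𝓡∂ 2) ∞ M]
  {F : Type*} [NormedAddCommGroup F] [NormedSpace ℝ F] [FiniteDimensional ℝ F]
  {E : M → Type*} [TopologicalSpace (TotalSpace F E)] [∀ x, AddCommGroup (E x)]
  [∀ x, Module ℝ (E x)] [∀ x, TopologicalSpace (E x)] [∀ x, IsTopologicalAddGroup (E x)]
  [∀ x, ContinuousSMul ℝ (E x)] [FiberBundle F E] [VectorBundle ℝ F E]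
  [ContMDiffVectorBundle ∞ F E (𝓡∂ 2)]
  {e : Trivialization F (π F E)} [MemTrivializationAtlas e]
  {D D' : CovariantDerivative (𝓡∂ 2) F E}

theorem tendsto_symm {p : M} {z : ℝ²} (hz : z ∈ (extChartAt (𝓡∂ 2) p).target) :
    Filter.Tendsto (extChartAt (𝓡∂ 2) p).symm (𝓝[range (𝓡∂ 2)] z)
      (𝓝 ((extChartAt (𝓡∂ 2) p).symm z)) :=
  ((contMDiffOn_symm p).continuousOn z hz).tendsto.mono_left
    (nhdsWithin_le_of_mem (target_mem_nhdsWithin hz))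

theorem triv_cov_field {p : M} {z : ℝ²}
    (hz : z ∈ (extChartAt (𝓡∂ 2) p).target) (hb : (extChartAt (𝓡∂ 2) p).symm z ∈ e.baseSet)
    {s : ∀ y, E y} (hs : DiffAt F s ((extChartAt (𝓡∂ 2) p).symm z))
    (X : ∀ y : M, TangentSpace (𝓡∂ 2) y) :
    triv e (fun y ↦ D s y (X y)) ((extChartAt (𝓡∂ 2) p).symm z)
      = covariantForm (connectionForm e D p) (fun z ↦ triv e s ((extChartAt (𝓡∂ 2) p).symm z))
        (fun z ↦ chartCoords p ((extChartAt (𝓡∂ 2) p).symm z) (X ((extChartAt (𝓡∂ 2) p).symm z)))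
        z := by
  have := triv_cov (D := D) hz hb hs (chartCoords p _ (X ((extChartAt (𝓡∂ 2) p).symm z)))
  rwa [coordField_chartCoords (symm_mem_source hz)] at this

theorem covariantForm_congr {Γ : ℝ² → F →L[ℝ] ℝ² →L[ℝ] F} {g g' : ℝ² → F} (Y : ℝ² → ℝ²) {z : ℝ²}
    (hz : z ∈ range (𝓡∂ 2)) (h : g =ᶠ[𝓝[range (𝓡∂ 2)] z] g') :
    covariantForm Γ g Y z = covariantForm Γ g' Y z := by
  have h0 := h.eq_of_nhdsWithin hz
  rw [covariantForm, covariantForm, h.fderivWithin_eq h0, h0]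

theorem differentiableWithinAt_chartCoords {X : ∀ y : M, TangentSpace (𝓡∂ 2) y} {p : M} {z : ℝ²}
    (hz : z ∈ (extChartAt (𝓡∂ 2) p).target) (hX : SmoothAt ℝ² X ((extChartAt (𝓡∂ 2) p).symm z)) :
    DifferentiableWithinAt ℝ (fun z ↦ chartCoords p ((extChartAt (𝓡∂ 2) p).symm z)
      (X ((extChartAt (𝓡∂ 2) p).symm z))) (range (𝓡∂ 2)) z := by
  have h := (triv_smooth (e := trivializationAt ℝ² (TangentSpace (𝓡∂ 2)) p) hz
    (by simpa using symm_mem_source hz) hX).differentiableWithinAt (by simp)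
  refine h.congr_of_eventuallyEq_of_mem ?_ (extChartAt_target_subset_range p hz)
  filter_upwards [target_mem_nhdsWithin hz] with z' hz'
  rw [chartCoords_eq (symm_mem_source hz')]
  rfl

/-- The curvature in a trivialization and a chart. -/
theorem triv_curvatureAux (hD : CovariantDerivative.ContMDiffCovariantDerivative D ∞) {p : M}
    {z : ℝ²} (hz : z ∈ (extChartAt (𝓡∂ 2) p).target)
    (hb : (extChartAt (𝓡∂ 2) p).symm z ∈ e.baseSet) {s : ∀ y, E y}
    {X Y : ∀ y : M, TangentSpace (𝓡∂ 2) y} (hs : SmoothNear F s ((extChartAt (𝓡∂ 2) p).symm z))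
    (hX : SmoothNear ℝ² X ((extChartAt (𝓡∂ 2) p).symm z))
    (hY : SmoothNear ℝ² Y ((extChartAt (𝓡∂ 2) p).symm z)) :
    e.continuousLinearMapAt ℝ _ (curvatureAux D X Y s ((extChartAt (𝓡∂ 2) p).symm z))
      = curvatureForm (connectionForm e D p) z (chartCoords p _ (X ((extChartAt (𝓡∂ 2) p).symm z)))
        (chartCoords p _ (Y ((extChartAt (𝓡∂ 2) p).symm z)))
        (triv e s ((extChartAt (𝓡∂ 2) p).symm z)) := by
  have hzr := extChartAt_target_subset_range p hz
  have key : ∀ X Y : ∀ y : M, TangentSpace (𝓡∂ 2) y,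
      SmoothNear ℝ² Y ((extChartAt (𝓡∂ 2) p).symm z) →
      triv e (fun y ↦ D (fun y ↦ D s y (Y y)) y (X y)) ((extChartAt (𝓡∂ 2) p).symm z)
      = covariantForm (connectionForm e D p) (covariantForm (connectionForm e D p)
          (fun z ↦ triv e s ((extChartAt (𝓡∂ 2) p).symm z))
          (fun z ↦ chartCoords p ((extChartAt (𝓡∂ 2) p).symm z) (Y ((extChartAt (𝓡∂ 2) p).symm z))))
        (fun z ↦ chartCoords p ((extChartAt (𝓡∂ 2) p).symm z) (X ((extChartAt (𝓡∂ 2) p).symm z)))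
        z := by
    intro X Y hY
    rw [triv_cov_field hz hb ((smoothAt_cov hD hs).apply hY.smoothAt).diffAt]
    refine covariantForm_congr _ hzr ?_
    filter_upwards [(tendsto_symm hz).eventually hs, target_mem_nhdsWithin hz,
      (tendsto_symm hz).eventually (e.open_baseSet.mem_nhds hb)] with z' hs' hz' hb'
    exact triv_cov_field hz' hb' hs'.diffAt Y
  have h := curvatureForm_apply hzr
    ((contDiffWithinAt_connectionForm hD hz hb).differentiableWithinAt (by simp))
    ((triv_smooth hz hb hs.smoothAt).of_le ENat.LEInfty.out)
    (differentiableWithinAt_chartCoords hz hX.smoothAt)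
    (differentiableWithinAt_chartCoords hz hY.smoothAt)
  rw [← h, ← key X Y hY, ← key Y X hX, curvatureAux, map_sub, map_sub]
  congr 1
  refine (triv_cov_field hz hb hs.diffAt (VectorField.mlieBracket (𝓡∂ 2) X Y)).trans ?_
  rw [covariantForm, covariantForm, chartCoords_mlieBracket hz hX.diffAt hY.diffAt]

theorem smoothNear_extend {x : M} (u : TangentSpace (𝓡∂ 2) x) :
    SmoothNear ℝ² (FiberBundle.extend ℝ² u) x := by
  obtain ⟨U, hU, hs⟩ := FiberBundle.exists_contMDiffOn_extend (𝓡∂ 2) ℝ² u (k := ∞)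
  exact .of_contMDiffOn hU hs

theorem smoothNear_localExtension {x : M} (f : E x) : SmoothNear F (localExtension F f) x := by
  obtain ⟨U, hU, hs⟩ := contMDiffOn_localExtension (F := F) f
  exact .of_contMDiffOn hU hs

theorem localExtension_self {x : M} (f : E x) : localExtension F f x = f :=
  (trivializationAt F E x).symmL_continuousLinearMapAt
    (FiberBundle.mem_baseSet_trivializationAt F E x) f

theorem triv_curvature (hD : CovariantDerivative.ContMDiffCovariantDerivative D ∞) {p : M}
    {z : ℝ²} (hz : z ∈ (extChartAt (𝓡∂ 2) p).target)
    (hb : (extChartAt (𝓡∂ 2) p).symm z ∈ e.baseSet)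
    (u v : TangentSpace (𝓡∂ 2) ((extChartAt (𝓡∂ 2) p).symm z))
    (f : E ((extChartAt (𝓡∂ 2) p).symm z)) :
    e.continuousLinearMapAt ℝ _ (curvature D hD _ u v f)
      = curvatureForm (connectionForm e D p) z (chartCoords p _ u) (chartCoords p _ v)
        (e.continuousLinearMapAt ℝ _ f) := by
  have h := triv_curvatureAux hD hz hb (smoothNear_localExtension f) (smoothNear_extend u)
    (smoothNear_extend v)
  rw [FiberBundle.extend_apply_self, FiberBundle.extend_apply_self, triv, localExtension_self] at h
  exact h

/-- The curvature is a tensor: it can be computed with arbitrary local extensions. -/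
theorem curvatureAux_eq_curvature (hD : CovariantDerivative.ContMDiffCovariantDerivative D ∞)
    {x : M} {s : ∀ y, E y} {X Y : ∀ y : M, TangentSpace (𝓡∂ 2) y} (hs : SmoothNear F s x)
    (hX : SmoothNear ℝ² X x) (hY : SmoothNear ℝ² Y x) :
    curvatureAux D X Y s x = curvature D hD x (X x) (Y x) (s x) := by
  obtain ⟨p, hp⟩ : ∃ p, x ∈ (chartAt (EuclideanHalfSpace 2) p).source := ⟨x, mem_chart_source _ x⟩
  obtain ⟨z, hz, rfl⟩ := exists_coord hp
  obtain ⟨y, hb⟩ : ∃ y, (extChartAt (𝓡∂ 2) p).symm z ∈ (trivializationAt F E y).baseSet :=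
    ⟨_, FiberBundle.mem_baseSet_trivializationAt F E _⟩
  -- In coordinates both sides are `curvatureForm` evaluated at the same values of `X`, `Y` and `s`
  -- at the point.
  have h1 := triv_curvatureAux hD hz hb hs hX hY
  have h2 := triv_curvature hD hz hb (X _) (Y _) (s ((extChartAt (𝓡∂ 2) p).symm z))
  have h3 := congrArg ((trivializationAt F E y).symmL ℝ ((extChartAt (𝓡∂ 2) p).symm z)) (h1.trans h2.symm)
  rwa [Trivialization.symmL_continuousLinearMapAt _ hb,
    Trivialization.symmL_continuousLinearMapAt _ hb] at h3

end ConnectionCurvature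

/-! ### Transgression -/

section Transgression

variable {M : Type*} [TopologicalSpace M] [T2Space M] [ChartedSpace (EuclideanHalfSpace 2) M]
  [IsManifold (𝓡∂ 2) ∞ M]
  {F : Type*} [NormedAddCommGroup F] [NormedSpace ℝ F] [FiniteDimensional ℝ F]
  {E : M → Type*} [TopologicalSpace (TotalSpace F E)] [∀ x, AddCommGroup (E x)]
  [∀ x, Module ℝ (E x)] [∀ x, TopologicalSpace (E x)] [∀ x, IsTopologicalAddGroup (E x)]
  [∀ x, ContinuousSMul ℝ (E x)] [FiberBundle F E] [VectorBundle ℝ F E]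
  [ContMDiffVectorBundle ∞ F E (𝓡∂ 2)]
  {e : Trivialization F (π F E)} [MemTrivializationAtlas e]
  {D D' : CovariantDerivative (𝓡∂ 2) F E}

theorem trace_eq_of_triv {x : M} (hx : x ∈ e.baseSet) (A : E x →ₗ[ℝ] E x) (B : F →L[ℝ] F)
    (h : ∀ f, e.continuousLinearMapAt ℝ x (A f) = B (e.continuousLinearMapAt ℝ x f)) :
    LinearMap.trace ℝ (E x) A = traceCLM F B := by
  let φ := (e.continuousLinearEquivAt ℝ x hx).toLinearEquiv
  have hφ : ∀ f, φ f = e.continuousLinearMapAt ℝ x f := fun f ↦ by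
    rw [Trivialization.continuousLinearMapAt_apply, e.coe_linearMapAt_of_mem hx]
    rfl
  have : φ.conj A = B := by
    ext f
    obtain ⟨f, rfl⟩ := φ.surjective f
    rw [LinearEquiv.conj_apply_apply, LinearEquiv.symm_apply_apply, hφ, hφ, h]
    rfl
  rw [traceCLM_apply, ← this, LinearMap.trace_conj']

/-- The definition uses a fixed basis of `F`; this is the basis-free formula, obtained from
`triv_cov` because a constant section has zero derivative in the trivialization. -/
theorem connectionForm_apply {p : M} {z : ℝ²}
    (hz : z ∈ (extChartAt (𝓡∂ 2) p).target) (hb : (extChartAt (𝓡∂ 2) p).symm z ∈ e.baseSet)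
    (f : F) (w : ℝ²) :
    connectionForm e D p z f w = e.continuousLinearMapAt ℝ _
      (D (constSection e f) ((extChartAt (𝓡∂ 2) p).symm z) (coordField p _ w)) := by
  have h : (fun z ↦ triv e (constSection e f) ((extChartAt (𝓡∂ 2) p).symm z))
      =ᶠ[𝓝[range (𝓡∂ 2)] z] fun _ ↦ f := by
    filter_upwards [(tendsto_symm hz).eventually (e.open_baseSet.mem_nhds hb)] with z' hz'
    exact triv_constSection hz' f
  rw [triv_cov hz hb (smoothAt_constSection hb f).diffAt,
    h.fderivWithin_eq (triv_constSection hb f), triv_constSection hb]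
  simp

variable (e) in
/-- The expression of the endomorphism `K` in a trivialization. -/
def trivEndo (K : ∀ y, E y →L[ℝ] E y) (y : M) : F →L[ℝ] F :=
  e.continuousLinearMapAt ℝ y ∘L K y ∘L e.symmL ℝ y

theorem trivEndo_triv {x : M} (hx : x ∈ e.baseSet) (K : ∀ y, E y →L[ℝ] E y) (f : E x) :
    trivEndo e K x (e.continuousLinearMapAt ℝ x f) = e.continuousLinearMapAt ℝ x (K x f) := by
  simp only [trivEndo, ContinuousLinearMap.comp_apply]
  rw [e.symmL_continuousLinearMapAt hx]

theorem contDiffWithinAt_trivEndo {K : ∀ y, E y →L[ℝ] E y} {p : M} {z : ℝ²}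
    (hz : z ∈ (extChartAt (𝓡∂ 2) p).target) (hb : (extChartAt (𝓡∂ 2) p).symm z ∈ e.baseSet)
    (hK : SmoothAt (F →L[ℝ] F) K ((extChartAt (𝓡∂ 2) p).symm z)) :
    ContDiffWithinAt ℝ ∞ (fun z ↦ trivEndo e K ((extChartAt (𝓡∂ 2) p).symm z))
      (range (𝓡∂ 2)) z :=
  contDiffWithinAt_clm_of_apply fun f ↦ triv_smooth hz hb (hK.apply (smoothAt_constSection hb f))

/-- The endomorphism field `K` is parallel. -/
def IsParallel (D : CovariantDerivative (𝓡∂ 2) F E) (K : ∀ y, E y →L[ℝ] E y) : Prop :=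
  ∀ (s : ∀ y, E y) (x : M), DiffAt F s x → ∀ v, D (fun y ↦ K y (s y)) x v = K x (D s x v)

/-- Apply the parallelism of `K` to a constant section: the two descriptions of `D (K s)` differ by
the derivative of `K` and the commutator with `Γ`. -/
theorem fderivWithin_trivEndo {K : ∀ y, E y →L[ℝ] E y} (hK : IsParallel D K) {p : M} {z : ℝ²}
    (hz : z ∈ (extChartAt (𝓡∂ 2) p).target) (hb : (extChartAt (𝓡∂ 2) p).symm z ∈ e.baseSet)
    (hKs : SmoothAt (F →L[ℝ] F) K ((extChartAt (𝓡∂ 2) p).symm z)) (w : ℝ²) :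
    fderivWithin ℝ (fun z ↦ trivEndo e K ((extChartAt (𝓡∂ 2) p).symm z)) (range (𝓡∂ 2)) z w
      = trivEndo e K ((extChartAt (𝓡∂ 2) p).symm z) * (connectionForm e D p z).flip w
        - (connectionForm e D p z).flip w * trivEndo e K ((extChartAt (𝓡∂ 2) p).symm z) := by
  ext f
  have hf := smoothAt_constSection hb f
  have h1 := triv_cov (D := D) hz hb (hKs.apply hf).diffAt w
  rw [hK _ _ hf.diffAt, ← trivEndo_triv hb, ← connectionForm_apply hz hb] at h1
  have h2 := ((contDiffWithinAt_trivEndo hz hb hKs).differentiableWithinAt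
    (by simp)).hasFDerivWithinAt.clm_apply (hasFDerivWithinAt_const f z _)
  have h3 := h2.fderivWithin (uniqueDiffOn_halfPlane z (extChartAt_target_subset_range p hz))
  have h4 : fderivWithin ℝ (fun z ↦ triv e (fun y ↦ K y (constSection e f y))
      ((extChartAt (𝓡∂ 2) p).symm z)) (range (𝓡∂ 2)) z w = _ := DFunLike.congr_fun h3 w
  rw [h4] at h1
  simp only [add_apply, sub_apply, ContinuousLinearMap.comp_apply, zero_apply, map_zero, zero_add,
    ContinuousLinearMap.flip_apply, mul_apply_eq_comp] at h1 ⊢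
  rw [h1]
  exact (add_sub_cancel_right _ _).symm

/-- The difference of two connections. -/
def connectionDifference (D D' : CovariantDerivative (𝓡∂ 2) F E) (x : M) :
    E x →L[ℝ] TangentSpace (𝓡∂ 2) x →L[ℝ] E x :=
  have : ContMDiffVectorBundle 1 F E (𝓡∂ 2) := .of_le (n := ∞) (by simp)
  have : IsManifold (𝓡∂ 2) 1 M := isManifold_one
  D'.difference D x

theorem connectionDifference_apply {s : ∀ y, E y} {x : M} (hs : DiffAt F s x) :
    connectionDifference D D' x (s x) = D' s x - D s x := by
  have : ContMDiffVectorBundle 1 F E (𝓡∂ 2) := .of_le (n := ∞) (by simp)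
  have : IsManifold (𝓡∂ 2) 1 M := isManifold_one
  exact IsCovariantDerivativeOn.difference_apply D'.isCovariantDerivativeOnUniv
    D.isCovariantDerivativeOnUniv trivial hs

/-- The difference of two connections in the direction `v`. -/
def differenceEndo (D D' : CovariantDerivative (𝓡∂ 2) F E) (x : M) (v : TangentSpace (𝓡∂ 2) x) :
    E x →ₗ[ℝ] E x where
  toFun f := connectionDifference D D' x f v
  map_add' f g := by simp
  map_smul' c f := by simp

theorem differenceEndo_apply {s : ∀ y, E y} {x : M} (hs : DiffAt F s x)
    (v : TangentSpace (𝓡∂ 2) x) : differenceEndo D D' x v (s x) = D' s x v - D s x v :=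
  DFunLike.congr_fun (connectionDifference_apply hs) v

/-- The one-form `tr (K (D' - D))`. -/
def traceForm (K : ∀ y, E y →L[ℝ] E y) (D D' : CovariantDerivative (𝓡∂ 2) F E) (x : M) :
    TangentSpace (𝓡∂ 2) x →L[ℝ] ℂ :=
  Complex.ofRealCLM ∘L (LinearMap.toContinuousLinearMap
    { toFun := fun w : ℝ² ↦ LinearMap.trace ℝ (E x)
        ((K x : E x →ₗ[ℝ] E x) ∘ₗ differenceEndo D D' x (coordField x x w))
      map_add' := fun w w' ↦ by
        rw [← map_add]
        congr 1
        ext f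
        simp [differenceEndo]
      map_smul' := fun c w ↦ by
        rw [RingHom.id_apply, ← map_smul]
        congr 1
        ext f
        simp [differenceEndo] }) ∘L chartCoords x x

theorem traceForm_apply (K : ∀ y, E y →L[ℝ] E y) (x : M) (v : TangentSpace (𝓡∂ 2) x) :
    traceForm K D D' x v = (LinearMap.trace ℝ (E x)
        ((K x : E x →ₗ[ℝ] E x) ∘ₗ differenceEndo D D' x v) : ℂ) := by
  conv_rhs => rw [← coordField_chartCoords (mem_chart_source (EuclideanHalfSpace 2) x) v]
  rfl

theorem traceForm_coordField {K : ∀ y, E y →L[ℝ] E y} {p : M} {z : ℝ²}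
    (hz : z ∈ (extChartAt (𝓡∂ 2) p).target) (hb : (extChartAt (𝓡∂ 2) p).symm z ∈ e.baseSet)
    (w : ℝ²) :
    traceForm K D D' ((extChartAt (𝓡∂ 2) p).symm z) (coordField p _ w)
      = (traceCLM F (trivEndo e K ((extChartAt (𝓡∂ 2) p).symm z)
          * (connectionForm e D' p z - connectionForm e D p z).flip w) : ℂ) := by
  rw [traceForm_apply]
  congr 1
  refine trace_eq_of_triv hb _ _ fun f ↦ ?_
  rw [LinearMap.comp_apply]
  change e.continuousLinearMapAt ℝ _ (K _ (differenceEndo D D' _ _ f)) = _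
  rw [← trivEndo_triv hb, mul_apply_eq_comp]
  congr 1
  have h := differenceEndo_apply (D := D) (D' := D') (smoothAt_constSection hb
    (e.continuousLinearMapAt ℝ _ f)).diffAt (coordField p _ w)
  rw [constSection, e.symmL_continuousLinearMapAt hb] at h
  rw [h, map_sub, ← connectionForm_apply hz hb, ← connectionForm_apply hz hb]
  rfl

theorem trace_comp_curvature {K : ∀ y, E y →L[ℝ] E y}
    (hD : CovariantDerivative.ContMDiffCovariantDerivative D ∞) {p : M} {z : ℝ²}
    (hz : z ∈ (extChartAt (𝓡∂ 2) p).target) (hb : (extChartAt (𝓡∂ 2) p).symm z ∈ e.baseSet)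
    (u v : ℝ²) :
    LinearMap.trace ℝ _ ((K ((extChartAt (𝓡∂ 2) p).symm z) :
        E ((extChartAt (𝓡∂ 2) p).symm z) →ₗ[ℝ] E ((extChartAt (𝓡∂ 2) p).symm z))
        ∘ₗ curvature D hD _ (coordField p _ u) (coordField p _ v))
      = traceCLM F (trivEndo e K ((extChartAt (𝓡∂ 2) p).symm z)
        * curvatureForm (connectionForm e D p) z u v) := by
  refine trace_eq_of_triv hb _ _ fun f ↦ ?_
  rw [LinearMap.comp_apply]
  change e.continuousLinearMapAt ℝ _ (K _ (curvature D hD _ _ _ f)) = _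
  rw [← trivEndo_triv hb, mul_apply_eq_comp, triv_curvature hD hz hb,
    chartCoords_coordField (symm_mem_source hz), chartCoords_coordField (symm_mem_source hz)]

/-- The difference of the curvature traces of two connections is the exterior derivative of the
trace of their difference. -/
theorem isExteriorDerivative_traceForm {K : ∀ y, E y →L[ℝ] E y}
    (hD : CovariantDerivative.ContMDiffCovariantDerivative D ∞)
    (hD' : CovariantDerivative.ContMDiffCovariantDerivative D' ∞)
    (hK : ∀ x, SmoothAt (F →L[ℝ] F) K x) (h : IsParallel D K) (h' : IsParallel D' K) :
    IsExteriorDerivative (traceForm K D D') (fun x u v ↦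
      ((LinearMap.trace ℝ (E x) ((K x : E x →ₗ[ℝ] E x) ∘ₗ curvature D' hD' x u v)
        - LinearMap.trace ℝ (E x) ((K x : E x →ₗ[ℝ] E x) ∘ₗ curvature D hD x u v) : ℝ) : ℂ)) := by
  -- There need not be one trivialization over the chart domain. Regularity and the derivative are
  -- local, so at each point the trivialization centred at that point is used.
  have hev : ∀ (p : M), ∀ z ∈ (extChartAt (𝓡∂ 2) p).target, ∀ w,
      (fun z ↦ traceForm K D D' ((extChartAt (𝓡∂ 2) p).symm z) (coordField p _ w))
      =ᶠ[𝓝[range (𝓡∂ 2)] z] fun z' ↦ Complex.ofRealCLM (traceCLM F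
        (trivEndo (trivializationAt F E ((extChartAt (𝓡∂ 2) p).symm z)) K
          ((extChartAt (𝓡∂ 2) p).symm z')
          * (connectionForm (trivializationAt F E ((extChartAt (𝓡∂ 2) p).symm z)) D' p z'
          - connectionForm (trivializationAt F E ((extChartAt (𝓡∂ 2) p).symm z)) D p z').flip w)) := by
    intro p z hz w
    filter_upwards [target_mem_nhdsWithin hz, (tendsto_symm hz).eventually
      ((trivializationAt F E ((extChartAt (𝓡∂ 2) p).symm z)).open_baseSet.mem_nhds
        (FiberBundle.mem_baseSet_trivializationAt F E _))] with z' hz' hb'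
    exact traceForm_coordField hz' hb' w
  have hcd : ∀ (p : M), ∀ z ∈ (extChartAt (𝓡∂ 2) p).target, ∀ w,
      ContDiffWithinAt ℝ 1 (fun z' ↦ traceCLM F
        (trivEndo (trivializationAt F E ((extChartAt (𝓡∂ 2) p).symm z)) K
          ((extChartAt (𝓡∂ 2) p).symm z')
          * (connectionForm (trivializationAt F E ((extChartAt (𝓡∂ 2) p).symm z)) D' p z'
          - connectionForm (trivializationAt F E ((extChartAt (𝓡∂ 2) p).symm z)) D p z').flip w))
        (range (𝓡∂ 2)) z := by
    intro p z hz w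
    have hb := FiberBundle.mem_baseSet_trivializationAt F E ((extChartAt (𝓡∂ 2) p).symm z)
    have h1 : ∀ {D : CovariantDerivative (𝓡∂ 2) F E}
        (_ : CovariantDerivative.ContMDiffCovariantDerivative D ∞) (f : F),
        ContDiffWithinAt ℝ ∞ (fun z' ↦ connectionForm
          (trivializationAt F E ((extChartAt (𝓡∂ 2) p).symm z)) D p z' f w) (range (𝓡∂ 2)) z :=
      fun hD f ↦ ((contDiffWithinAt_connectionForm hD hz hb).clm_apply
        contDiffWithinAt_const).clm_apply contDiffWithinAt_const
    have h2 : ContDiffWithinAt ℝ ∞ (fun z' ↦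
        (connectionForm (trivializationAt F E ((extChartAt (𝓡∂ 2) p).symm z)) D' p z'
          - connectionForm (trivializationAt F E ((extChartAt (𝓡∂ 2) p).symm z)) D p z').flip w)
        (range (𝓡∂ 2)) z :=
      contDiffWithinAt_clm_of_apply fun f ↦ (h1 hD' f).sub (h1 hD f)
    exact ((traceCLM F).contDiff.contDiffAt.comp_contDiffWithinAt z
      ((contDiffWithinAt_trivEndo hz hb (hK _)).mul h2)).of_le (by simp)
  refine ⟨fun p w z hz ↦ ?_, fun p z hz u v ↦ ?_⟩
  · have h1 := (Complex.ofRealCLM.contDiff.contDiffAt.comp_contDiffWithinAt z (hcd p z hz w))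
    exact (h1.congr_of_eventuallyEq_of_mem (hev p z hz w)
      (extChartAt_target_subset_range p hz)).mono (extChartAt_target_subset_range p)
  · have hb := FiberBundle.mem_baseSet_trivializationAt F E ((extChartAt (𝓡∂ 2) p).symm z)
    have hzr := extChartAt_target_subset_range p hz
    have hd : ∀ w w', fderivWithin ℝ (fun z ↦ traceForm K D D' ((extChartAt (𝓡∂ 2) p).symm z)
        (coordField p _ w)) (range (𝓡∂ 2)) z w' = Complex.ofRealCLM (fderivWithin ℝ
        (fun z' ↦ traceCLM F
        (trivEndo (trivializationAt F E ((extChartAt (𝓡∂ 2) p).symm z)) K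
          ((extChartAt (𝓡∂ 2) p).symm z')
          * (connectionForm (trivializationAt F E ((extChartAt (𝓡∂ 2) p).symm z)) D' p z'
          - connectionForm (trivializationAt F E ((extChartAt (𝓡∂ 2) p).symm z)) D p z').flip w))
          (range (𝓡∂ 2)) z w') := by
      intro w w'
      rw [(hev p z hz w).fderivWithin_eq_of_mem hzr]
      exact DFunLike.congr_fun ((Complex.ofRealCLM.hasFDerivAt.comp_hasFDerivWithinAt z
        ((hcd p z hz w).differentiableWithinAt one_ne_zero).hasFDerivWithinAt).fderivWithin
        (uniqueDiffOn_halfPlane z hzr)) w'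
    rw [hd, hd, trace_comp_curvature hD hz hb, trace_comp_curvature hD' hz hb]
    refine (congrArg Complex.ofRealCLM ?_).trans (map_sub Complex.ofRealCLM _ _)
    exact trace_curvatureForm_sub (K := fun z' ↦ trivEndo _ K ((extChartAt (𝓡∂ 2) p).symm z')) hzr
      ((contDiffWithinAt_connectionForm hD hz hb).differentiableWithinAt (by simp))
      ((contDiffWithinAt_connectionForm hD' hz hb).differentiableWithinAt (by simp))
      ((contDiffWithinAt_trivEndo hz hb (hK _)).differentiableWithinAt (by simp))
      (fun w ↦ fderivWithin_trivEndo h hz hb (hK _) w)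
      (fun w ↦ fderivWithin_trivEndo h' hz hb (hK _) w) u v

theorem continuousWithinAt_fderivWithin_postcomp {V X W Y : Type*} [NormedAddCommGroup V]
    [NormedSpace ℝ V] [NormedAddCommGroup X] [NormedSpace ℝ X] [NormedAddCommGroup W]
    [NormedSpace ℝ W] [NormedAddCommGroup Y] [NormedSpace ℝ Y] (P : X →L[ℝ] Y) {Γ : V → W →L[ℝ] X}
    {S : Set V} {z : V} (h : ContDiffWithinAt ℝ ∞ Γ S z) (hS : UniqueDiffOn ℝ S) (hz : z ∈ S)
    (w : V) : ContinuousWithinAt (fun z ↦ P ∘L fderivWithin ℝ Γ S z w) S z :=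
  continuousWithinAt_const.clm_comp
    ((h.fderivWithin_right (m := 0) hS (by simp) hz).continuousWithinAt.clm_apply
      continuousWithinAt_const)

theorem continuousWithinAt_fderivWithin_flip {V G W X : Type*} [NormedAddCommGroup V]
    [NormedSpace ℝ V] [NormedAddCommGroup G] [NormedSpace ℝ G] [NormedAddCommGroup W]
    [NormedSpace ℝ W] [NormedAddCommGroup X] [NormedSpace ℝ X] {Γ : V → W →L[ℝ] G →L[ℝ] X}
    {S : Set V} {z : V} (h : ContDiffWithinAt ℝ ∞ Γ S z) (hS : UniqueDiffOn ℝ S) (hz : z ∈ S)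
    (w : V) (v : G) : ContinuousWithinAt (fun z ↦ (fderivWithin ℝ Γ S z w).flip v) S z :=
  continuousWithinAt_fderivWithin_postcomp (ContinuousLinearMap.apply ℝ X v) h hS hz w

theorem continuousWithinAt_curvatureForm {Γ : ℝ² → F →L[ℝ] ℝ² →L[ℝ] F} {z : ℝ²}
    (hz : z ∈ range (𝓡∂ 2)) (hΓ : ContDiffWithinAt ℝ ∞ Γ (range (𝓡∂ 2)) z) (u v : ℝ²) :
    ContinuousWithinAt (fun z ↦ curvatureForm Γ z u v) (range (𝓡∂ 2)) z := by
  have h1 : ∀ w, ContinuousWithinAt (fun z ↦ (Γ z).flip w) (range (𝓡∂ 2)) z := fun w ↦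
    (hasFDerivWithinAt_flip (hΓ.differentiableWithinAt (by simp)).hasFDerivWithinAt
      w).continuousWithinAt
  have h2 := continuousWithinAt_fderivWithin_flip hΓ uniqueDiffOn_halfPlane hz
  exact ((h2 u v).sub (h2 v u)).add (((h1 u).mul (h1 v)).sub ((h1 v).mul (h1 u)))

/-- The trace of the curvature is continuous in every chart. -/
theorem continuousOn_trace_comp_curvature {K : ∀ y, E y →L[ℝ] E y}
    (hD : CovariantDerivative.ContMDiffCovariantDerivative D ∞)
    (hK : ∀ x, SmoothAt (F →L[ℝ] F) K x) (p : M) (u v : ℝ²) :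
    ContinuousOn (fun z ↦ LinearMap.trace ℝ _ ((K ((extChartAt (𝓡∂ 2) p).symm z) :
        E ((extChartAt (𝓡∂ 2) p).symm z) →ₗ[ℝ] E ((extChartAt (𝓡∂ 2) p).symm z))
        ∘ₗ curvature D hD _ (coordField p _ u) (coordField p _ v)))
      (extChartAt (𝓡∂ 2) p).target := by
  intro z hz
  have hb := FiberBundle.mem_baseSet_trivializationAt F E ((extChartAt (𝓡∂ 2) p).symm z)
  have hzr := extChartAt_target_subset_range p hz
  have hΓ := contDiffWithinAt_connectionForm (e := trivializationAt F E
    ((extChartAt (𝓡∂ 2) p).symm z)) hD hz hb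
  have hC := continuousWithinAt_curvatureForm hzr hΓ u v
  have h3 : ContinuousWithinAt (fun z' ↦ traceCLM F
      (trivEndo (trivializationAt F E ((extChartAt (𝓡∂ 2) p).symm z)) K
        ((extChartAt (𝓡∂ 2) p).symm z') * curvatureForm (connectionForm
          (trivializationAt F E ((extChartAt (𝓡∂ 2) p).symm z)) D p) z' u v))
      (range (𝓡∂ 2)) z :=
    (traceCLM F).continuous.continuousAt.comp_continuousWithinAt
      ((contDiffWithinAt_trivEndo hz hb (hK _)).continuousWithinAt.mul
        hC)
  refine (h3.congr_of_eventuallyEq_of_mem ?_ hzr).mono (extChartAt_target_subset_range p)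
  filter_upwards [target_mem_nhdsWithin hz, (tendsto_symm hz).eventually
    ((trivializationAt F E ((extChartAt (𝓡∂ 2) p).symm z)).open_baseSet.mem_nhds hb)] with z' hz' hb'
  exact trace_comp_curvature hD hz' hb' u v

end Transgression

/-! ### Parallel sections along the boundary -/

section LinearODE

/-- Local existence for linear ordinary differential equations. -/
theorem exists_linear_ode {F : Type*} [NormedAddCommGroup F] [NormedSpace ℝ F] [CompleteSpace F]
    {a : ℝ → F →L[ℝ] F} {r : ℝ} (hr : 0 < r) (ha : ContinuousOn a (Icc (-r) r)) (x₀ : F) :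
    ∃ ε > 0, ε ≤ r ∧ ∃ g : ℝ → F, g 0 = x₀ ∧ ∀ t ∈ Ioo (-ε) ε, HasDerivAt g (a t (g t)) t := by
  obtain ⟨A, hA⟩ := isCompact_Icc.exists_bound_of_continuousOn ha
  have hA0 : 0 ≤ A := (norm_nonneg _).trans (hA 0 ⟨by linarith, hr.le⟩)
  -- `B` bounds the velocity on the unit ball about `x₀`; the choice of `ε` gives `B ε ≤ 1`, which
  -- keeps the solution in that ball.
  set B := A * (‖x₀‖ + 1) with hB
  have hB0 : 0 ≤ B := by positivity
  set ε := min r (1 / (B + 1)) with hε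
  have hε0 : 0 < ε := lt_min hr (by positivity)
  have hεr : ε ≤ r := min_le_left _ _
  have hsub : Icc (-ε) ε ⊆ Icc (-r) r := Icc_subset_Icc (by linarith) hεr
  have hpl : IsPicardLindelof (fun t x ↦ a t x)
      (⟨0, by linarith, hε0.le⟩ : Icc (-ε) ε) x₀ 1 0 ⟨B, hB0⟩ ⟨A, hA0⟩ := by
    refine ⟨fun t ht ↦ ?_, fun x _ ↦ ?_, fun t ht x hx ↦ ?_, ?_⟩
    · exact ((a t).lipschitz.weaken (hA t (hsub ht))).lipschitzOnWith
    · exact (ha.mono hsub).clm_apply continuousOn_const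
    · refine ((a t).le_opNorm x).trans ?_
      refine mul_le_mul (hA t (hsub ht)) ?_ (norm_nonneg _) hA0
      have := norm_le_norm_add_norm_sub' x x₀
      rw [← dist_eq_norm] at this
      have h2 : dist x x₀ ≤ 1 := hx
      linarith
    · have h1 : ε * (B + 1) ≤ 1 :=
        (le_div_iff₀ (by positivity)).1 (min_le_right r (1 / (B + 1)))
      have h2 : max (ε - 0) (0 - -ε) = ε := by simp
      change B * max (ε - 0) (0 - -ε) ≤ 1 - 0
      rw [h2]
      nlinarith
  obtain ⟨g, hg0, hg⟩ := hpl.exists_eq_forall_mem_Icc_hasDerivWithinAt₀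
  exact ⟨ε, hε0, hεr, g, hg0, fun t ht ↦
    (hg t (Ioo_subset_Icc_self ht)).hasDerivAt (Icc_mem_nhds ht.1 ht.2)⟩

end LinearODE

/-! ### Extending boundary vectors by parallel transport -/

section Boundary

variable {M : Type*} [TopologicalSpace M] [T2Space M] [ChartedSpace (EuclideanHalfSpace 2) M]
  [IsManifold (𝓡∂ 2) ∞ M]
  {F : Type*} [NormedAddCommGroup F] [NormedSpace ℝ F] [FiniteDimensional ℝ F]
  {E : M → Type*} [TopologicalSpace (TotalSpace F E)] [∀ x, AddCommGroup (E x)]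
  [∀ x, Module ℝ (E x)] [∀ x, TopologicalSpace (E x)] [∀ x, IsTopologicalAddGroup (E x)]
  [∀ x, ContinuousSMul ℝ (E x)] [FiberBundle F E] [VectorBundle ℝ F E]
  [ContMDiffVectorBundle ∞ F E (𝓡∂ 2)]

/-- Every vector at a boundary point extends to a section which is parallel along the boundary. -/
theorem exists_parallel_section {D : CovariantDerivative (𝓡∂ 2) F E}
    (hD : CovariantDerivative.ContMDiffCovariantDerivative D ∞) {x : M}
    (hx : x ∈ (𝓡∂ 2).boundary M) (f : E x) :
    ∃ U : Set M, IsOpen U ∧ x ∈ U ∧ IsPreconnected (U ∩ (𝓡∂ 2).boundary M) ∧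
      ∃ σ : ∀ y, E y, σ x = f ∧ ∀ y ∈ U ∩ (𝓡∂ 2).boundary M,
        DiffAt F σ y ∧ ∀ v ∈ boundaryTangentSpace y, D σ y v = 0 := by
  have : CompleteSpace F := FiniteDimensional.complete ℝ F
  set e := trivializationAt F E x with he
  set z₀ := extChartAt (𝓡∂ 2) x x with hz₀
  have hz₀t : z₀ ∈ (extChartAt (𝓡∂ 2) x).target := mem_extChartAt_target x
  have hψz₀ : (extChartAt (𝓡∂ 2) x).symm z₀ = x := extChartAt_to_inv x
  have hz₀0 : z₀ 0 = 0 := coord_zero_of_boundary (mem_chart_source _ x) hx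
  have hxb : x ∈ e.baseSet := FiberBundle.mem_baseSet_trivializationAt F E x
  -- a half-disc in the domain of the chart and of the trivialization
  obtain ⟨r, hr, hball⟩ : ∃ r > 0, ∀ z ∈ Metric.ball z₀ r, z ∈ range (𝓡∂ 2) →
      z ∈ (extChartAt (𝓡∂ 2) x).target ∧ (extChartAt (𝓡∂ 2) x).symm z ∈ e.baseSet := by
    have h1 : ∀ᶠ z in 𝓝[range (𝓡∂ 2)] z₀,
        z ∈ (extChartAt (𝓡∂ 2) x).target ∧ (extChartAt (𝓡∂ 2) x).symm z ∈ e.baseSet := by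
      filter_upwards [target_mem_nhdsWithin hz₀t, (tendsto_symm hz₀t).eventually
        (e.open_baseSet.mem_nhds (by rw [hψz₀]; exact hxb))] with z h1 h2 using ⟨h1, h2⟩
    obtain ⟨r, hr, h2⟩ := Metric.mem_nhdsWithin_iff.1 h1
    exact ⟨r, hr, fun z hz hzr ↦ h2 ⟨hz, hzr⟩⟩
  -- In the chart at `x` the boundary is this line, and being parallel along it is a linear ordinary
  -- differential equation in `τ`.
  let line : ℝ → ℝ² := fun τ ↦ z₀ + τ • stdVec 1
  have hline0 : ∀ τ, line τ 0 = 0 := fun τ ↦ by simp [line, hz₀0]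
  have hline1 : ∀ τ, line τ 1 - z₀ 1 = τ := fun τ ↦ by simp [line]
  have hlineH : ∀ τ, line τ ∈ range (𝓡∂ 2) := fun τ ↦ mem_range_halfPlane.2 (hline0 τ).ge
  have hlineb : ∀ τ ρ : ℝ, line τ ∈ Metric.ball z₀ ρ ↔ |τ| < ρ := fun τ ρ ↦ by
    simp [line, dist_eq_norm, norm_smul]
  have hlinec : Continuous line := by fun_prop
  have hline_eq : ∀ z : ℝ², z 0 = 0 → z = line (z 1 - z₀ 1) := by
    intro z hz
    ext i
    fin_cases i
    · exact hz.trans (hline0 _).symm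
    · exact (sub_left_inj.1 (hline1 (z 1 - z₀ 1))).symm
  have hgood : ∀ τ : ℝ, |τ| < r → line τ ∈ (extChartAt (𝓡∂ 2) x).target ∧
      (extChartAt (𝓡∂ 2) x).symm (line τ) ∈ e.baseSet :=
    fun τ hτ ↦ hball _ ((hlineb τ r).2 hτ) (hlineH τ)
  -- Existence is applied on a closed interval; halving `r` keeps it inside the open interval where
  -- chart and trivialization are available.
  obtain ⟨ε, hε, hεr, g, hg0, hg⟩ := exists_linear_ode (r := r / 2)
    (a := fun τ ↦ -(connectionForm e D x (line τ)).flip (stdVec 1)) (half_pos hr) (by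
      intro τ hτ
      have hτr : |τ| < r := (abs_le.2 ⟨hτ.1, hτ.2⟩).trans_lt (by linarith)
      have h1 := (hasFDerivWithinAt_flip ((contDiffWithinAt_connectionForm hD (hgood τ hτr).1
        (hgood τ hτr).2).differentiableWithinAt (by simp)).hasFDerivWithinAt
        (stdVec 1)).continuousWithinAt
      exact (h1.comp hlinec.continuousWithinAt fun τ _ ↦ hlineH τ).neg)
    (e.continuousLinearMapAt ℝ x f)
  -- The solution is extended into the surface independently of the coordinate of index `0`. Only
  -- derivatives tangent to the boundary have to vanish, so any differentiable extension serves.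
  let σ : ∀ y, E y := fun y ↦ e.symmL ℝ y (g (extChartAt (𝓡∂ 2) x y 1 - z₀ 1))
  -- The ball meets the boundary line in the segment where `g` solves the equation; its image is
  -- connected, as the definition of parallel transport requires.
  let U : Set M := (extChartAt (𝓡∂ 2) x).source ∩ extChartAt (𝓡∂ 2) x ⁻¹' Metric.ball z₀ ε
  have hU : IsOpen U := isOpen_extChartAt_preimage' x Metric.isOpen_ball
  have hUb : U ∩ (𝓡∂ 2).boundary M
      = (fun τ ↦ (extChartAt (𝓡∂ 2) x).symm (line τ)) '' Ioo (-ε) ε := by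
    ext y
    constructor
    · rintro ⟨⟨hy, hyε⟩, hyb⟩
      have h0 := hline_eq _ (coord_zero_of_boundary (by rwa [extChartAt_source] at hy) hyb)
      rw [mem_preimage, h0, hlineb] at hyε
      refine ⟨_, abs_lt.1 hyε, ?_⟩
      change (extChartAt (𝓡∂ 2) x).symm (line _) = y
      rw [← h0, (extChartAt (𝓡∂ 2) x).left_inv hy]
    · rintro ⟨τ, hτ, rfl⟩
      have hτε : |τ| < ε := abs_lt.2 hτ
      have ht := (hgood τ (by linarith)).1
      refine ⟨⟨(extChartAt (𝓡∂ 2) x).map_target ht, ?_⟩, (mem_boundary_iff ht).2 (hline0 τ)⟩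
      change extChartAt (𝓡∂ 2) x ((extChartAt (𝓡∂ 2) x).symm (line τ)) ∈ Metric.ball z₀ ε
      rw [(extChartAt (𝓡∂ 2) x).right_inv ht, hlineb]
      exact hτε
  refine ⟨U, hU, ⟨mem_extChartAt_source x, Metric.mem_ball_self hε⟩, ?_, σ, ?_, ?_⟩
  · rw [hUb]
    refine isPreconnected_Ioo.image _ fun τ hτ ↦ ?_
    have hτε : |τ| < ε := abs_lt.2 hτ
    exact ((tendsto_symm (hgood τ (by linarith)).1).comp (tendsto_nhdsWithin_iff.2
      ⟨hlinec.continuousWithinAt, Filter.Eventually.of_forall hlineH⟩))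
  · simp only [σ]
    rw [← hz₀, sub_self, hg0, e.symmL_continuousLinearMapAt hxb]
  · rw [hUb]
    rintro _ ⟨τ, hτ, rfl⟩
    have hτε : |τ| < ε := abs_lt.2 hτ
    obtain ⟨ht, hb⟩ := hgood τ (by linarith)
    change DiffAt F σ ((extChartAt (𝓡∂ 2) x).symm (line τ)) ∧ ∀ v ∈ boundaryTangentSpace
      ((extChartAt (𝓡∂ 2) x).symm (line τ)), D σ ((extChartAt (𝓡∂ 2) x).symm (line τ)) v = 0
    have hsrc := symm_mem_source ht
    have hgτ := hg τ hτ
    have htriv : ∀ y ∈ e.baseSet, triv e σ y = g (extChartAt (𝓡∂ 2) x y 1 - z₀ 1) :=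
      fun y hy ↦ e.continuousLinearMapAt_symmL hy _
    have hg' : HasFDerivAt (fun z : ℝ² ↦ g (z 1 - z₀ 1)) ((ContinuousLinearMap.toSpanSingleton ℝ
        (-(connectionForm e D x (line τ)).flip (stdVec 1) (g τ))) ∘L
        (EuclideanSpace.proj (𝕜 := ℝ) (1 : Fin 2) : ℝ² →L[ℝ] ℝ)) (line τ) := by
      have h1 : HasFDerivAt (fun z : ℝ² ↦ z 1 - z₀ 1)
          (EuclideanSpace.proj (𝕜 := ℝ) (1 : Fin 2) : ℝ² →L[ℝ] ℝ) (line τ) :=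
        (EuclideanSpace.proj (𝕜 := ℝ) (1 : Fin 2) : ℝ² →L[ℝ] ℝ).hasFDerivAt.sub_const _
      have h2 : HasDerivAt g (-(connectionForm e D x (line τ)).flip (stdVec 1) (g τ))
          (line τ 1 - z₀ 1) := by rw [hline1]; exact hgτ
      exact h2.hasFDerivAt.comp (line τ) h1
    have hσ : DiffAt F σ ((extChartAt (𝓡∂ 2) x).symm (line τ)) := by
      rw [diffAt_iff hb]
      have h1 : MDifferentiableAt (𝓡∂ 2) 𝓘(ℝ, F) ((fun z : ℝ² ↦ g (z 1 - z₀ 1)) ∘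
          extChartAt (𝓡∂ 2) x) ((extChartAt (𝓡∂ 2) x).symm (line τ)) := by
        refine MDifferentiableAt.comp (I' := 𝓘(ℝ, ℝ²)) _ ?_ (mdifferentiableAt_coord hsrc)
        rw [(extChartAt (𝓡∂ 2) x).right_inv ht]
        exact hg'.differentiableAt.mdifferentiableAt
      refine h1.congr_of_eventuallyEq ?_
      filter_upwards [e.open_baseSet.mem_nhds hb] with y hy using htriv y hy
    refine ⟨hσ, fun v hv ↦ ?_⟩
    have hw := mfderiv_mem_of_boundaryTangentSpace hsrc ((mem_boundary_iff ht).2 (hline0 τ)) hv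
    have hvw := coordField_chartCoords hsrc v
    set w := chartCoords x _ v with hwdef
    have hw1 : w = w 1 • stdVec 1 := by
      ext i
      fin_cases i
      · simp [hw]
      · simp
    have h1 := triv_cov (D := D) ht hb hσ w
    have h2 : (fun z ↦ triv e σ ((extChartAt (𝓡∂ 2) x).symm z)) =ᶠ[𝓝[range (𝓡∂ 2)] (line τ)]
        fun z : ℝ² ↦ g (z 1 - z₀ 1) := by
      filter_upwards [target_mem_nhdsWithin ht, (tendsto_symm ht).eventually
        (e.open_baseSet.mem_nhds hb)] with z hz hzb
      rw [htriv _ hzb, (extChartAt (𝓡∂ 2) x).right_inv hz]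
    rw [h2.fderivWithin_eq_of_mem (hlineH τ), hg'.hasFDerivWithinAt.fderivWithin
      (uniqueDiffOn_halfPlane _ (hlineH τ)), htriv _ hb, (extChartAt (𝓡∂ 2) x).right_inv ht, hline1,
      hvw] at h1
    have h3 : e.continuousLinearMapAt ℝ _ (D σ ((extChartAt (𝓡∂ 2) x).symm (line τ)) v) = 0 := by
      rw [h1]
      conv_lhs => rw [hw1]
      simp
    have h4 := congrArg (e.symmL ℝ ((extChartAt (𝓡∂ 2) x).symm (line τ))) h3
    rwa [e.symmL_continuousLinearMapAt hb, map_zero] at h4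

end Boundary

/-! ### Orthogonal connections along the boundary -/

section OrthogonalConnections

variable {M : Type*} [TopologicalSpace M] [T2Space M] [ChartedSpace (EuclideanHalfSpace 2) M]
  [IsManifold (𝓡∂ 2) ∞ M]
  {F : Type*} [NormedAddCommGroup F] [NormedSpace ℝ F] [FiniteDimensional ℝ F]
  {E : M → Type*} [TopologicalSpace (TotalSpace F E)] [∀ x, AddCommGroup (E x)]
  [∀ x, Module ℝ (E x)] [∀ x, TopologicalSpace (E x)] [∀ x, IsTopologicalAddGroup (E x)]
  [∀ x, ContinuousSMul ℝ (E x)] [FiberBundle F E] [VectorBundle ℝ F E]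
  [ContMDiffVectorBundle ∞ F E (𝓡∂ 2)]
  {Ω : SymplecticStructure F E} {L : LagrangianSubbundle Ω} {J : CompatibleComplexStructure Ω}
  {D D' : CovariantDerivative (𝓡∂ 2) F E}

theorem smoothAt_J (J : CompatibleComplexStructure Ω) (x : M) : SmoothAt (F →L[ℝ] F) J.J x :=
  J.contMDiff_J x

theorem smoothAt_form (Ω : SymplecticStructure F E) {s t : ∀ y, E y} {x : M} (hs : SmoothAt F s x)
    (ht : SmoothAt F t x) : ContMDiffAt (𝓡∂ 2) 𝓘(ℝ, ℝ) ∞ (fun y ↦ Ω.form y (s y) (t y)) x := by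
  have : ContMDiffAt (𝓡∂ 2) ((𝓡∂ 2).prod 𝓘(ℝ, ℝ)) ∞
      (fun m ↦ TotalSpace.mk' ℝ (E := Bundle.Trivial M ℝ) m (Ω.form m (s m) (t m))) x :=
    ContMDiffAt.clm_bundle_apply₂ (F₁ := F) (F₂ := F) (Ω.contMDiff_form x) hs ht
  simp only [contMDiffAt_totalSpace] at this
  exact this.2

theorem diffAt_form (Ω : SymplecticStructure F E) {s t : ∀ y, E y} {x : M} (hs : DiffAt F s x)
    (ht : DiffAt F t x) :
    MDifferentiableAt (𝓡∂ 2) 𝓘(ℝ, ℝ) (fun y ↦ Ω.form y (s y) (t y)) x := by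
  have : ContMDiffVectorBundle 1 F E (𝓡∂ 2) := .of_le (n := ∞) (by simp)
  have : MDifferentiableAt (𝓡∂ 2) ((𝓡∂ 2).prod 𝓘(ℝ, ℝ))
      (fun m ↦ TotalSpace.mk' ℝ (E := Bundle.Trivial M ℝ) m (Ω.form m (s m) (t m))) x :=
    MDifferentiableAt.clm_bundle_apply₂ (F₁ := F) (F₂ := F)
      ((Ω.contMDiff_form x).mdifferentiableAt (by simp)) hs ht
  simp only [mdifferentiableAt_totalSpace] at this
  exact this.2

/-- Take the imaginary part of the Hermitian identity. Since `ω` does not depend on `J`, this is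
what connections for different complex structures have in common. -/
theorem mvfderiv_form (h : IsUnitaryAlongBoundary J D) {x : M} (hx : x ∈ (𝓡∂ 2).boundary M)
    {s t : ∀ y, E y} (hs : DiffAt F s x) (ht : DiffAt F t x) {v : TangentSpace (𝓡∂ 2) x}
    (hv : v ∈ boundaryTangentSpace x) :
    mvfderiv (𝓡∂ 2) (fun y ↦ Ω.form y (s y) (t y)) x v
      = Ω.form x (D s x v) (t x) + Ω.form x (s x) (D t x v) := by
  have h1 := h x hx s t hs ht v hv
  have ha := diffAt_form Ω hs (DiffAt.apply (smoothAt_J J x) ht)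
  have hb := diffAt_form Ω hs ht
  have hH : MDifferentiableAt (𝓡∂ 2) 𝓘(ℝ, ℂ) (fun y ↦ J.hermitian y (s y) (t y)) x := by
    have h2 := Complex.ofRealCLM.mdifferentiableAt.comp x ha
    have h3 := (Complex.I • Complex.ofRealCLM).mdifferentiableAt.comp x hb
    exact h2.add h3
  have him := Complex.imCLM.hasMFDerivAt.comp x hH.hasMFDerivAt
  have h4 : (Complex.imCLM ∘ fun y ↦ J.hermitian y (s y) (t y))
      = fun y ↦ Ω.form y (s y) (t y) := by
    ext y
    simp [CompatibleComplexStructure.hermitian]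
  rw [h4] at him
  have h5 : mvfderiv (𝓡∂ 2) (fun y ↦ Ω.form y (s y) (t y)) x v
      = (mvfderiv (𝓡∂ 2) (fun y ↦ J.hermitian y (s y) (t y)) x v).im :=
    DFunLike.congr_fun him.mfderiv v
  rw [h5, h1]
  simp [CompatibleComplexStructure.hermitian]

variable (F) in
theorem exists_smoothAt_eq {x : M} (f : E x) : ∃ s : ∀ y, E y, SmoothAt F s x ∧ s x = f := by
  have hx := FiberBundle.mem_baseSet_trivializationAt F E x
  exact ⟨constSection (trivializationAt F E x) ((trivializationAt F E x).continuousLinearMapAt ℝ x f),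
    smoothAt_constSection hx _, (trivializationAt F E x).symmL_continuousLinearMapAt hx f⟩

/-- The difference of two unitary connections is skew with respect to the symplectic form. -/
theorem form_differenceEndo {J' : CompatibleComplexStructure Ω} (h : IsUnitaryAlongBoundary J D)
    (h' : IsUnitaryAlongBoundary J' D') {x : M} (hx : x ∈ (𝓡∂ 2).boundary M)
    {v : TangentSpace (𝓡∂ 2) x} (hv : v ∈ boundaryTangentSpace x) (f g : E x) :
    Ω.form x (differenceEndo D D' x v f) g + Ω.form x f (differenceEndo D D' x v g) = 0 := by
  obtain ⟨s, hs, rfl⟩ := exists_smoothAt_eq F f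
  obtain ⟨t, ht, rfl⟩ := exists_smoothAt_eq F g
  have h1 := mvfderiv_form h hx hs.diffAt ht.diffAt hv
  have h2 := mvfderiv_form h' hx hs.diffAt ht.diffAt hv
  rw [differenceEndo_apply hs.diffAt, differenceEndo_apply ht.diffAt]
  simp only [map_sub, sub_apply]
  linarith

/-- The covariant derivative, along the boundary, of a section of the Lagrangian subbundle is a
section of the Lagrangian subbundle. -/
theorem cov_mem_lagrangian (N : OrthogonalConnection L J) {x : M} (hx : x ∈ (𝓡∂ 2).boundary M)
    {s : ∀ y, E y} (hs : DiffAt F s x)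
    (hsL : ∀ᶠ y in 𝓝 x, ∀ hy : y ∈ (𝓡∂ 2).boundary M, s y ∈ L.fiber ⟨y, hy⟩)
    {v : TangentSpace (𝓡∂ 2) x} (hv : v ∈ boundaryTangentSpace x) :
    N.D s x v ∈ L.fiber ⟨x, hx⟩ := by
  rw [L.lagrangian]
  intro f hf
  -- The test vector `f` in `L` is extended to a parallel section, which stays in `L`. Then `ω (s,
  -- σ)` vanishes on the boundary, and differentiating it gives `ω (∇s, f) = 0` because `∇σ = 0`.
  obtain ⟨U, hU, hxU, hconn, σ, hσx, hσ⟩ := exists_parallel_section N.smooth hx f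
  have hσL : ∀ y (hy : y ∈ (𝓡∂ 2).boundary M), y ∈ U → σ y ∈ L.fiber ⟨y, hy⟩ := fun y hy hyU ↦
    N.orthogonal U hU hconn σ hσ ⟨x, hx⟩ ⟨y, hy⟩ hxU hyU (by rw [hσx]; exact hf)
  obtain ⟨hσd, hσ0⟩ := hσ x ⟨hxU, hx⟩
  have h1 := mvfderiv_form N.unitary hx hs hσd hv
  rw [mvfderiv_eq_zero_of_boundary hx (diffAt_form Ω hs hσd) ?_ hv, hσ0 v hv, hσx, map_zero,
    add_zero] at h1
  · exact h1.symm
  · filter_upwards [hsL, hU.mem_nhds hxU] with y hy hyU hyb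
    exact (L.lagrangian ⟨y, hyb⟩ _).1 (hy hyb) _ (hσL y hyb hyU)

/-- Every vector of the Lagrangian subbundle extends to a local section of it. -/
theorem exists_section_lagrangian (L : LagrangianSubbundle Ω) {x : M} (hx : x ∈ (𝓡∂ 2).boundary M)
    {f : E x} (hf : f ∈ L.fiber ⟨x, hx⟩) : ∃ s : ∀ y, E y, DiffAt F s x ∧ s x = f ∧
      ∀ᶠ y in 𝓝 x, ∀ hy : y ∈ (𝓡∂ 2).boundary M, s y ∈ L.fiber ⟨y, hy⟩ := by
  obtain ⟨U, hU, k, s, hs, hsU⟩ := L.exists_frame ⟨x, hx⟩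
  rw [← (hsU ⟨x, hx⟩ (mem_of_mem_nhds hU)).2, Submodule.mem_span_range_iff_exists_fun] at hf
  obtain ⟨c, hc⟩ := hf
  refine ⟨∑ i, c i • s i, ?_, ?_, ?_⟩
  · have : ∀ S : Finset (Fin k), DiffAt F (∑ i ∈ S, c i • s i) x := by
      intro S
      classical
      induction S using Finset.induction with
      | empty => exact mdifferentiableAt_zeroSection ..
      | insert i S hi IH =>
        rw [Finset.sum_insert hi]
        exact mdifferentiableAt_add_section (MDifferentiableAt.smul_section
          (mdifferentiableAt_const (c := c i)) (((hs i).contMDiffAt hU).mdifferentiableAt (by simp)))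
          IH
    exact this _
  · simpa [Finset.sum_apply] using hc
  · filter_upwards [hU] with y hy hyb
    rw [Finset.sum_apply]
    refine Submodule.sum_mem _ fun i _ ↦ Submodule.smul_mem _ _ ?_
    rw [← (hsU ⟨y, hyb⟩ hy).2]
    exact Submodule.subset_span (mem_range_self i)

theorem finiteDimensional_fiber (F : Type*) [NormedAddCommGroup F] [NormedSpace ℝ F]
    [FiniteDimensional ℝ F] {E : M → Type*} [TopologicalSpace (TotalSpace F E)]
    [∀ x, AddCommGroup (E x)] [∀ x, Module ℝ (E x)] [∀ x, TopologicalSpace (E x)]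
    [FiberBundle F E] [VectorBundle ℝ F E] (x : M) : FiniteDimensional ℝ (E x) :=
  ((trivializationAt F E x).continuousLinearEquivAt ℝ x
    (FiberBundle.mem_baseSet_trivializationAt F E x)).symm.toLinearEquiv.finiteDimensional

variable (Ω) in
/-- The symplectic form on the fibre at `x`, as a bilinear map. -/
def formAt (x : M) : E x →ₗ[ℝ] E x →ₗ[ℝ] ℝ :=
  LinearMap.mk₂ ℝ (fun v w ↦ Ω.form x v w) (by simp) (by simp) (by simp) (by simp)

theorem isCompatible (J : CompatibleComplexStructure Ω) (x : M) :
    IsCompatible (formAt Ω x) (J.J x : E x →ₗ[ℝ] E x) :=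
  ⟨Ω.self_eq_zero x, J.sq_eq_neg x, J.form_map x, J.form_pos x⟩

/-- The difference of the connections is skew for `ω`, hence traceless. The two complex structures
may differ. -/
theorem traceForm_id_eq_zero {J' : CompatibleComplexStructure Ω} (h : IsUnitaryAlongBoundary J D)
    (h' : IsUnitaryAlongBoundary J' D') {x : M} (hx : x ∈ (𝓡∂ 2).boundary M)
    {v : TangentSpace (𝓡∂ 2) x} (hv : v ∈ boundaryTangentSpace x) :
    traceForm (fun y ↦ ContinuousLinearMap.id ℝ (E y)) D D' x v = 0 := by
  have := finiteDimensional_fiber F (E := E) x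
  rw [traceForm_apply]
  have h1 : LinearMap.trace ℝ (E x) (differenceEndo D D' x v) = 0 :=
    trace_eq_zero_of_skew (formAt Ω x) (Ω.nondegenerate x) _ (form_differenceEndo h h' hx hv)
  exact_mod_cast h1

/-- The Lagrangian condition is a hypothesis on derivatives of sections of `L`, and no unitarity is
required, so that the result covers the conjugated connection. -/
theorem traceForm_J_eq_zero (h : IsComplexLinear J D) (h' : IsComplexLinear J D') {x : M}
    (hx : x ∈ (𝓡∂ 2).boundary M) {v : TangentSpace (𝓡∂ 2) x}
    (hL : ∀ s : ∀ y, E y, DiffAt F s x →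
      (∀ᶠ y in 𝓝 x, ∀ hy : y ∈ (𝓡∂ 2).boundary M, s y ∈ L.fiber ⟨y, hy⟩) →
      D s x v ∈ L.fiber ⟨x, hx⟩ ∧ D' s x v ∈ L.fiber ⟨x, hx⟩) :
    traceForm J.J D D' x v = 0 := by
  have := finiteDimensional_fiber F (E := E) x
  rw [traceForm_apply]
  have h1 := (isCompatible J x).trace_comp_eq_zero (L.lagrangian ⟨x, hx⟩)
    (differenceEndo D D' x v) (fun f ↦ ?_) fun f hf ↦ ?_
  · exact_mod_cast h1
  · obtain ⟨s, hs, rfl⟩ := exists_smoothAt_eq F f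
    have h2 := differenceEndo_apply (D := D) (D' := D')
      (DiffAt.apply (smoothAt_J J x) hs.diffAt) v
    rw [h s x hs.diffAt, h' s x hs.diffAt, ← map_sub] at h2
    exact h2.trans (congrArg _ (differenceEndo_apply hs.diffAt v).symm)
  · obtain ⟨s, hs, rfl, hsL⟩ := exists_section_lagrangian L hx hf
    rw [differenceEndo_apply hs]
    exact Submodule.sub_mem _ (hL s hs hsL).2 (hL s hs hsL).1

end OrthogonalConnections

/-! ### Isomorphisms of bundle pairs -/

/-- Tube lemma: `[0, 1]` is compact, so one neighbourhood of `x` serves for all `t`. -/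
theorem eventually_convexCombination_mem {X G : Type*} [TopologicalSpace X]
    [NormedAddCommGroup G] [NormedSpace ℝ G] {a b : X → G} {x : X} (ha : ContinuousAt a x)
    (hb : ContinuousAt b x) {S : Set G} (hS : IsOpen S)
    (h : ∀ t ∈ Icc (0 : ℝ) 1, (1 - t) • a x + t • b x ∈ S) :
    ∀ᶠ y in 𝓝 x, ∀ t ∈ Icc (0 : ℝ) 1, (1 - t) • a y + t • b y ∈ S := by
  refine isCompact_Icc.eventually_forall_of_forall_eventually
    (P := fun y t ↦ (1 - t) • a y + t • b y ∈ S) fun t ht ↦ ?_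
  have h2 : ContinuousAt (fun q : X × ℝ ↦ (1 - q.2) • a q.1 + q.2 • b q.1) (x, t) :=
    ((continuousAt_const.sub continuousAt_snd).smul
      (ContinuousAt.comp (f := Prod.fst) ha continuousAt_fst)).add
      (continuousAt_snd.smul (ContinuousAt.comp (f := Prod.fst) hb continuousAt_fst))
  exact h2.eventually (hS.mem_nhds (h t ht))

/-! ### Invertible bundle endomorphisms -/

section BundleMaps

variable {M : Type*} [TopologicalSpace M] [T2Space M] [ChartedSpace (EuclideanHalfSpace 2) M]
  [IsManifold (𝓡∂ 2) ∞ M]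
  {F : Type*} [NormedAddCommGroup F] [NormedSpace ℝ F] [FiniteDimensional ℝ F]
  {E : M → Type*} [TopologicalSpace (TotalSpace F E)] [∀ x, AddCommGroup (E x)]
  [∀ x, Module ℝ (E x)] [∀ x, TopologicalSpace (E x)] [∀ x, IsTopologicalAddGroup (E x)]
  [∀ x, ContinuousSMul ℝ (E x)] [FiberBundle F E] [VectorBundle ℝ F E]
  [ContMDiffVectorBundle ∞ F E (𝓡∂ 2)]
  {e : Trivialization F (π F E)} [MemTrivializationAtlas e]

theorem contMDiffAt_trivEndo {Φ : ∀ y, E y →L[ℝ] E y} {x : M} (h : SmoothAt (F →L[ℝ] F) Φ x)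
    (hx : x ∈ e.baseSet) :
    ContMDiffAt (𝓡∂ 2) 𝓘(ℝ, F →L[ℝ] F) ∞ (trivEndo e Φ) x :=
  contMDiffAt_clm_of_apply fun f ↦ (smoothAt_iff hx).1 (h.apply (smoothAt_constSection hx f))

theorem exists_equiv_of_injective {A : F →L[ℝ] F} (hA : ∀ f, A f = 0 → f = 0) :
    ∃ B : F ≃L[ℝ] F, (B : F →L[ℝ] F) = A :=
  ⟨(LinearEquiv.ofInjectiveEndo (A : F →ₗ[ℝ] F)
    ((injective_iff_map_eq_zero _).2 hA)).toContinuousLinearEquiv, by ext; rfl⟩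

theorem trivEndo_injective_iff {Φ : ∀ y, E y →L[ℝ] E y} {x : M} (hx : x ∈ e.baseSet) :
    (∃ B : F ≃L[ℝ] F, (B : F →L[ℝ] F) = trivEndo e Φ x) ↔ ∀ v, Φ x v = 0 → v = 0 := by
  constructor
  · rintro ⟨B, hB⟩ v hv
    have h1 := trivEndo_triv hx Φ v
    rw [hv, map_zero, ← hB] at h1
    have h2 : e.continuousLinearMapAt ℝ x v = 0 := B.map_eq_zero_iff.1 h1
    rw [← e.symmL_continuousLinearMapAt (R := ℝ) hx v, h2, map_zero]
  · intro h
    refine exists_equiv_of_injective fun f hf ↦ ?_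
    have h1 := congrArg (e.symmL ℝ x) hf
    simp only [trivEndo, ContinuousLinearMap.comp_apply] at h1
    rw [e.symmL_continuousLinearMapAt hx, map_zero] at h1
    rw [← e.continuousLinearMapAt_symmL (R := ℝ) hx f, h _ h1, map_zero]

/-- A smooth family of injective endomorphisms has a smooth inverse. -/
theorem exists_smooth_inverse {Φ : ∀ y, E y →L[ℝ] E y} (hΦ : ∀ x, SmoothAt (F →L[ℝ] F) Φ x)
    (hinj : ∀ x v, Φ x v = 0 → v = 0) : ∃ Ψ : ∀ y, E y →L[ℝ] E y,
    (∀ x, SmoothAt (F →L[ℝ] F) Ψ x) ∧ (∀ x v, Ψ x (Φ x v) = v) ∧ ∀ x v, Φ x (Ψ x v) = v := by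
  have : CompleteSpace F := FiniteDimensional.complete ℝ F
  have hmem := FiberBundle.mem_baseSet_trivializationAt F E
  have key : ∀ x, ∃ Ψ : E x →L[ℝ] E x, ∀ v, Φ x (Ψ v) = v := by
    intro x
    obtain ⟨B, hB⟩ := (trivEndo_injective_iff (e := trivializationAt F E x) (hmem x)).2 (hinj x)
    refine ⟨(trivializationAt F E x).symmL ℝ x ∘L (B.symm : F →L[ℝ] F) ∘L
      (trivializationAt F E x).continuousLinearMapAt ℝ x, fun v ↦ ?_⟩
    set w := (trivializationAt F E x).continuousLinearMapAt ℝ x v with hw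
    have h1 := trivEndo_triv (hmem x) Φ ((trivializationAt F E x).symmL ℝ x (B.symm w))
    rw [(trivializationAt F E x).continuousLinearMapAt_symmL (hmem x), ← hB] at h1
    have h2 := congrArg ((trivializationAt F E x).symmL ℝ x) h1
    rw [(trivializationAt F E x).symmL_continuousLinearMapAt (hmem x)] at h2
    simp only [ContinuousLinearMap.comp_apply, ContinuousLinearEquiv.coe_coe,
      ContinuousLinearEquiv.apply_symm_apply] at h2 ⊢
    rw [← hw, ← h2, hw, (trivializationAt F E x).symmL_continuousLinearMapAt (hmem x)]
  choose Ψ hΨ using key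
  refine ⟨Ψ, fun x ↦ smoothAt_hom_of_apply fun f ↦ ?_, fun x v ↦ ?_, hΨ⟩
  · set e := trivializationAt F E x
    obtain ⟨B, hB⟩ := (trivEndo_injective_iff (hmem x)).2 (hinj x)
    rw [smoothAt_iff (hmem x)]
    -- The inverses were chosen pointwise, but they are unique, and in a trivialization they are
    -- given by operator inversion, which is smooth at invertible operators.
    have h1 : ContMDiffAt (𝓡∂ 2) 𝓘(ℝ, F →L[ℝ] F) ∞
        (ContinuousLinearMap.inverse ∘ trivEndo e Φ) x := by
      refine ContMDiffAt.comp x (I' := 𝓘(ℝ, F →L[ℝ] F)) ?_ (contMDiffAt_trivEndo (hΦ x) (hmem x))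
      rw [← hB]
      exact (contDiffAt_map_inverse B).contMDiffAt
    have h2 : ContMDiffAt (𝓡∂ 2) 𝓘(ℝ, F) ∞
        (fun y ↦ (ContinuousLinearMap.inverse ∘ trivEndo e Φ) y f) x :=
      h1.clm_apply contMDiffAt_const
    refine h2.congr_of_eventuallyEq ?_
    filter_upwards [e.open_baseSet.mem_nhds (hmem x)] with y hy
    obtain ⟨B, hB⟩ := (trivEndo_injective_iff hy).2 (hinj y)
    rw [Function.comp_apply, ← hB, ContinuousLinearMap.inverse_equiv]
    refine (B.symm_apply_eq.2 ?_).symm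
    have h3 := trivEndo_triv hy Φ (Ψ y (constSection e f y))
    rw [hΨ, ← hB] at h3
    exact ((triv_constSection hy f).symm.trans h3.symm)
  · refine sub_eq_zero.1 (hinj x _ ?_)
    rw [map_sub, hΨ, sub_self]

/-- Invertibility of all convex combinations of two smooth families of endomorphisms is an open
condition. -/
theorem eventually_injective_convexCombination {Φ Φ' : ∀ y, E y →L[ℝ] E y} {x : M}
    (hΦ : SmoothAt (F →L[ℝ] F) Φ x) (hΦ' : SmoothAt (F →L[ℝ] F) Φ' x)
    (h : ∀ t ∈ Icc (0 : ℝ) 1, ∀ v, ((1 - t) • Φ x + t • Φ' x) v = 0 → v = 0) :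
    ∀ᶠ y in 𝓝 x, ∀ t ∈ Icc (0 : ℝ) 1, ∀ v, ((1 - t) • Φ y + t • Φ' y) v = 0 → v = 0 := by
  have : CompleteSpace F := FiniteDimensional.complete ℝ F
  have hx := FiberBundle.mem_baseSet_trivializationAt F E x
  set e := trivializationAt F E x
  have htriv : ∀ y (t : ℝ), trivEndo e (fun y ↦ (1 - t) • Φ y + t • Φ' y) y
      = (1 - t) • trivEndo e Φ y + t • trivEndo e Φ' y := by
    intro y t
    ext f
    simp [trivEndo]
  have hev := eventually_convexCombination_mem
    (contMDiffAt_trivEndo (e := e) hΦ hx).continuousAt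
    (contMDiffAt_trivEndo (e := e) hΦ' hx).continuousAt
    (ContinuousLinearEquiv.isOpen (𝕜 := ℝ) (E := F) (F := F)) fun t ht ↦ by
      obtain ⟨B, hB⟩ := (trivEndo_injective_iff (e := e)
        (Φ := fun y ↦ (1 - t) • Φ y + t • Φ' y) hx).2 (h t ht)
      exact ⟨B, by rw [hB, htriv]⟩
  filter_upwards [hev, e.open_baseSet.mem_nhds hx] with y hy hyb t ht
  obtain ⟨B, hB⟩ := hy t ht
  exact (trivEndo_injective_iff (e := e) (Φ := fun y ↦ (1 - t) • Φ y + t • Φ' y) hyb).1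
    ⟨B, by rw [hB, htriv]⟩

end BundleMaps

/-! ### Construction of the isomorphism preserving the Lagrangian subbundle -/

section Intertwiner

variable {M : Type*} [TopologicalSpace M] [T2Space M] [CompactSpace M]
  [ChartedSpace (EuclideanHalfSpace 2) M] [IsManifold (𝓡∂ 2) ∞ M]
  {F : Type*} [NormedAddCommGroup F] [NormedSpace ℝ F] [FiniteDimensional ℝ F]
  {E : M → Type*} [TopologicalSpace (TotalSpace F E)] [∀ x, AddCommGroup (E x)]
  [∀ x, Module ℝ (E x)] [∀ x, TopologicalSpace (E x)] [∀ x, IsTopologicalAddGroup (E x)]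
  [∀ x, ContinuousSMul ℝ (E x)] [FiberBundle F E] [VectorBundle ℝ F E]
  [ContMDiffVectorBundle ∞ F E (𝓡∂ 2)]
  {Ω : SymplecticStructure F E}

/-- A Lagrangian subbundle is spanned by finitely many global smooth sections. -/
theorem exists_spanning_sections (L : LagrangianSubbundle Ω) :
    ∃ (ι : Type) (_ : Fintype ι) (σ : ι → ∀ y, E y), (∀ i x, SmoothAt F (σ i) x) ∧
      ∀ y : (𝓡∂ 2).boundary M, Submodule.span ℝ (range fun i ↦ σ i y) = L.fiber y := by
  have hcomp : IsCompact ((𝓡∂ 2).boundary M) :=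
    (ModelWithCorners.isClosed_boundary (I := 𝓡∂ 2) (n := ∞) (by simp)).isCompact
  have key : ∃ (ι : Type) (_ : Fintype ι) (σ : ι → ∀ y, E y), (∀ i x, SmoothAt F (σ i) x) ∧
      (∀ i, ∀ y : (𝓡∂ 2).boundary M, σ i y ∈ L.fiber y) ∧
      ∀ y : (𝓡∂ 2).boundary M, (y : M) ∈ (𝓡∂ 2).boundary M →
        L.fiber y ≤ Submodule.span ℝ (range fun i ↦ σ i y) := by
    -- Compactness of the boundary, with disjoint unions of families. Only a spanning family is
    -- sought: `L` need not be trivial along a boundary circle.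
    refine hcomp.induction_on (p := fun S ↦ ∃ (ι : Type) (_ : Fintype ι) (σ : ι → ∀ y, E y),
      (∀ i x, SmoothAt F (σ i) x) ∧ (∀ i, ∀ y : (𝓡∂ 2).boundary M, σ i y ∈ L.fiber y) ∧
      ∀ y : (𝓡∂ 2).boundary M, (y : M) ∈ S → L.fiber y ≤ Submodule.span ℝ (range fun i ↦ σ i y))
      ⟨Empty, inferInstance, fun i ↦ i.elim, fun i ↦ i.elim, fun i ↦ i.elim,
        fun y hy ↦ hy.elim⟩ ?_ ?_ ?_
    · rintro S T hST ⟨ι, hι, σ, h1, h2, h3⟩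
      exact ⟨ι, hι, σ, h1, h2, fun y hy ↦ h3 y (hST hy)⟩
    · rintro S T ⟨ι, hι, σ, h1, h2, h3⟩ ⟨ι', hι', σ', h1', h2', h3'⟩
      refine ⟨ι ⊕ ι', inferInstance, Sum.elim σ σ', ?_, ?_, ?_⟩
      · rintro (i | i) x
        exacts [h1 i x, h1' i x]
      · rintro (i | i) y
        exacts [h2 i y, h2' i y]
      · rintro y (hy | hy)
        · refine (h3 y hy).trans (Submodule.span_mono ?_)
          rintro _ ⟨i, rfl⟩
          exact ⟨Sum.inl i, rfl⟩
        · refine (h3' y hy).trans (Submodule.span_mono ?_)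
          rintro _ ⟨i, rfl⟩
          exact ⟨Sum.inr i, rfl⟩
    · intro x hx
      obtain ⟨U, hU, k, s, hs, hsU⟩ := L.exists_frame ⟨x, hx⟩
      obtain ⟨f, hf⟩ := (SmoothBumpFunction.nhds_basis_tsupport (I := 𝓡∂ 2) x).mem_iff.1
        (interior_mem_nhds.2 hU)
      refine ⟨{y | f y = 1} ∩ U, mem_nhdsWithin_of_mem_nhds (Filter.inter_mem f.eventuallyEq_one hU),
        Fin k, inferInstance, fun i ↦ (f : M → ℝ) • s i, fun i y ↦ ?_, fun i y ↦ ?_,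
        fun y hy ↦ ?_⟩
      · exact ContMDiffOn.smul_section_of_tsupport (V := E) (F := F) (s := s i)
          f.contMDiff.contMDiffOn isOpen_interior hf.2 ((hs i).mono interior_subset) y
      · change f y • s i y ∈ _
        -- The cut-off section must lie in `L` at every boundary point: inside `U` because the frame
        -- does, outside because it is zero.
        by_cases hy : (y : M) ∈ U
        · refine Submodule.smul_mem _ _ ?_
          rw [← (hsU y hy).2]
          exact Submodule.subset_span (mem_range_self i)
        · have h0 : f y = 0 := image_eq_zero_of_notMem_tsupport
            fun h ↦ hy (interior_subset (hf.2 h))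
          rw [h0, zero_smul]
          exact Submodule.zero_mem _
      · rw [← (hsU y hy.2).2]
        refine Submodule.span_mono ?_
        rintro _ ⟨i, rfl⟩
        refine ⟨i, ?_⟩
        change f y • s i y = s i y
        rw [hy.1, one_smul]
  obtain ⟨ι, hι, σ, h1, h2, h3⟩ := key
  refine ⟨ι, hι, σ, h1, fun y ↦ le_antisymm (Submodule.span_le.2 ?_) (h3 y y.2)⟩
  rintro _ ⟨i, rfl⟩
  exact h2 i y

/-- The complex bundles given by two compatible complex structures are isomorphic, by an
isomorphism which preserves a given Lagrangian subbundle. -/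
theorem exists_intertwiner (L : LagrangianSubbundle Ω) (J J' : CompatibleComplexStructure Ω) :
    ∃ Φ : ∀ y, E y →L[ℝ] E y, (∀ x, SmoothAt (F →L[ℝ] F) Φ x) ∧ (∀ x v, Φ x v = 0 → v = 0) ∧
      (∀ x v, J'.J x (Φ x v) = Φ x (J.J x v)) ∧
      ∀ y : (𝓡∂ 2).boundary M, ∀ v ∈ L.fiber y, Φ y v ∈ L.fiber y := by
  obtain ⟨ι, hι, σ, hσ, hσL⟩ := exists_spanning_sections L
  -- `Φ₀` is injective everywhere but need not preserve `L`. `Φ₁` is the `(J, J')`-linear extension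
  -- of `v ↦ ∑ ω (σ i, J v) σ i` on `L`: for `v` in `L` the terms with `J' (σ i)` vanish, so `Φ₁`
  -- preserves `L` at the boundary.
  let Φ₀ : ∀ y, E y →L[ℝ] E y := fun y ↦ ContinuousLinearMap.id ℝ (E y) - J'.J y ∘L J.J y
  let Φ₁ : ∀ y, E y →L[ℝ] E y := fun y ↦ ∑ i, ((Ω.form y (σ i y) ∘L J.J y).smulRight (σ i y)
    + (Ω.form y (σ i y)).smulRight (J'.J y (σ i y)))
  have hΦ₁ : ∀ y v, Φ₁ y v = ∑ i, (Ω.form y (σ i y) (J.J y v) • σ i y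
      + Ω.form y (σ i y) v • J'.J y (σ i y)) := fun y v ↦ by
    simp [Φ₁, sum_apply]
  have hJ₀ : ∀ y v, J'.J y (Φ₀ y v) = Φ₀ y (J.J y v) := fun y v ↦ by
    simp [Φ₀, J.sq_eq_neg, J'.sq_eq_neg, add_comm]
  have hJ₁ : ∀ y v, J'.J y (Φ₁ y v) = Φ₁ y (J.J y v) := fun y v ↦ by
    simp [hΦ₁, J.sq_eq_neg, J'.sq_eq_neg, add_comm]
  have hs₀ : ∀ x, SmoothAt (F →L[ℝ] F) Φ₀ x := fun x ↦ smoothAt_hom_of_apply fun f ↦ by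
    have hc := smoothAt_constSection (FiberBundle.mem_baseSet_trivializationAt F E x) f
    exact ContMDiffAt.sub_section hc ((smoothAt_J J' x).apply ((smoothAt_J J x).apply hc))
  have hs₁ : ∀ x, SmoothAt (F →L[ℝ] F) Φ₁ x := fun x ↦ smoothAt_hom_of_apply fun f ↦ by
    have hc := smoothAt_constSection (FiberBundle.mem_baseSet_trivializationAt F E x) f
    simp only [hΦ₁]
    exact ContMDiffAt.sum_section fun i _ ↦ ContMDiffAt.add_section
      (ContMDiffAt.smul_section (smoothAt_form Ω (hσ i x) ((smoothAt_J J x).apply hc)) (hσ i x))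
      (ContMDiffAt.smul_section (smoothAt_form Ω (hσ i x) hc) ((smoothAt_J J' x).apply (hσ i x)))
  have hinj₀ : ∀ x v, Φ₀ x v = 0 → v = 0 := fun x v hv ↦
    (isCompatible J x).map_sub_comp_injective (isCompatible J' x) hv
  -- All convex combinations are required to be injective because nothing is known about the values
  -- of the cutoff `χ` between the boundary and the complement of `W`.
  let W : Set M := {x | ∀ t ∈ Icc (0 : ℝ) 1, ∀ v, ((1 - t) • Φ₀ x + t • Φ₁ x) v = 0 → v = 0}
  have hW : IsOpen W := isOpen_iff_mem_nhds.2 fun x hx ↦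
    eventually_injective_convexCombination (hs₀ x) (hs₁ x) hx
  have hbW : (𝓡∂ 2).boundary M ⊆ W := by
    intro x hx t ht v hv
    have := finiteDimensional_fiber F (E := E) x
    refine (isCompatible J x).convexCombination_injective (isCompatible J' x)
      (L.lagrangian ⟨x, hx⟩) (fun i ↦ σ i x) (hσL ⟨x, hx⟩) ht.1 ht.2 (v := v) ?_
    rw [add_apply, smul_apply, smul_apply, hΦ₁] at hv
    exact hv
  -- With `χ = 1` on the boundary and `χ = 0` off `W`, the glued map equals `Φ₁` where `L` matters
  -- and `Φ₀` where combinations may degenerate.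
  obtain ⟨χ, hχ0, hχ1, hχ⟩ := exists_contMDiffMap_zero_one_of_isClosed (𝓡∂ 2) (n := ⊤)
    hW.isClosed_compl (ModelWithCorners.isClosed_boundary (I := 𝓡∂ 2) (M := M) (n := ∞) (by simp))
    (disjoint_compl_left_iff_subset.2 hbW)
  refine ⟨fun y ↦ (1 - χ y) • Φ₀ y + χ y • Φ₁ y, fun x ↦ ?_, fun x v hv ↦ ?_, fun x v ↦ ?_,
    fun y v hv ↦ ?_⟩
  · exact ContMDiffAt.add_section
      (ContMDiffAt.smul_section (contMDiffAt_const.sub χ.contMDiff.contMDiffAt) (hs₀ x))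
      (ContMDiffAt.smul_section χ.contMDiff.contMDiffAt (hs₁ x))
  · by_cases hx : x ∈ W
    · exact hx _ (hχ x) v hv
    · have h0 : χ x = 0 := hχ0 hx
      beta_reduce at hv
      rw [h0, sub_zero, one_smul, zero_smul, add_zero] at hv
      exact hinj₀ x v hv
  · simp only [add_apply, smul_apply, map_add, map_smul, hJ₀, hJ₁]
  · have h1 : χ y = 1 := hχ1 y.2
    have hσm : ∀ i, σ i y ∈ L.fiber y := fun i ↦ by
      rw [← hσL y]
      exact Submodule.subset_span (mem_range_self i)
    simp only [h1, sub_self, zero_smul, zero_add, one_smul]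
    rw [hΦ₁]
    refine Submodule.sum_mem _ fun i _ ↦ ?_
    rw [(L.lagrangian y _).1 (hσm i) v hv, zero_smul, add_zero]
    exact Submodule.smul_mem _ _ (hσm i)

end Intertwiner

/-! ### Conjugation of connections -/

section Conjugation

variable {M : Type*} [TopologicalSpace M] [T2Space M] [ChartedSpace (EuclideanHalfSpace 2) M]
  [IsManifold (𝓡∂ 2) ∞ M]
  {F : Type*} [NormedAddCommGroup F] [NormedSpace ℝ F] [FiniteDimensional ℝ F]
  {E : M → Type*} [TopologicalSpace (TotalSpace F E)] [∀ x, AddCommGroup (E x)]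
  [∀ x, Module ℝ (E x)] [∀ x, TopologicalSpace (E x)] [∀ x, IsTopologicalAddGroup (E x)]
  [∀ x, ContinuousSMul ℝ (E x)] [FiberBundle F E] [VectorBundle ℝ F E]
  [ContMDiffVectorBundle ∞ F E (𝓡∂ 2)]
  {D : CovariantDerivative (𝓡∂ 2) F E} {Φ Ψ : ∀ y, E y →L[ℝ] E y}

/-- The connection `Φ⁻¹ ∘ D ∘ Φ`. -/
def conjugate (D : CovariantDerivative (𝓡∂ 2) F E) (hΦ : ∀ x, SmoothAt (F →L[ℝ] F) Φ x)
    (hΨΦ : ∀ x v, Ψ x (Φ x v) = v) : CovariantDerivative (𝓡∂ 2) F E where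
  toFun s x := Ψ x ∘L D (fun y ↦ Φ y (s y)) x
  isCovariantDerivativeOnUniv :=
    { add := by
        intro s s' x hs hs' _
        have h : (fun y ↦ Φ y ((s + s') y)) = (fun y ↦ Φ y (s y)) + fun y ↦ Φ y (s' y) := by
          ext y
          simp
        rw [h, D.isCovariantDerivativeOnUniv.add (DiffAt.apply (hΦ x) hs) (DiffAt.apply (hΦ x) hs'),
          ContinuousLinearMap.comp_add]
      leibniz := by
        intro s g x hs hg _
        have h : (fun y ↦ Φ y ((g • s) y)) = g • fun y ↦ Φ y (s y) := by
          ext y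
          simp
        rw [h, D.isCovariantDerivativeOnUniv.leibniz (DiffAt.apply (hΦ x) hs) hg]
        ext v
        simp [hΨΦ] }

theorem conjugate_apply (hΦ : ∀ x, SmoothAt (F →L[ℝ] F) Φ x) (hΨΦ : ∀ x v, Ψ x (Φ x v) = v)
    (s : ∀ y, E y) (x : M) (v : TangentSpace (𝓡∂ 2) x) :
    conjugate D hΦ hΨΦ s x v = Ψ x (D (fun y ↦ Φ y (s y)) x v) := rfl

theorem conjugate_smooth (hD : CovariantDerivative.ContMDiffCovariantDerivative D ∞)
    (hΦ : ∀ x, SmoothAt (F →L[ℝ] F) Φ x) (hΨ : ∀ x, SmoothAt (F →L[ℝ] F) Ψ x)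
    (hΨΦ : ∀ x v, Ψ x (Φ x v) = v) :
    CovariantDerivative.ContMDiffCovariantDerivative (conjugate D hΦ hΨΦ) ∞ := by
  refine ⟨⟨fun {s} hs x _ ↦ ContMDiffAt.contMDiffWithinAt ?_⟩⟩
  have hs' : ∀ y, SmoothAt F s y := fun y ↦
    (hs.contMDiffAt Filter.univ_mem).of_le (by simp)
  have h1 := smoothAt_cov hD (x := x) (Filter.Eventually.of_forall fun y ↦ (hΦ y).apply (hs' y))
  refine smoothAt_hom_of_apply (E := fun y : M ↦ TangentSpace (𝓡∂ 2) y) (F := ℝ²)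
    (Φ := fun y ↦ conjugate D hΦ hΨΦ s y) fun f ↦ ?_
  exact (hΨ x).apply (h1.apply (smoothAt_constSection
    (FiberBundle.mem_baseSet_trivializationAt ℝ² (TangentSpace (𝓡∂ 2)) x) f))

/-- `Φ` and `Φ⁻¹` cancel between successive derivatives. The section `Φ s` is no longer the standard
extension of its value, so tensoriality of the curvature is needed to conclude. -/
theorem curvature_conjugate (hD : CovariantDerivative.ContMDiffCovariantDerivative D ∞)
    (hΦ : ∀ x, SmoothAt (F →L[ℝ] F) Φ x) (hΨΦ : ∀ x v, Ψ x (Φ x v) = v)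
    (hΦΨ : ∀ x v, Φ x (Ψ x v) = v)
    (hD' : CovariantDerivative.ContMDiffCovariantDerivative (conjugate D hΦ hΨΦ) ∞) (x : M)
    (u v : TangentSpace (𝓡∂ 2) x) (f : E x) :
    curvature (conjugate D hΦ hΨΦ) hD' x u v f = Ψ x (curvature D hD x u v (Φ x f)) := by
  have h1 : curvature (conjugate D hΦ hΨΦ) hD' x u v f
      = Ψ x (curvatureAux D (FiberBundle.extend ℝ² u) (FiberBundle.extend ℝ² v)
        (fun y ↦ Φ y (localExtension F f y)) x) := by
    change curvatureAux (conjugate D hΦ hΨΦ) _ _ _ x = _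
    simp only [curvatureAux, conjugate_apply, hΦΨ, map_sub]
  have hs : SmoothNear F (fun y ↦ Φ y (localExtension F f y)) x :=
    SmoothNear.apply (Filter.Eventually.of_forall hΦ) (smoothNear_localExtension f)
  rw [h1, curvatureAux_eq_curvature hD hs (smoothNear_extend u) (smoothNear_extend v),
    FiberBundle.extend_apply_self, FiberBundle.extend_apply_self, localExtension_self]

theorem trace_curvature_conjugate (hD : CovariantDerivative.ContMDiffCovariantDerivative D ∞)
    (hΦ : ∀ x, SmoothAt (F →L[ℝ] F) Φ x) (hΨΦ : ∀ x v, Ψ x (Φ x v) = v)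
    (hΦΨ : ∀ x v, Φ x (Ψ x v) = v)
    (hD' : CovariantDerivative.ContMDiffCovariantDerivative (conjugate D hΦ hΨΦ) ∞)
    {K K' : ∀ y, E y →L[ℝ] E y} (hK : ∀ x v, K' x (Φ x v) = Φ x (K x v)) (x : M)
    (u v : TangentSpace (𝓡∂ 2) x) :
    LinearMap.trace ℝ (E x) ((K x : E x →ₗ[ℝ] E x) ∘ₗ curvature (conjugate D hΦ hΨΦ) hD' x u v)
      = LinearMap.trace ℝ (E x) ((K' x : E x →ₗ[ℝ] E x) ∘ₗ curvature D hD x u v) := by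
  let φ : E x ≃ₗ[ℝ] E x := LinearEquiv.ofLinearMap (Φ x : E x →ₗ[ℝ] E x) (Ψ x : E x →ₗ[ℝ] E x)
    (by ext f; exact hΦΨ x f) (by ext f; exact hΨΦ x f)
  rw [← LinearMap.trace_conj' _ φ]
  congr 1
  ext f
  rw [LinearEquiv.conj_apply_apply]
  change Φ x (K x (curvature (conjugate D hΦ hΨΦ) hD' x u v (Ψ x f))) = K' x _
  rw [← hK, curvature_conjugate hD hΦ hΨΦ hΦΨ, hΦΨ, hΦΨ]

theorem IsExteriorDerivative.linearCombination {β β' : ∀ x : M, TangentSpace (𝓡∂ 2) x →L[ℝ] ℂ}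
    {η η' : ∀ x : M, TangentSpace (𝓡∂ 2) x → TangentSpace (𝓡∂ 2) x → ℂ}
    (h : IsExteriorDerivative β η) (h' : IsExteriorDerivative β' η') (c c' : ℂ) :
    IsExteriorDerivative (fun x ↦ c • β x + c' • β' x)
      (fun x u v ↦ c * η x u v + c' * η' x u v) := by
  refine ⟨fun p w ↦ ?_, fun p z hz u v ↦ ?_⟩
  · exact ((h.contDiffOn p w).const_smul c).add ((h'.contDiffOn p w).const_smul c')
  · have hu := uniqueDiffOn_halfPlane z (extChartAt_target_subset_range p hz)
    have key : ∀ w, fderivWithin ℝ (fun z ↦ (c • β ((extChartAt (𝓡∂ 2) p).symm z)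
          + c' • β' ((extChartAt (𝓡∂ 2) p).symm z))
          (coordField p ((extChartAt (𝓡∂ 2) p).symm z) w)) (range (𝓡∂ 2)) z
        = c • fderivWithin ℝ (fun z ↦ β ((extChartAt (𝓡∂ 2) p).symm z)
          (coordField p ((extChartAt (𝓡∂ 2) p).symm z) w)) (range (𝓡∂ 2)) z
        + c' • fderivWithin ℝ (fun z ↦ β' ((extChartAt (𝓡∂ 2) p).symm z)
          (coordField p ((extChartAt (𝓡∂ 2) p).symm z) w)) (range (𝓡∂ 2)) z := fun w ↦
      (((h.differentiableWithinAt hz w).hasFDerivWithinAt.const_smul c).add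
        ((h'.differentiableWithinAt hz w).hasFDerivWithinAt.const_smul c')).fderivWithin hu
    rw [key, key, h.eq p z hz, h'.eq p z hz]
    simp only [add_apply, smul_apply, smul_eq_mul]
    ring

end Conjugation

/-! ### A primitive for the difference of the curvature traces -/

section Index

variable {M : Type*} [TopologicalSpace M] [T2Space M] [CompactSpace M]
  [ChartedSpace (EuclideanHalfSpace 2) M] [IsManifold (𝓡∂ 2) ∞ M]
  {F : Type*} [NormedAddCommGroup F] [NormedSpace ℝ F] [FiniteDimensional ℝ F]
  {E : M → Type*} [TopologicalSpace (TotalSpace F E)] [∀ x, AddCommGroup (E x)]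
  [∀ x, Module ℝ (E x)] [∀ x, TopologicalSpace (E x)] [∀ x, IsTopologicalAddGroup (E x)]
  [∀ x, ContinuousSMul ℝ (E x)] [FiberBundle F E] [VectorBundle ℝ F E]
  [ContMDiffVectorBundle ∞ F E (𝓡∂ 2)]
  {Ω : SymplecticStructure F E} {L : LagrangianSubbundle Ω} {J J' : CompatibleComplexStructure Ω}

/-- Lets the integral of the difference of the two traces be split. -/
theorem continuousOn_density_complexTrace (N : OrthogonalConnection L J) (p : M) :
    ContinuousOn (fun z ↦ density (fun x u v ↦
        complexTrace (J.J x : E x →ₗ[ℝ] E x) (curvature N.D N.smooth x u v)) p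
        ((extChartAt (𝓡∂ 2) p).symm z)) (extChartAt (𝓡∂ 2) p).target := by
  have h1 := continuousOn_trace_comp_curvature (K := fun y ↦ ContinuousLinearMap.id ℝ (E y))
    N.smooth (fun x ↦ smoothAt_hom_of_apply fun f ↦ smoothAt_constSection
      (FiberBundle.mem_baseSet_trivializationAt F E x) f) p (stdVec 0) (stdVec 1)
  have h2 := continuousOn_trace_comp_curvature N.smooth (smoothAt_J J) p (stdVec 0) (stdVec 1)
  exact ((Complex.continuous_ofReal.comp_continuousOn h1).sub (continuousOn_const.mul
    (Complex.continuous_ofReal.comp_continuousOn h2))).div_const _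

/-- The primitive is `(tr (D' - D) - i tr (J (D'' - D))) / 2`, where `D''` is the conjugate of `D'`
by the intertwiner. The two summands deliberately use different connections: `D''` may fail to be
unitary, and `D'` may fail to be `J`-linear. -/
theorem exists_primitive (N : OrthogonalConnection L J) (N' : OrthogonalConnection L J') :
    ∃ β : ∀ x : M, TangentSpace (𝓡∂ 2) x →L[ℝ] ℂ,
      IsExteriorDerivative β (fun x u v ↦
        complexTrace (J'.J x : E x →ₗ[ℝ] E x) (curvature N'.D N'.smooth x u v)
        - complexTrace (J.J x : E x →ₗ[ℝ] E x) (curvature N.D N.smooth x u v)) ∧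
      ∀ x ∈ (𝓡∂ 2).boundary M, ∀ v ∈ boundaryTangentSpace x, β x v = 0 := by
  obtain ⟨Φ, hΦ, hinj, hJ, hL⟩ := exists_intertwiner L J J'
  obtain ⟨Ψ, hΨ, hΨΦ, hΦΨ⟩ := exists_smooth_inverse hΦ hinj
  have hsm := conjugate_smooth N'.smooth hΦ hΨ hΨΦ
  have hlin : IsComplexLinear J (conjugate N'.D hΦ hΨΦ) := by
    intro s x hs v
    simp only [conjugate_apply, ← hJ]
    rw [N'.complexLinear _ x (DiffAt.apply (hΦ x) hs)]
    generalize N'.D (fun y ↦ Φ y (s y)) x v = w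
    rw [← hΨΦ x (J.J x (Ψ x w)), ← hJ, hΦΨ]
  -- An injective endomorphism of the finite-dimensional space `L` is onto, so `Φ L = L` and the
  -- inverse preserves `L` as well.
  have hΨL : ∀ y : (𝓡∂ 2).boundary M, ∀ v ∈ L.fiber y, Ψ y v ∈ L.fiber y := by
    intro y v hv
    have := finiteDimensional_fiber F (E := E) (y : M)
    have hi : Function.Injective ((Φ y : E y →ₗ[ℝ] E y).restrict (hL y)) := by
      intro a b hab
      have h1 : Φ y a = Φ y b := congrArg Subtype.val hab
      exact Subtype.ext (by rw [← hΨΦ y a, h1, hΨΦ])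
    obtain ⟨w, hw⟩ := LinearMap.injective_iff_surjective.1 hi ⟨v, hv⟩
    have h1 : Φ y w = v := congrArg Subtype.val hw
    rw [← h1, hΨΦ]
    exact w.2
  have hid : ∀ x, SmoothAt (F →L[ℝ] F) (fun y ↦ ContinuousLinearMap.id ℝ (E y)) x := fun x ↦
    smoothAt_hom_of_apply fun f ↦ smoothAt_constSection
      (FiberBundle.mem_baseSet_trivializationAt F E x) f
  have hre := isExteriorDerivative_traceForm (K := fun y ↦ ContinuousLinearMap.id ℝ (E y))
    N.smooth N'.smooth hid (fun _ _ _ _ ↦ rfl) (fun _ _ _ _ ↦ rfl)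
  have him := isExteriorDerivative_traceForm N.smooth hsm (smoothAt_J J) N.complexLinear hlin
  -- The coefficients are those of `tr A` and `tr (J A)` in `complexTrace`.
  have h := hre.linearCombination him (1 / 2) (-Complex.I / 2)
  refine ⟨fun x ↦ (1 / 2 : ℂ) • traceForm (fun y ↦ ContinuousLinearMap.id ℝ (E y)) N.D N'.D x
    + (-Complex.I / 2) • traceForm J.J N.D (conjugate N'.D hΦ hΨΦ) x,
    ⟨h.contDiffOn, fun p z hz u v ↦ (Eq.trans ?_ (h.eq p z hz u v))⟩, fun x hx v hv ↦ ?_⟩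
  -- Conjugation invariance replaces `tr (J F'')` by `tr (J' F')`, so the derivative is the
  -- difference of the original complex traces.
  · have h1 := trace_curvature_conjugate N'.smooth hΦ hΨΦ hΦΨ hsm hJ ((extChartAt (𝓡∂ 2) p).symm z)
      (coordField p _ u) (coordField p _ v)
    have h2 : ∀ x, ∀ A : E x →ₗ[ℝ] E x,
        (ContinuousLinearMap.id ℝ (E x) : E x →ₗ[ℝ] E x) ∘ₗ A = A := fun x A ↦ LinearMap.id_comp A
    rw [h1, h2, h2]
    simp only [complexTrace]
    push_cast
    ring
  · rw [add_apply, smul_apply, smul_apply, traceForm_id_eq_zero N.unitary N'.unitary hx hv,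
      traceForm_J_eq_zero (L := L) N.complexLinear hlin hx, smul_zero, smul_zero, add_zero]
    refine fun s hs hsL ↦ ⟨cov_mem_lagrangian N hx hs hsL hv, hΨL ⟨x, hx⟩ _ ?_⟩
    -- For a section `s` of `L`, the section `Φ s` lies in `L`; its `N'`-derivative stays in `L`,
    -- and `Ψ` brings it back to `L`.
    refine cov_mem_lagrangian N' hx (DiffAt.apply (hΦ x) hs) ?_ hv
    filter_upwards [hsL] with y hy hyb using hL ⟨y, hyb⟩ _ (hy hyb)

end Index

end ChernWeilMaslov

end

theorem mainTheorem6
    {M : Type*} [TopologicalSpace M] [T2Space M] [CompactSpace M]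
    [ChartedSpace (EuclideanHalfSpace 2) M] [IsManifold (𝓡∂ 2) ∞ M]
    (hM : ChernWeilMaslov.IsOriented M)
    {F : Type*} [NormedAddCommGroup F] [NormedSpace ℝ F] [FiniteDimensional ℝ F]
    {E : M → Type*} [TopologicalSpace (TotalSpace F E)] [∀ x, AddCommGroup (E x)]
    [∀ x, Module ℝ (E x)] [∀ x, TopologicalSpace (E x)] [∀ x, IsTopologicalAddGroup (E x)]
    [∀ x, ContinuousSMul ℝ (E x)] [FiberBundle F E] [VectorBundle ℝ F E]
    [ContMDiffVectorBundle ∞ F E (𝓡∂ 2)]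
    (Ω : ChernWeilMaslov.SymplecticStructure F E) (L : ChernWeilMaslov.LagrangianSubbundle Ω)
    (J₀ J₁ : ChernWeilMaslov.CompatibleComplexStructure Ω)
    (N₀ : ChernWeilMaslov.OrthogonalConnection L J₀)
    (N₁ : ChernWeilMaslov.OrthogonalConnection L J₁) :
    ChernWeilMaslov.chernWeilMaslovIndex N₀ = ChernWeilMaslov.chernWeilMaslovIndex N₁ := by
  obtain ⟨β, hβ, hβ0⟩ := ChernWeilMaslov.exists_primitive N₀ N₁
  have h1 := ChernWeilMaslov.surfaceIntegral_eq_zero hM hβ hβ0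
  rw [ChernWeilMaslov.surfaceIntegral_sub
    (ChernWeilMaslov.continuousOn_density_complexTrace N₁)
    (ChernWeilMaslov.continuousOn_density_complexTrace N₀), sub_eq_zero] at h1
  rw [ChernWeilMaslov.chernWeilMaslovIndex, ChernWeilMaslov.chernWeilMaslovIndex, h1]
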